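/- Let $\nu\ge 0$ be real and let $d>1$ be an integer. Let $T_\nu=-\partial_r^2+r^{-2}\left(\nu^2-\tfrac14\right)$ in $L^2((0,\infty))$ with domain $C_c^\infty((0,\infty))$, and denote its Friedrichs extension by the same letter. The operator $T_\nu+1$ has a bounded everywhere defined inverse, and $(T_\nu+1)^{-d-1}$ has an integral kernel $(T_\nu+1)^{-d-1}(r,q)$ that is continuous on $(0,\infty)\times(0,\infty)$. For every complex $s$ with $$\max\{-2-2d,\,-2-2\nu\}<\operatorname{Re}(s)<-1$$ the function $r\mapsto r^s\,(T_\nu+1)^{-d-1}(r,r)$ is integrable on $(0,\infty)$, its regularised integral over $(0,\infty)$ exists and coincides with the ordinary integral, and $$ {-\!\!\!\!\!\int}_0^\infty r^s\,(T_\nu+1)^{-d-1}(r,r)\,dr =\frac{\Gamma\left(d+1+\frac s2\right)\Gamma\left(-\frac12-\frac s2\right)\Gamma\left(\nu+1+\frac s2\right)}{4\sqrt{\pi}\,d!\,\Gamma\left(\nu-\frac s2\right)} . $$ Here the regularised integral ${-\!\!\!\!\!\int}_0^\infty g(r)\,dr$ of a function $g$ on $(0,\infty)$ is the constant term of the Laurent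 expansion at $w=0$ of $F(w)+G(w)$, where $F$ and $G$ are the meromorphic continuations, to half-planes containing $w=0$, of $w\mapsto\int_0^1 r^w g(r)\,dr$ (defined for large $\operatorname{Re}w$) and of $w\mapsto\int_1^\infty r^w g(r)\,dr$ (defined for very negative $\operatorname{Re}w$). -/

import Mathlib

open MeasureTheory Filter Topology Set
open scoped Distributions ContDiff InnerProductSpace

noncomputable section

namespace FriedrichsKernel

/-! ### The Friedrichs extension of a nonnegative operator -/

section Friedrichs

variable {H : Type*} [NormedAddCommGroup H] [InnerProductSpace ℂ H]

/-- The operator `T` is nonnegative: `0 ≤ Re ⟪u, T u⟫` on its domain. -/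
def IsNonneg (T : H →ₗ.[ℂ] H) : Prop :=
  ∀ u : T.domain, 0 ≤ (⟪(u : H), T u⟫_ℂ).re

/-- The quadratic form `Re ⟪u, T u⟫` on the domain of `T`. -/
def form (T : H →ₗ.[ℂ] H) (u : T.domain) : ℝ := (⟪(u : H), T u⟫_ℂ).re

theorem form_add_add_form_sub (T : H →ₗ.[ℂ] H) (u v : T.domain) :
    form T (u + v) + form T (u - v) = 2 * form T u + 2 * form T v := by
  simp only [form, Submodule.coe_add, Submodule.coe_sub, LinearPMap.map_add, LinearPMap.map_sub,
    inner_add_left, inner_add_right, inner_sub_left, inner_sub_right, Complex.add_re,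
    Complex.sub_re]
  ring

theorem form_smul (T : H →ₗ.[ℂ] H) (c : ℂ) (u : T.domain) :
    form T (c • u) = ‖c‖ ^ 2 * form T u := by
  simp only [form, Submodule.coe_smul, LinearPMap.map_smul, inner_smul_left, inner_smul_right]
  rw [← mul_assoc, Complex.mul_conj', ← Complex.ofReal_pow, Complex.re_ofReal_mul]

/-- The form domain of a nonnegative operator `T`: the vectors `u ∈ H` that are limits in `H` of a
sequence in the domain of `T` which is Cauchy for the quadratic form of `T`. -/
def formDomain (T : H →ₗ.[ℂ] H) (hT : IsNonneg T) : Submodule ℂ H where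
  carrier := {u | ∃ x : ℕ → T.domain, Tendsto (fun n => (x n : H)) atTop (𝓝 u) ∧
    Tendsto (fun p : ℕ × ℕ => form T (x p.1 - x p.2)) atTop (𝓝 0)}
  zero_mem' := ⟨fun _ => 0, by simp, by simp [form]⟩
  add_mem' := by
    rintro u v ⟨x, hx, hx'⟩ ⟨y, hy, hy'⟩
    refine ⟨fun n => x n + y n, by simpa using hx.add hy, ?_⟩
    have h0 : Tendsto (fun p : ℕ × ℕ => 2 * form T (x p.1 - x p.2) + 2 * form T (y p.1 - y p.2))
        atTop (𝓝 0) := by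
      simpa using (hx'.const_mul 2).add (hy'.const_mul 2)
    refine squeeze_zero (fun p => hT _) (fun p => ?_) h0
    have h1 := form_add_add_form_sub T (x p.1 - x p.2) (y p.1 - y p.2)
    have h2 : 0 ≤ form T ((x p.1 - x p.2) - (y p.1 - y p.2)) := hT _
    have h3 : x p.1 + y p.1 - (x p.2 + y p.2) = (x p.1 - x p.2) + (y p.1 - y p.2) := by abel
    rw [h3]
    linarith
  smul_mem' := by
    rintro c u ⟨x, hx, hx'⟩
    refine ⟨fun n => c • x n, by simpa using hx.const_smul c, ?_⟩
    simpa [← smul_sub, form_smul] using hx'.const_mul (‖c‖ ^ 2)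

/-- The Friedrichs extension of a densely defined nonnegative symmetric operator `T`:
the restriction of the adjoint of `T` to the vectors in the form domain of `T`. -/
def friedrichsExtension [CompleteSpace H] (T : H →ₗ.[ℂ] H) (hT : IsNonneg T) : H →ₗ.[ℂ] H :=
  T.adjoint.domRestrict (formDomain T hT)

/-- `R` is the bounded everywhere defined inverse `(A + c)⁻¹` of the operator `A + c`, which maps
the domain of `A` to `H`. -/
def IsResolvent (A : H →ₗ.[ℂ] H) (c : ℂ) (R : H →L[ℂ] H) : Prop :=
  (∀ f : H, ∃ h : R f ∈ A.domain, A ⟨R f, h⟩ + c • R f = f) ∧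
    ∀ u : A.domain, R (A u + c • (u : H)) = u

end Friedrichs

/-! ### The operator `-∂ᵣ² + r⁻² (ν² - 1/4)` on the half-line -/

/-- The open half-line `(0, ∞)`. -/
def halfLine : TopologicalSpace.Opens ℝ := ⟨Ioi 0, isOpen_Ioi⟩

/-- The Hilbert space `L²((0, ∞))` of complex functions. -/
abbrev L2HalfLine : Type := Lp ℂ 2 (volume.restrict (Ioi (0 : ℝ)))

/-- The differential expression `-u'' + r⁻² (ν² - 1/4) u`. -/
def besselExpr (ν : ℝ) (u : ℝ → ℂ) (r : ℝ) : ℂ :=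
  -deriv (deriv u) r + ((ν ^ 2 - 1 / 4) / r ^ 2 : ℝ) * u r

theorem eventually_zero (u : 𝓓(halfLine, ℂ)) {r : ℝ} (hr : r ≤ 0) : u =ᶠ[𝓝 r] 0 :=
  notMem_tsupport_iff_eventuallyEq.1 fun h => absurd (u.tsupport_subset h) (not_lt.2 hr)

theorem contDiff_top (u : 𝓓(halfLine, ℂ)) : ContDiff ℝ ∞ u := u.contDiff

theorem contDiff_deriv (u : 𝓓(halfLine, ℂ)) : ContDiff ℝ ∞ (deriv u) :=
  ((contDiff_infty_iff_deriv).1 (contDiff_top u)).2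

theorem contDiff_deriv_deriv (u : 𝓓(halfLine, ℂ)) : ContDiff ℝ ∞ (deriv (deriv u)) :=
  ((contDiff_infty_iff_deriv).1 (contDiff_deriv u)).2

theorem besselExpr_continuous (ν : ℝ) (u : 𝓓(halfLine, ℂ)) : Continuous (besselExpr ν u) := by
  refine (contDiff_deriv_deriv u).continuous.neg.add ?_
  rw [continuous_iff_continuousAt]
  intro r
  rcases le_or_gt r 0 with hr | hr
  · have h : (fun _ : ℝ => (0 : ℂ)) =ᶠ[𝓝 r]
        fun x => (((ν ^ 2 - 1 / 4) / x ^ 2 : ℝ) : ℂ) * u x := by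
      filter_upwards [eventually_zero u hr] with x hx
      simp [hx]
    exact continuousAt_const.congr h
  · have h : ContinuousAt (fun x : ℝ => (ν ^ 2 - 1 / 4) / x ^ 2) r :=
      continuousAt_const.div (by fun_prop) (by positivity)
    exact (Complex.continuous_ofReal.continuousAt.comp h).mul u.continuous.continuousAt

theorem besselExpr_hasCompactSupport (ν : ℝ) (u : 𝓓(halfLine, ℂ)) :
    HasCompactSupport (besselExpr ν u) :=
  (u.hasCompactSupport.deriv.deriv.neg).add (u.hasCompactSupport.mul_left)

/-- The inclusion of the test functions on `(0, ∞)` in `L²((0, ∞))`. -/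
def testToL2 : 𝓓(halfLine, ℂ) →ₗ[ℂ] L2HalfLine where
  toFun u := (u.continuous.memLp_of_hasCompactSupport u.hasCompactSupport).toLp u
  map_add' _ _ := rfl
  map_smul' _ _ := rfl

/-- The map `u ↦ -u'' + r⁻² (ν² - 1/4) u` from the test functions on `(0, ∞)` to `L²((0, ∞))`. -/
def besselToL2 (ν : ℝ) : 𝓓(halfLine, ℂ) →ₗ[ℂ] L2HalfLine where
  toFun u := ((besselExpr_continuous ν u).memLp_of_hasCompactSupport
    (besselExpr_hasCompactSupport ν u)).toLp (besselExpr ν u)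
  map_add' u v := by
    rw [← MemLp.toLp_add]
    congr 1
    funext r
    have h1 : deriv (u + v : 𝓓(halfLine, ℂ)) = deriv u + deriv v := by
      funext x
      exact deriv_add ((contDiff_top u).differentiable (by simp) x)
        ((contDiff_top v).differentiable (by simp) x)
    have h2 : deriv (deriv u + deriv v) r = deriv (deriv u) r + deriv (deriv v) r :=
      deriv_add ((contDiff_deriv u).differentiable (by simp) r)
        ((contDiff_deriv v).differentiable (by simp) r)
    simp only [besselExpr, h1, h2, Pi.add_apply]
    rw [FunLike.coe_add, Pi.add_apply]
    ring
  map_smul' c u := by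
    simp only [RingHom.id_apply]
    rw [← MemLp.toLp_const_smul]
    congr 1
    funext r
    have h1 : deriv (c • u : 𝓓(halfLine, ℂ)) = c • deriv u := by
      funext x
      exact deriv_const_smul c ((contDiff_top u).differentiable (by simp) x)
    have h2 : deriv (c • deriv u) r = c • deriv (deriv u) r :=
      deriv_const_smul c ((contDiff_deriv u).differentiable (by simp) r)
    simp only [besselExpr, h1, h2, Pi.smul_apply]
    rw [FunLike.coe_smul, Pi.smul_apply, smul_eq_mul, smul_eq_mul]
    ring

theorem testToL2_injective : Function.Injective testToL2 := by
  intro u v huv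
  have h1 : (u : ℝ → ℂ) =ᵐ[volume.restrict (Ioi (0 : ℝ))] v := by
    exact (MemLp.toLp_eq_toLp_iff
      (u.continuous.memLp_of_hasCompactSupport u.hasCompactSupport)
      (v.continuous.memLp_of_hasCompactSupport v.hasCompactSupport)).1 huv
  have h2 : EqOn u v (Ioi (0 : ℝ)) :=
    Measure.eqOn_open_of_ae_eq h1 isOpen_Ioi u.continuous.continuousOn v.continuous.continuousOn
  ext r
  rcases le_or_gt r 0 with hr | hr
  · rw [(eventually_zero u hr).eq_of_nhds, (eventually_zero v hr).eq_of_nhds]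
  · exact h2 hr

/-- The operator `T_ν = -∂ᵣ² + r⁻² (ν² - 1/4)` in `L²((0, ∞))` with domain `C_c^∞((0, ∞))`. -/
def besselOp (ν : ℝ) : L2HalfLine →ₗ.[ℂ] L2HalfLine where
  domain := LinearMap.range testToL2
  toFun := (besselToL2 ν).comp
    (LinearEquiv.ofInjective testToL2 testToL2_injective).symm.toLinearMap

theorem besselOp_apply (ν : ℝ) (u : 𝓓(halfLine, ℂ)) :
    besselOp ν ⟨testToL2 u, LinearMap.mem_range_self _ u⟩ = besselToL2 ν u := by
  have h : (LinearEquiv.ofInjective testToL2 testToL2_injective).symm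
      ⟨testToL2 u, LinearMap.mem_range_self _ u⟩ = u := by
    rw [LinearEquiv.symm_apply_eq]
    rfl
  exact congrArg (besselToL2 ν) h

/-- Hardy's inequality: `T_ν` is nonnegative on `C_c^∞((0, ∞))`. -/
theorem besselOp_isNonneg (ν : ℝ) : IsNonneg (besselOp ν) := by
  rintro ⟨_, u, rfl⟩
  rw [besselOp_apply, L2.inner_def]
  have hu0 : ∀ r : ℝ, r ≤ 0 → u r = 0 := fun r hr => (eventually_zero u hr).eq_of_nhds
  have hd1 : ∀ r, HasDerivAt u (deriv u r) r := fun r =>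
    ((contDiff_top u).differentiable (by simp) r).hasDerivAt
  have hd2 : ∀ r, HasDerivAt (deriv u) (deriv (deriv u) r) r := fun r =>
    ((contDiff_deriv u).differentiable (by simp) r).hasDerivAt
  have hint0 : Integrable (fun r => ⟪u r, besselExpr ν u r⟫_ℂ) :=
    (u.continuous.inner (besselExpr_continuous ν u)).integrable_of_hasCompactSupport
      (u.hasCompactSupport.mono fun r hr h => hr (by simp [h]))
  have e1 : ∫ r in Ioi (0 : ℝ), ⟪(testToL2 u : ℝ → ℂ) r, (besselToL2 ν u : ℝ → ℂ) r⟫_ℂ =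
      ∫ r : ℝ, ⟪u r, besselExpr ν u r⟫_ℂ := by
    rw [← setIntegral_eq_integral_of_forall_compl_eq_zero (s := Ioi (0 : ℝ))
      (f := fun r => ⟪u r, besselExpr ν u r⟫_ℂ)]
    · apply integral_congr_ae
      have a1 : (testToL2 u : ℝ → ℂ) =ᵐ[volume.restrict (Ioi (0 : ℝ))] u :=
        MemLp.coeFn_toLp (u.continuous.memLp_of_hasCompactSupport u.hasCompactSupport)
      have a2 : (besselToL2 ν u : ℝ → ℂ) =ᵐ[volume.restrict (Ioi (0 : ℝ))] besselExpr ν u :=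
        MemLp.coeFn_toLp ((besselExpr_continuous ν u).memLp_of_hasCompactSupport
          (besselExpr_hasCompactSupport ν u))
      filter_upwards [a1, a2] with r h1 h2
      rw [h1, h2]
    · intro r hr
      rw [hu0 r (not_lt.1 hr), inner_zero_left]
  rw [e1]
  have e2 : (∫ r : ℝ, ⟪u r, besselExpr ν u r⟫_ℂ).re = ∫ r : ℝ, ⟪u r, besselExpr ν u r⟫_ℝ := by
    have := integral_re hint0
    simp only [RCLike.re_to_complex] at this
    rw [← this]
    rfl
  rw [e2]
  have hint1 : Integrable (fun r => ⟪u r, besselExpr ν u r⟫_ℝ) := hint0.re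
  set φ : ℝ → ℝ := fun r => -⟪u r, deriv u r⟫_ℝ + (2 * r)⁻¹ * ⟪u r, u r⟫_ℝ with hφ
  have hφ' : ∀ r, ∃ c, HasDerivAt φ c r ∧ c ≤ ⟪u r, besselExpr ν u r⟫_ℝ := by
    intro r
    rcases le_or_gt r 0 with hr | hr
    · refine ⟨0, ?_, by rw [hu0 r hr, inner_zero_left]⟩
      have : φ =ᶠ[𝓝 r] fun _ => 0 := by
        filter_upwards [eventually_zero u hr] with x hx
        simp [hφ, hx]
      exact (hasDerivAt_const r (0 : ℝ)).congr_of_eventuallyEq this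
    · have k1 := (hd1 r).inner ℝ (hd2 r)
      have k2 := (hd1 r).inner ℝ (hd1 r)
      have k3 : HasDerivAt (fun x : ℝ => (2 * x)⁻¹) (-(2 * 1) / (2 * r) ^ 2) r :=
        ((hasDerivAt_id r).const_mul 2).inv (by simpa using hr.ne')
      refine ⟨_, k1.neg.add (k3.mul k2), ?_⟩
      have k4 : 0 ≤ ⟪deriv u r - (2 * r)⁻¹ • u r, deriv u r - (2 * r)⁻¹ • u r⟫_ℝ :=
        real_inner_self_nonneg
      have k5 : 0 ≤ ν ^ 2 / r ^ 2 * ⟪u r, u r⟫_ℝ :=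
        mul_nonneg (by positivity) real_inner_self_nonneg
      have k6 : besselExpr ν u r =
          -deriv (deriv u) r + ((ν ^ 2 - 1 / 4) / r ^ 2 : ℝ) • u r := by
        rw [besselExpr, Complex.real_smul]
      rw [k6]
      simp only [inner_add_right, inner_neg_right, inner_smul_right, inner_sub_left,
        inner_sub_right, real_inner_smul_left] at k4 ⊢
      have k7 : ⟪deriv u r, u r⟫_ℝ = ⟪u r, deriv u r⟫_ℝ := real_inner_comm _ _
      rw [k7] at k4 ⊢
      have k8 : (2 * r)⁻¹ * ((2 * r)⁻¹ * ⟪u r, u r⟫_ℝ) = 1 / 4 / r ^ 2 * ⟪u r, u r⟫_ℝ := by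
        field_simp
        ring
      have k9 : -(2 * 1) / (2 * r) ^ 2 = -(2 * (1 / 4 / r ^ 2)) := by
        field_simp
        ring
      have k10 : (ν ^ 2 - 1 / 4) / r ^ 2 = ν ^ 2 / r ^ 2 - 1 / 4 / r ^ 2 := by ring
      rw [k9, k10]
      rw [mul_sub, k8] at k4
      nlinarith [k4, k5]
  have hφd : Differentiable ℝ φ := fun r => (hφ' r).choose_spec.1.differentiableAt
  have hφc : HasCompactSupport φ :=
    u.hasCompactSupport.mono fun r hr h => hr (by simp [hφ, h])
  obtain ⟨a, b, hab⟩ : ∃ a b : ℝ, tsupport u ⊆ Ioo a b := by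
    obtain ⟨C, hC⟩ := u.hasCompactSupport.isCompact.isBounded.subset_closedBall 0
    refine ⟨-C - 1, C + 1, fun x hx => ?_⟩
    have := hC hx
    rw [mem_closedBall_zero_iff, Real.norm_eq_abs, abs_le] at this
    constructor <;> linarith [this.1, this.2]
  have hout : ∀ r, r ∉ Ioo a b → u r = 0 := fun r hr =>
    image_eq_zero_of_notMem_tsupport fun h => hr (hab h)
  rcases le_or_gt b a with hba | hba
  · have : ∀ r, ⟪u r, besselExpr ν u r⟫_ℝ = 0 := fun r => by
      rw [hout r (fun h => absurd (h.1.trans h.2) (not_lt.2 hba)), inner_zero_left]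
    simp [this]
  have e3 : ∫ r : ℝ, ⟪u r, besselExpr ν u r⟫_ℝ = ∫ r in a..b, ⟪u r, besselExpr ν u r⟫_ℝ := by
    rw [intervalIntegral.integral_of_le hba.le,
      setIntegral_eq_integral_of_forall_compl_eq_zero]
    intro r hr
    rw [hout r fun h => hr ⟨h.1, h.2.le⟩, inner_zero_left]
  rw [e3]
  have hfin := intervalIntegral.sub_le_integral_of_hasDeriv_right_of_le hba.le
    hφd.continuous.continuousOn
    (fun x _ => (hφ' x).choose_spec.1.hasDerivWithinAt)
    hint1.integrableOn (fun x _ => (hφ' x).choose_spec.2)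
  have ha : φ a = 0 := by simp [hφ, hout a (by simp)]
  have hb : φ b = 0 := by simp [hφ, hout b (by simp)]
  linarith

/-- The Friedrichs extension of `T_ν = -∂ᵣ² + r⁻² (ν² - 1/4)`. -/
def besselFriedrichs (ν : ℝ) : L2HalfLine →ₗ.[ℂ] L2HalfLine :=
  friedrichsExtension (besselOp ν) (besselOp_isNonneg ν)

/-! ### Integral kernels and regularised integrals -/

/-- `k` is a continuous integral kernel on `(0, ∞) × (0, ∞)` of the bounded operator `A`. -/
def IsContinuousKernel (A : L2HalfLine →L[ℂ] L2HalfLine) (k : ℝ → ℝ → ℂ) : Prop :=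
  ContinuousOn (Function.uncurry k) (Ioi 0 ×ˢ Ioi 0) ∧
    ∀ f : L2HalfLine, ∀ᵐ r ∂volume.restrict (Ioi (0 : ℝ)),
      IntegrableOn (fun q => k r q * f q) (Ioi 0) ∧
        (A f : ℝ → ℂ) r = ∫ q in Ioi (0 : ℝ), k r q * f q

/-- `c` is the constant term of the Laurent expansion of the function `F` at `0`. -/
def IsConstantTerm (F : ℂ → ℂ) (c : ℂ) : Prop :=
  ∃ p : Polynomial ℂ, p.coeff 0 = 0 ∧
    Tendsto (fun w => F w - p.eval w⁻¹) (𝓝[≠] 0) (𝓝 c)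

/-- The regularised integral of `g` over `(0, ∞)` exists and equals `c`: the functions
`w ↦ ∫₀¹ r ^ w g(r) dr` (for large `Re w`) and `w ↦ ∫₁^∞ r ^ w g(r) dr` (for very negative `Re w`)
continue meromorphically to half-planes that contain `0`, and `c` is the constant term at `w = 0` of
the sum of the two continuations. -/
def IsRegularizedIntegral (g : ℝ → ℂ) (c : ℂ) : Prop :=
  ∃ (F G : ℂ → ℂ) (δ a b : ℝ), 0 < δ ∧
    MeromorphicOn F {w | -δ < w.re} ∧ MeromorphicOn G {w | w.re < δ} ∧
    (∀ w : ℂ, a < w.re → IntegrableOn (fun r : ℝ => (r : ℂ) ^ w * g r) (Ioc 0 1) ∧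
      F w = ∫ r in Ioc (0 : ℝ) 1, (r : ℂ) ^ w * g r) ∧
    (∀ w : ℂ, w.re < b → IntegrableOn (fun r : ℝ => (r : ℂ) ^ w * g r) (Ioi 1) ∧
      G w = ∫ r in Ioi (1 : ℝ), (r : ℂ) ^ w * g r) ∧
    IsConstantTerm (fun w => F w + G w) c

end FriedrichsKernel

end

/-! Everything rests on the functions f_b(r) = r^(ν+1/2) exp(-b r²), b > 0, on which T_ν is
explicit: T_ν f_b = (4b(ν+1) - 4b² r²) f_b. Hence u_t = (1+4at)^(-ν-1) f_{a/(1+4at)} solves u' =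
-T_ν u with u_0 = f_a, and (T_ν+1)^(-d-1) f_a has to be (1/d!) ∫ t^d e^(-t) u_t dt. Neither the
spectral theorem nor a semigroup is needed for this: pair u_t with a fixed vector and integrate by
parts in t (`inner_resolvent_pow_powGaussL2`).

Two facts make this usable. Each f_b lies in the Friedrichs domain (`besselFriedrichs_powGauss`); in
the borderline case ν = 0 this forces a logarithmic cutoff at the origin. And the f_b span a dense
subspace, by injectivity of the Laplace transform in r² (`span_powGaussL2_dense`). The inverse of
T_ν + 1 exists because the Friedrichs extension A is closed, ‖u‖ ≤ ‖(A+1)u‖, and a vector orthogonal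
to the range is orthogonal to every f_a (`existsUnique_isResolvent`).

For the kernel, a Gaussian integral of the modified Bessel function shows that u_t is the image of
f_a under the heat kernel √(rq)/(2t) · exp(-(r²+q²)/(4t)) · I_ν(rq/(2t))
(`integral_besselHeatKernel_mul_powGauss`). Integrating against t^d e^(-t)/d! gives a continuous
kernel which represents the resolvent power on the f_a, and by density on all of L²
(`isContinuousKernel_resolventPowKernel`). A continuous kernel is unique
(`IsContinuousKernel.eqOn`), so only the diagonal of this one matters.

With φ(x) = e^(-x) I_ν(x), the diagonal is (r/d!) ∫ t^d e^(-t) (2t)⁻¹ φ(r²/(2t)) dt, a superposition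
of dilates of φ. The Mellin transform turns this into a product: the weight contributes Γ(d+1+s/2),
and the transform of φ contributes the other gamma factors. Poisson's integral makes φ itself a
superposition of dilates, of (y/2)^ν e^(-y) with a beta weight, so its transform is a gamma function
times a beta integral. The stated strip of s is where all of these integrals converge. The strip is
open, so the two truncated integrals are holomorphic near w = 0, there is no polar part, and the
regularised integral is the ordinary one. -/

namespace FriedrichsKernel

/-! ### Friedrichs extensions of abstract operators: positivity, closedness, resolvent at 1. -/

section Abstract

variable {H : Type*} [NormedAddCommGroup H] [InnerProductSpace ℂ H]

theorem form_add_le {T : H →ₗ.[ℂ] H} (hT : IsNonneg T) (u v : T.domain) :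
    form T (u + v) ≤ 2 * form T u + 2 * form T v := by
  have h1 := form_add_add_form_sub T u v
  have h2 : 0 ≤ form T (u - v) := hT _
  linarith

theorem form_sub_eq {T : H →ₗ.[ℂ] H} (hs : T.IsFormalAdjoint T) (u v : T.domain) :
    form T (u - v) = form T u + form T v - 2 * (⟪T u, (v : H)⟫_ℂ).re := by
  have h1 : (⟪(v : H), T u⟫_ℂ).re = (⟪T u, (v : H)⟫_ℂ).re := by
    rw [← inner_conj_symm, Complex.conj_re]
  simp only [form, Submodule.coe_sub, LinearPMap.map_sub, inner_sub_left, inner_sub_right,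
    Complex.sub_re, h1, hs u v]
  ring

variable [CompleteSpace H] {T : H →ₗ.[ℂ] H}

/-- The Friedrichs extension restricts the adjoint, so its action is determined weakly, by testing
against the original domain only. -/
theorem exists_friedrichsExtension_eq (hT : IsNonneg T) (hd : Dense (T.domain : Set H))
    {u w : H} (hu : u ∈ formDomain T hT) (h : ∀ x : T.domain, ⟪w, (x : H)⟫_ℂ = ⟪u, T x⟫_ℂ) :
    ∃ hu : u ∈ (friedrichsExtension T hT).domain, friedrichsExtension T hT ⟨u, hu⟩ = w :=
  ⟨⟨hu, LinearPMap.mem_adjoint_domain_of_exists u ⟨w, h⟩⟩,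
    LinearPMap.adjoint_apply_eq hd ⟨u, LinearPMap.mem_adjoint_domain_of_exists u ⟨w, h⟩⟩ h⟩

theorem friedrichsExtension_inner (hT : IsNonneg T) (hd : Dense (T.domain : Set H))
    (u : (friedrichsExtension T hT).domain) (x : T.domain) :
    ⟪friedrichsExtension T hT u, (x : H)⟫_ℂ = ⟪(u : H), T x⟫_ℂ :=
  LinearPMap.adjoint_isFormalAdjoint hd ⟨u, u.2.2⟩ x

theorem mem_formDomain (hT : IsNonneg T) (u : (friedrichsExtension T hT).domain) :
    (u : H) ∈ formDomain T hT := u.2.1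

/-- Along an approximating sequence of `u`, the form stays controlled by `⟪u, A u⟫`. -/
theorem eventually_form_le (hT : IsNonneg T) (hs : T.IsFormalAdjoint T)
    (hd : Dense (T.domain : Set H)) (u : (friedrichsExtension T hT).domain) {x : ℕ → T.domain}
    (hx : Tendsto (fun n => (x n : H)) atTop (𝓝 (u : H)))
    (hx' : Tendsto (fun p : ℕ × ℕ => form T (x p.1 - x p.2)) atTop (𝓝 0)) {ε : ℝ} (hε : 0 < ε) :
    ∀ᶠ j in atTop, form T (x j) ≤ 2 * (⟪(u : H), friedrichsExtension T hT u⟫_ℂ).re + ε := by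
  set w := friedrichsExtension T hT u with hw
  have h1 := (tendsto_order.1 hx').2 (ε / 2) (by positivity)
  obtain ⟨⟨N, M⟩, hN⟩ := eventually_atTop.1 h1
  -- Expand form (x j - x k) by `form_sub_eq`, drop form (x k) ≥ 0 and let k → ∞; then ⟪T (x j), u⟫
  -- = ⟪x j, w⟫. Dropping form (x k) costs the factor 2.
  have h2 : ∀ j, N ≤ j → form T (x j) ≤ ε / 2 + 2 * (⟪(x j : H), w⟫_ℂ).re := by
    intro j hj
    have h3 : Tendsto (fun k => ε / 2 + 2 * (⟪T (x j), (x k : H)⟫_ℂ).re) atTop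
        (𝓝 (ε / 2 + 2 * (⟪T (x j), (u : H)⟫_ℂ).re)) :=
      ((Complex.continuous_re.tendsto _).comp
        ((tendsto_const_nhds (x := T (x j))).inner hx)).const_mul 2 |>.const_add _
    have h4 : ⟪T (x j), (u : H)⟫_ℂ = ⟪(x j : H), w⟫_ℂ := by
      rw [← inner_conj_symm, ← friedrichsExtension_inner hT hd, inner_conj_symm]
    rw [← h4]
    refine ge_of_tendsto h3 ?_
    filter_upwards [eventually_ge_atTop M] with k hk
    have h5 : form T (x j - x k) < ε / 2 := hN (j, k) ⟨hj, hk⟩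
    have h6 : 0 ≤ form T (x k) := hT _
    rw [form_sub_eq hs] at h5
    linarith
  have h3 : Tendsto (fun j => 2 * (⟪(x j : H), w⟫_ℂ).re) atTop (𝓝 (2 * (⟪(u : H), w⟫_ℂ).re)) :=
    ((Complex.continuous_re.tendsto _).comp (hx.inner tendsto_const_nhds)).const_mul 2
  filter_upwards [eventually_ge_atTop N,
    (tendsto_order.1 h3).2 (2 * (⟪(u : H), w⟫_ℂ).re + ε / 2) (by linarith)] with j hj hj'
  linarith [h2 j hj]

theorem friedrichsExtension_nonneg (hT : IsNonneg T) (hs : T.IsFormalAdjoint T)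
    (hd : Dense (T.domain : Set H)) (u : (friedrichsExtension T hT).domain) :
    0 ≤ (⟪(u : H), friedrichsExtension T hT u⟫_ℂ).re := by
  obtain ⟨x, hx, hx'⟩ := mem_formDomain hT u
  by_contra! h
  -- If the value c is negative, the choice ε = -c gives form (x j) ≤ 2c - c = c < 0.
  obtain ⟨j, hj⟩ := (eventually_form_le hT hs hd u hx hx' (ε := -(⟪(u : H),
    friedrichsExtension T hT u⟫_ℂ).re) (by linarith)).exists
  have : 0 ≤ form T (x j) := hT _
  linarith

/-- The Friedrichs extension is a closed operator. -/
theorem friedrichsExtension_closed (hT : IsNonneg T) (hs : T.IsFormalAdjoint T)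
    (hd : Dense (T.domain : Set H)) {u : ℕ → (friedrichsExtension T hT).domain} {v w : H}
    (hu : Tendsto (fun n => (u n : H)) atTop (𝓝 v))
    (hw : Tendsto (fun n => friedrichsExtension T hT (u n)) atTop (𝓝 w)) :
    ∃ hv : v ∈ (friedrichsExtension T hT).domain, friedrichsExtension T hT ⟨v, hv⟩ = w := by
  refine exists_friedrichsExtension_eq hT hd ?_ fun x => ?_
  · choose x hx hx' using fun n => mem_formDomain hT (u n)
    have h1 : ∀ n : ℕ, ∀ᶠ j in atTop, dist (x n j : H) (u n) < 1 / ((n : ℝ) + 1) :=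
      fun n => Metric.tendsto_nhds.1 (hx n) _ (by positivity)
    have h2 : ∀ n : ℕ, ∃ N, ∀ j k, N ≤ j → N ≤ k → form T (x n j - x n k) < 1 / ((n : ℝ) + 1) := by
      intro n
      obtain ⟨⟨N, M⟩, hN⟩ := eventually_atTop.1
        ((tendsto_order.1 (hx' n)).2 (1 / ((n : ℝ) + 1)) (by positivity))
      exact ⟨max N M, fun j k hj hk => hN (j, k)
        ⟨(le_max_left _ _).trans hj, (le_max_right _ _).trans hk⟩⟩
    choose N hN using h2
    have h3 : ∀ n : ℕ, ∃ j, N n ≤ j ∧ dist (x n j : H) (u n) < 1 / ((n : ℝ) + 1) := fun n =>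
      ((eventually_ge_atTop (N n)).and (h1 n)).exists
    choose J hJ hJ' using h3
    have hlim : Tendsto (fun n : ℕ => 1 / ((n : ℝ) + 1)) atTop (𝓝 0) :=
      tendsto_one_div_add_atTop_nhds_zero_nat
    -- Diagonal sequence: J n is so late that x n (J n) is close to u n in norm and to all later x n
    -- j in form.
    refine ⟨fun n => x n (J n), ?_, ?_⟩
    · have h4 : Tendsto (fun n => dist (x n (J n) : H) (u n)) atTop (𝓝 0) :=
        squeeze_zero (fun _ => dist_nonneg) (fun n => (hJ' n).le) hlim
      exact (tendsto_iff_of_dist h4).2 hu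
    · set q : ℕ × ℕ → ℝ := fun p =>
        4 * (1 / ((p.1 : ℝ) + 1)) + 4 * (1 / ((p.2 : ℝ) + 1)) +
          4 * |(⟪(u p.1 : H) - u p.2, friedrichsExtension T hT (u p.1) - friedrichsExtension T hT (u p.2)⟫_ℂ).re| with hq
      have key : ∀ p : ℕ × ℕ, form T (x p.1 (J p.1) - x p.2 (J p.2)) ≤ 4 * q p + 
          4 * (1 / ((p.1 : ℝ) + 1)) := by
        rintro ⟨n, m⟩
        have a1 : Tendsto (fun j => ((x n j - x m j : T.domain) : H)) atTop
            (𝓝 ((u n - u m : (friedrichsExtension T hT).domain) : H)) := by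
          simpa using (hx n).sub (hx m)
        have a2 : Tendsto (fun p : ℕ × ℕ => form T ((x n p.1 - x m p.1) - (x n p.2 - x m p.2)))
            atTop (𝓝 0) := by
          have h0 : Tendsto (fun p : ℕ × ℕ => 2 * form T (x n p.1 - x n p.2) +
              2 * form T (x m p.2 - x m p.1)) atTop (𝓝 0) := by
            rw [← prod_atTop_atTop_eq] at hx' ⊢
            have := (hx' m).comp (tendsto_prod_iff'.2 ⟨tendsto_snd, tendsto_fst⟩ : Tendsto Prod.swap _ _)
            simpa using ((hx' n).const_mul 2).add (this.const_mul 2)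
          refine squeeze_zero (fun p => hT _) (fun p => ?_) h0
          rw [show x n p.1 - x m p.1 - (x n p.2 - x m p.2) =
            (x n p.1 - x n p.2) + (x m p.2 - x m p.1) by abel]
          exact form_add_le hT _ _
        -- Pass from x n (J n) to x m (J m) through x n j and x m j for one late j. The outer
        -- differences are small by the choice of J; the middle one is controlled by applying
        -- `eventually_form_le` to u n - u m. The constants in `q` are generous.
        obtain ⟨j, hj1, hj2, hj3⟩ := ((eventually_ge_atTop (N n)).and
          ((eventually_ge_atTop (N m)).and
          (eventually_form_le hT hs hd (u n - u m) a1 a2 (ε := 1 / ((n : ℝ) + 1))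
            (by positivity)))).exists
        have b1 := (hN n (J n) j (hJ n) hj1).le
        have b2 := (hN m j (J m) hj2 (hJ m)).le
        have b3 := form_add_le hT (x n (J n) - x n j) ((x n j - x m j) + (x m j - x m (J m)))
        have b4 := form_add_le hT (x n j - x m j) (x m j - x m (J m))
        have b5 : x n (J n) - x m (J m) =
          (x n (J n) - x n j) + ((x n j - x m j) + (x m j - x m (J m))) := by abel
        have b6 : (⟪((u n - u m : (friedrichsExtension T hT).domain) : H), friedrichsExtension T hT (u n - u m)⟫_ℂ).re ≤
            |(⟪(u n : H) - u m, friedrichsExtension T hT (u n) - friedrichsExtension T hT (u m)⟫_ℂ).re| := by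
          rw [LinearPMap.map_sub]
          exact le_abs_self _
        have b7 : 0 < 1 / ((n : ℝ) + 1) := by positivity
        have b8 : 0 < 1 / ((m : ℝ) + 1) := by positivity
        have b9 := abs_nonneg (⟪(u n : H) - u m, friedrichsExtension T hT (u n) - friedrichsExtension T hT (u m)⟫_ℂ).re
        simp only [hq]
        rw [b5]
        linarith
      have c1 : Tendsto (fun p : ℕ × ℕ => 1 / ((p.1 : ℝ) + 1)) atTop (𝓝 0) :=
        hlim.comp (tendsto_fst.mono_left prod_atTop_atTop_eq.ge)
      have c2 : Tendsto (fun p : ℕ × ℕ => 1 / ((p.2 : ℝ) + 1)) atTop (𝓝 0) :=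
        hlim.comp (tendsto_snd.mono_left prod_atTop_atTop_eq.ge)
      have d1 : Tendsto (fun p : ℕ × ℕ => (u p.1 : H) - u p.2) atTop (𝓝 (v - v)) :=
        (hu.comp (tendsto_fst.mono_left prod_atTop_atTop_eq.ge)).sub
          (hu.comp (tendsto_snd.mono_left prod_atTop_atTop_eq.ge))
      have d2 : Tendsto (fun p : ℕ × ℕ => friedrichsExtension T hT (u p.1) - friedrichsExtension T hT (u p.2)) atTop (𝓝 (w - w)) :=
        (hw.comp (tendsto_fst.mono_left prod_atTop_atTop_eq.ge)).sub
          (hw.comp (tendsto_snd.mono_left prod_atTop_atTop_eq.ge))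
      have d3 : Tendsto (fun p : ℕ × ℕ => |(⟪(u p.1 : H) - u p.2, friedrichsExtension T hT (u p.1) - friedrichsExtension T hT (u p.2)⟫_ℂ).re|)
          atTop (𝓝 0) := by
        have := ((Complex.continuous_re.tendsto _).comp (d1.inner (𝕜 := ℂ) d2)).abs
        rw [sub_self, inner_zero_left, Complex.zero_re, abs_zero] at this
        exact this
      have c3 : Tendsto (fun p : ℕ × ℕ => 4 * q p + 4 * (1 / ((p.1 : ℝ) + 1))) atTop (𝓝 0) := by
        have c4 := ((((c1.const_mul 4).add (c2.const_mul 4)).add (d3.const_mul 4)).const_mul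
          4).add (c1.const_mul 4)
        simp only [mul_zero, add_zero] at c4
        exact c4
      exact squeeze_zero (fun p => hT _) key c3
  · have h1 : Tendsto (fun n => ⟪friedrichsExtension T hT (u n), (x : H)⟫_ℂ) atTop (𝓝 ⟪w, (x : H)⟫_ℂ) :=
      hw.inner tendsto_const_nhds
    have h2 : Tendsto (fun n => ⟪(u n : H), T x⟫_ℂ) atTop (𝓝 ⟪v, T x⟫_ℂ) :=
      hu.inner tendsto_const_nhds
    refine tendsto_nhds_unique h1 (h2.congr fun n => ?_)
    exact (friedrichsExtension_inner hT hd (u n) x).symm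

omit [CompleteSpace H] in
theorem IsResolvent.unique {A : H →ₗ.[ℂ] H} {c : ℂ} {R R' : H →L[ℂ] H} (h : IsResolvent A c R)
    (h' : IsResolvent A c R') : R = R' := by
  ext f
  obtain ⟨hf, hf'⟩ := h.1 f
  have := h'.2 ⟨R f, hf⟩
  rw [hf'] at this
  exact this.symm

/-- Positivity gives ‖u‖² ≤ Re ⟪u, A u + u⟫, and Cauchy–Schwarz does the rest. This bound supplies
injectivity, closed range and the norm bound 1 for the inverse. -/
theorem norm_le_norm_friedrichsExtension_add (hT : IsNonneg T) (hs : T.IsFormalAdjoint T)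
    (hd : Dense (T.domain : Set H)) (u : (friedrichsExtension T hT).domain) :
    ‖(u : H)‖ ≤ ‖friedrichsExtension T hT u + u‖ := by
  have h1 := friedrichsExtension_nonneg hT hs hd u
  have h2 : ‖(u : H)‖ ^ 2 ≤ ‖(u : H)‖ * ‖friedrichsExtension T hT u + u‖ := by
    calc ‖(u : H)‖ ^ 2 ≤ (⟪(u : H), friedrichsExtension T hT u + u⟫_ℂ).re := by
          rw [inner_add_right, Complex.add_re, inner_self_eq_norm_sq_to_K]
          have h3 : ((‖(u : H)‖ : ℂ) ^ 2).re = ‖(u : H)‖ ^ 2 := by norm_cast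
          have h4 : ((RCLike.ofReal ‖(u : H)‖ : ℂ) ^ 2).re = ‖(u : H)‖ ^ 2 := h3
          rw [h4]
          linarith
      _ ≤ _ := re_inner_le_norm (𝕜 := ℂ) _ _
  rcases (norm_nonneg (u : H)).eq_or_lt with h | h
  · rw [← h]
    positivity
  · rw [pow_two] at h2
    exact le_of_mul_le_mul_left h2 h

/-- If `A + 1` has dense range, where `A` is the Friedrichs extension of `T`, then it has a bounded
everywhere defined inverse. -/
theorem exists_isResolvent (hT : IsNonneg T) (hs : T.IsFormalAdjoint T)
    (hd : Dense (T.domain : Set H))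
    (hrange : ∀ g : H, (∀ u : (friedrichsExtension T hT).domain,
      ⟪g, friedrichsExtension T hT u + u⟫_ℂ = 0) → g = 0) :
    ∃ R : H →L[ℂ] H, IsResolvent (friedrichsExtension T hT) 1 R := by
  set A := friedrichsExtension T hT with hA
  set B : A.domain →ₗ[ℂ] H := A.toFun + A.domain.subtype with hB
  have hBapp : ∀ u : A.domain, B u = A u + u := fun u => rfl
  have hbound : ∀ u : A.domain, ‖(u : H)‖ ≤ ‖B u‖ :=
    norm_le_norm_friedrichsExtension_add hT hs hd
  have hdense : (LinearMap.range B).topologicalClosure = ⊤ := by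
    rw [Submodule.topologicalClosure_eq_top_iff, Submodule.eq_bot_iff]
    intro g hg
    refine hrange g fun u => ?_
    rw [← inner_conj_symm, ← hBapp, (Submodule.mem_orthogonal _ _).1 hg _ ⟨u, rfl⟩, map_zero]
  -- The range is dense, and it is closed: by `hbound` a convergent sequence of images has Cauchy
  -- preimages, and A is closed.
  have hsurj : Function.Surjective B := by
    intro f
    have hf : f ∈ closure (LinearMap.range B : Set H) := by
      have : f ∈ (LinearMap.range B).topologicalClosure := hdense ▸ Submodule.mem_top
      exact this
    obtain ⟨y, hy, hyf⟩ := mem_closure_iff_seq_limit.1 hf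
    choose u hu using hy
    have hc : CauchySeq fun n => (u n : H) := by
      rw [Metric.cauchySeq_iff']
      intro ε hε
      obtain ⟨N, hN⟩ := Metric.cauchySeq_iff'.1 hyf.cauchySeq ε hε
      refine ⟨N, fun n hn => lt_of_le_of_lt ?_ (hN n hn)⟩
      rw [dist_eq_norm, dist_eq_norm, ← hu, ← hu, ← map_sub, ← Submodule.coe_sub]
      exact hbound _
    obtain ⟨v, hv⟩ := cauchySeq_tendsto_of_complete hc
    have hw : Tendsto (fun n => A (u n)) atTop (𝓝 (f - v)) := by
      refine (hyf.sub hv).congr fun n => ?_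
      rw [← hu, hBapp, add_sub_cancel_right]
    obtain ⟨h1, h2⟩ := friedrichsExtension_closed hT hs hd hv hw
    refine ⟨⟨v, h1⟩, ?_⟩
    rw [hBapp]
    change A ⟨v, h1⟩ + v = f
    rw [h2, sub_add_cancel]
  have hinj : Function.Injective B := by
    rw [injective_iff_map_eq_zero]
    intro u hu
    have := hbound u
    rw [hu, norm_zero] at this
    exact Subtype.ext (norm_le_zero_iff.1 this)
  set e := LinearEquiv.ofBijective B ⟨hinj, hsurj⟩ with he
  set R : H →L[ℂ] H := (A.domain.subtype ∘ₗ e.symm.toLinearMap).mkContinuous 1 (fun f => by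
    have := hbound (e.symm f)
    rw [show B (e.symm f) = f from e.apply_symm_apply f] at this
    simpa using this) with hR
  have hRapp : ∀ f, R f = (e.symm f : H) := fun f => rfl
  refine ⟨R, fun f => ⟨(e.symm f).2, ?_⟩, fun u => ?_⟩
  · rw [one_smul]
    exact e.apply_symm_apply f
  · rw [one_smul, hRapp]
    exact congrArg Subtype.val (e.symm_apply_apply u)

end Abstract

/-! ### Test functions on the half-line -/

theorem inner_eq_integral {u v : L2HalfLine} {f g : ℝ → ℂ}
    (hu : u =ᵐ[volume.restrict (Ioi (0 : ℝ))] f) (hv : v =ᵐ[volume.restrict (Ioi (0 : ℝ))] g) :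
    ⟪u, v⟫_ℂ = ∫ r in Ioi (0 : ℝ), starRingEnd ℂ (f r) * g r := by
  rw [L2.inner_def]
  refine integral_congr_ae ?_
  filter_upwards [hu, hv] with r h1 h2
  rw [h1, h2, RCLike.inner_apply']

theorem testToL2_ae (u : 𝓓(halfLine, ℂ)) :
    (testToL2 u : ℝ → ℂ) =ᵐ[volume.restrict (Ioi (0 : ℝ))] u :=
  MemLp.coeFn_toLp (u.continuous.memLp_of_hasCompactSupport u.hasCompactSupport)

theorem besselToL2_ae (ν : ℝ) (u : 𝓓(halfLine, ℂ)) :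
    (besselToL2 ν u : ℝ → ℂ) =ᵐ[volume.restrict (Ioi (0 : ℝ))] besselExpr ν u :=
  MemLp.coeFn_toLp ((besselExpr_continuous ν u).memLp_of_hasCompactSupport
    (besselExpr_hasCompactSupport ν u))

theorem hasDerivAt_test (u : 𝓓(halfLine, ℂ)) (r : ℝ) : HasDerivAt u (deriv u r) r :=
  ((contDiff_top u).differentiable (by simp) r).hasDerivAt

theorem hasDerivAt_deriv_test (u : 𝓓(halfLine, ℂ)) (r : ℝ) :
    HasDerivAt (deriv u) (deriv (deriv u) r) r :=
  ((contDiff_deriv u).differentiable (by simp) r).hasDerivAt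

/-- The factor g may be singular at 0 and arbitrary to its left, because u vanishes near every r ≤
0. Products of this kind can therefore be integrated by parts over the whole line, without boundary
terms. -/
theorem continuous_mul_of_eventually_zero {R : Type*} [NormedRing R] {g u : ℝ → R}
    (hg : ContinuousOn g (Ioi 0)) (hu : Continuous u) (h0 : ∀ r ≤ 0, u =ᶠ[𝓝 r] 0) :
    Continuous fun r => g r * u r := by
  rw [continuous_iff_continuousAt]
  intro r
  rcases le_or_gt r 0 with hr | hr
  · have h : (fun _ : ℝ => (0 : R)) =ᶠ[𝓝 r] fun x => g x * u x := by
      filter_upwards [h0 r hr] with x hx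
      simp [hx]
    exact continuousAt_const.congr h
  · exact (hg.continuousAt (Ioi_mem_nhds hr)).mul hu.continuousAt

theorem integrable_mul_of_eventually_zero {R : Type*} [NormedRing R] {g u : ℝ → R}
    (hg : ContinuousOn g (Ioi 0)) (hu : Continuous u) (h0 : ∀ r ≤ 0, u =ᶠ[𝓝 r] 0)
    (hc : HasCompactSupport u) : Integrable fun r => g r * u r :=
  (continuous_mul_of_eventually_zero hg hu h0).integrable_of_hasCompactSupport hc.mul_left

theorem eventually_zero_deriv {F : Type*} [NormedAddCommGroup F] [NormedSpace ℝ F] {u : ℝ → F}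
    {r : ℝ} (h : u =ᶠ[𝓝 r] 0) : deriv u =ᶠ[𝓝 r] 0 := by
  have := h.deriv
  simpa using this

theorem continuousOn_potential (ν : ℝ) :
    ContinuousOn (fun r : ℝ => (ν ^ 2 - 1 / 4) / r ^ 2) (Ioi 0) :=
  continuousOn_const.div (by fun_prop) fun r hr => pow_ne_zero 2 (ne_of_gt hr)

/-- Green's identity for the differential expression and a test function. -/
theorem integral_conj_mul_besselExpr (ν : ℝ) {f f₁ f₂ : ℝ → ℂ}
    (h1 : ∀ r, 0 < r → HasDerivAt f (f₁ r) r) (h2 : ∀ r, 0 < r → HasDerivAt f₁ (f₂ r) r)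
    (hc : ContinuousOn f₂ (Ioi 0)) (u : 𝓓(halfLine, ℂ)) :
    ∫ r in Ioi (0 : ℝ), starRingEnd ℂ (f r) * besselExpr ν u r =
      ∫ r in Ioi (0 : ℝ),
        starRingEnd ℂ (-f₂ r + ((ν ^ 2 - 1 / 4) / r ^ 2 : ℝ) * f r) * u r := by
  have hc0 : ContinuousOn f (Ioi 0) := fun r hr => (h1 r hr).continuousAt.continuousWithinAt
  have hc1 : ContinuousOn f₁ (Ioi 0) := fun r hr => (h2 r hr).continuousAt.continuousWithinAt
  have conjC : ∀ {g : ℝ → ℂ}, ContinuousOn g (Ioi 0) →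
      ContinuousOn (fun r => starRingEnd ℂ (g r)) (Ioi 0) := fun hg =>
    Complex.continuous_conj.comp_continuousOn hg
  have z0 : ∀ r ≤ 0, (u : ℝ → ℂ) =ᶠ[𝓝 r] 0 := fun r hr => eventually_zero u hr
  have z1 : ∀ r ≤ 0, deriv u =ᶠ[𝓝 r] 0 := fun r hr => eventually_zero_deriv (z0 r hr)
  have z2 : ∀ r ≤ 0, deriv (deriv u) =ᶠ[𝓝 r] 0 := fun r hr => eventually_zero_deriv (z1 r hr)
  have iA := integrable_mul_of_eventually_zero (conjC hc0) (contDiff_deriv u).continuous z1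
    u.hasCompactSupport.deriv
  have iB := integrable_mul_of_eventually_zero (conjC hc1) u.continuous z0 u.hasCompactSupport
  have iC := integrable_mul_of_eventually_zero (conjC hc0) (contDiff_deriv_deriv u).continuous z2
    u.hasCompactSupport.deriv.deriv
  have iD := integrable_mul_of_eventually_zero (conjC hc) u.continuous z0 u.hasCompactSupport
  have zb : ∀ r ≤ 0, besselExpr ν u =ᶠ[𝓝 r] 0 := fun r hr => by
    filter_upwards [z0 r hr, z2 r hr] with x hx hx2
    simp [besselExpr, hx, hx2]
  have iE := integrable_mul_of_eventually_zero (conjC hc0) (besselExpr_continuous ν u) zb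
    (besselExpr_hasCompactSupport ν u)
  have iF : Integrable fun r =>
      starRingEnd ℂ (-f₂ r + ((ν ^ 2 - 1 / 4) / r ^ 2 : ℝ) * f r) * u r :=
    integrable_mul_of_eventually_zero
    (conjC (hc.neg.add ((Complex.continuous_ofReal.comp_continuousOn
      (continuousOn_potential ν)).mul hc0))) u.continuous z0 u.hasCompactSupport
  -- The Wronskian of conj f and u is integrable on the line, so its derivative has integral zero.
  -- The potential terms cancel in the difference of the two sides, which leaves exactly minus this
  -- derivative.
  have hW : ∀ r, HasDerivAt (fun r => starRingEnd ℂ (f r) * deriv u r - starRingEnd ℂ (f₁ r) * u r)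
      (starRingEnd ℂ (f r) * deriv (deriv u) r - starRingEnd ℂ (f₂ r) * u r) r := by
    intro r
    rcases le_or_gt r 0 with hr | hr
    · have e : (fun r => starRingEnd ℂ (f r) * deriv u r - starRingEnd ℂ (f₁ r) * u r) =ᶠ[𝓝 r]
          fun _ => 0 := by
        filter_upwards [z0 r hr, z1 r hr] with x hx hx1
        simp [hx, hx1]
      rw [(z0 r hr).eq_of_nhds, (z2 r hr).eq_of_nhds]
      simpa using (hasDerivAt_const r (0 : ℂ)).congr_of_eventuallyEq e
    · have d1 : HasDerivAt (fun r => starRingEnd ℂ (f r)) (starRingEnd ℂ (f₁ r)) r :=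
        (h1 r hr).star
      have d2 : HasDerivAt (fun r => starRingEnd ℂ (f₁ r)) (starRingEnd ℂ (f₂ r)) r :=
        (h2 r hr).star
      convert! (d1.mul (hasDerivAt_deriv_test u r)).sub (d2.mul (hasDerivAt_test u r)) using 1
      ring
  have h0 := integral_eq_zero_of_hasDerivAt_of_integrable hW (iC.sub iD) (iA.sub iB)
  rw [← setIntegral_eq_integral_of_forall_compl_eq_zero (s := Ioi (0 : ℝ))] at h0
  swap
  · intro r hr
    rw [(z0 r (not_lt.1 hr)).eq_of_nhds, (z2 r (not_lt.1 hr)).eq_of_nhds]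
    simp
  rw [← sub_eq_zero, ← integral_sub iE.integrableOn iF.integrableOn, ← neg_eq_zero,
    ← integral_neg, ← h0]
  refine integral_congr_ae (Eventually.of_forall fun r => ?_)
  simp only [besselExpr, map_add, map_neg, map_mul, Complex.conj_ofReal]
  ring

theorem besselOp_isFormalAdjoint (ν : ℝ) : (besselOp ν).IsFormalAdjoint (besselOp ν) := by
  rintro ⟨_, u, rfl⟩ ⟨_, v, rfl⟩
  rw [besselOp_apply, besselOp_apply, inner_eq_integral (besselToL2_ae ν u) (testToL2_ae v),
    inner_eq_integral (testToL2_ae u) (besselToL2_ae ν v),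
    integral_conj_mul_besselExpr ν (fun r _ => hasDerivAt_test u r)
      (fun r _ => hasDerivAt_deriv_test u r) (contDiff_deriv_deriv u).continuous.continuousOn]
  rfl

/-- A real smooth function with compact support in the half-line, as a complex test function. -/
def testOfReal (ψ : ℝ → ℝ) (h1 : ContDiff ℝ ∞ ψ) (h2 : HasCompactSupport ψ)
    (h3 : tsupport ψ ⊆ Ioi 0) : 𝓓(halfLine, ℂ) where
  toFun r := (ψ r : ℂ)
  contDiff' := Complex.ofRealCLM.contDiff.comp h1
  hasCompactSupport' := h2.comp_left Complex.ofReal_zero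
  tsupport_subset' := (closure_mono (Function.support_comp_subset Complex.ofReal_zero ψ)).trans h3

theorem testOfReal_apply {ψ : ℝ → ℝ} (h1 : ContDiff ℝ ∞ ψ) (h2 : HasCompactSupport ψ)
    (h3 : tsupport ψ ⊆ Ioi 0) (r : ℝ) : testOfReal ψ h1 h2 h3 r = ψ r := rfl

/-- By the fundamental lemma of the calculus of variations, orthogonality to the real test functions
already forces a vector to vanish. -/
theorem besselOp_dense (ν : ℝ) : Dense ((besselOp ν).domain : Set L2HalfLine) := by
  rw [Submodule.dense_iff_topologicalClosure_eq_top, Submodule.topologicalClosure_eq_top_iff,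
    Submodule.eq_bot_iff]
  intro g hg
  have h1 : ∀ᵐ r ∂volume.restrict (Ioi (0 : ℝ)), r ∈ Ioi (0 : ℝ) → (g : ℝ → ℂ) r = 0 := by
    refine isOpen_Ioi.ae_eq_zero_of_integral_contDiff_smul_eq_zero
      (((Lp.memLp g).locallyIntegrable (by norm_num)).locallyIntegrableOn _) fun ψ a1 a2 a3 => ?_
    have h2 := (Submodule.mem_orthogonal _ _).1 hg (testToL2 (testOfReal ψ a1 a2 a3))
      (LinearMap.mem_range_self _ _)
    rw [inner_eq_integral (testToL2_ae _) (ae_eq_refl g)] at h2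
    rw [← h2]
    refine integral_congr_ae (Eventually.of_forall fun r => ?_)
    simp [testOfReal_apply]
  rw [Lp.eq_zero_iff_ae_eq_zero]
  filter_upwards [h1, ae_restrict_mem measurableSet_Ioi] with r hr hr'
  exact hr hr'

/-- The form of `T_ν` at a product `ζ f` of a cutoff function and a smooth function. -/
theorem form_besselOp_mul (ν : ℝ) {ζ f f₁ f₂ : ℝ → ℝ} (hζ : ContDiff ℝ ∞ ζ)
    (hζc : HasCompactSupport ζ) (hζs : ∀ r ≤ 0, ζ =ᶠ[𝓝 r] 0)
    (h1 : ∀ r, 0 < r → HasDerivAt f (f₁ r) r) (h2 : ∀ r, 0 < r → HasDerivAt f₁ (f₂ r) r)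
    (hc : ContinuousOn f₂ (Ioi 0)) (u : 𝓓(halfLine, ℂ)) (hu : ∀ r, u r = (ζ r * f r : ℝ)) :
    form (besselOp ν) ⟨testToL2 u, LinearMap.mem_range_self _ u⟩ =
      ∫ r in Ioi (0 : ℝ), (ζ r ^ 2 * (f r * (-f₂ r + (ν ^ 2 - 1 / 4) / r ^ 2 * f r)) +
        deriv ζ r ^ 2 * f r ^ 2) := by
  have hζ1 : ContDiff ℝ ∞ (deriv ζ) := ((contDiff_infty_iff_deriv).1 hζ).2
  have hζ2 : ContDiff ℝ ∞ (deriv (deriv ζ)) := ((contDiff_infty_iff_deriv).1 hζ1).2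
  have e1 : ∀ r, HasDerivAt ζ (deriv ζ r) r := fun r => (hζ.differentiable (by simp) r).hasDerivAt
  have e2 : ∀ r, HasDerivAt (deriv ζ) (deriv (deriv ζ) r) r := fun r =>
    (hζ1.differentiable (by simp) r).hasDerivAt
  have z1 : ∀ r ≤ 0, deriv ζ =ᶠ[𝓝 r] 0 := fun r hr => eventually_zero_deriv (hζs r hr)
  have z2 : ∀ r ≤ 0, deriv (deriv ζ) =ᶠ[𝓝 r] 0 := fun r hr => eventually_zero_deriv (z1 r hr)
  have hc0 : ContinuousOn f (Ioi 0) := fun r hr => (h1 r hr).continuousAt.continuousWithinAt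
  have hc1 : ContinuousOn f₁ (Ioi 0) := fun r hr => (h2 r hr).continuousAt.continuousWithinAt
  have du : ∀ r, 0 < r → deriv u r = (deriv ζ r * f r + ζ r * f₁ r : ℝ) := by
    intro r hr
    have : (u : ℝ → ℂ) = fun r => ((ζ r * f r : ℝ) : ℂ) := funext hu
    rw [this]
    exact (((e1 r).mul (h1 r hr)).ofReal_comp).deriv
  have ddu : ∀ r, 0 < r → deriv (deriv u) r =
      (deriv (deriv ζ) r * f r + 2 * deriv ζ r * f₁ r + ζ r * f₂ r : ℝ) := by
    intro r hr
    have : deriv u =ᶠ[𝓝 r] fun r => ((deriv ζ r * f r + ζ r * f₁ r : ℝ) : ℂ) := by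
      filter_upwards [Ioi_mem_nhds hr] with x hx
      exact du x hx
    rw [this.deriv_eq]
    refine ((((e2 r).mul (h1 r hr)).add ((e1 r).mul (h2 r hr))).ofReal_comp).deriv.trans ?_
    congr 1
    ring
  -- `D` is the derivative of f² ζ ζ'. Pointwise, ζf · T(ζf) = ζ² f · Tf + ζ'² f² - D (the IMS
  -- localisation identity), and D integrates to zero.
  set D : ℝ → ℝ := fun r => (deriv ζ r ^ 2 + ζ r * deriv (deriv ζ) r) * f r ^ 2 +
    2 * ζ r * deriv ζ r * f r * f₁ r with hD
  have hW : ∀ r, HasDerivAt (fun r => f r ^ 2 * (ζ r * deriv ζ r)) (D r) r := by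
    intro r
    rcases le_or_gt r 0 with hr | hr
    · have e : (fun r => f r ^ 2 * (ζ r * deriv ζ r)) =ᶠ[𝓝 r] fun _ => 0 := by
        filter_upwards [hζs r hr] with x hx
        simp [hx]
      have : D r = 0 := by
        simp [hD, (hζs r hr).eq_of_nhds, (z1 r hr).eq_of_nhds]
      rw [this]
      exact (hasDerivAt_const r (0 : ℝ)).congr_of_eventuallyEq e
    · convert! ((h1 r hr).pow 2).mul ((e1 r).mul (e2 r)) using 1
      simp only [hD, Pi.pow_apply, Pi.mul_apply]
      ring
  have q1 : Continuous fun r => ζ r * deriv ζ r := hζ.continuous.mul hζ1.continuous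
  have q2 : ∀ r ≤ 0, (fun r => ζ r * deriv ζ r) =ᶠ[𝓝 r] 0 := fun r hr => by
    filter_upwards [hζs r hr] with x hx
    simp [hx]
  have iW := integrable_mul_of_eventually_zero (hc0.pow 2) q1 q2 hζc.mul_right
  have iD1 := integrable_mul_of_eventually_zero ((hc0.pow 2).mul hζ1.continuous.continuousOn)
    hζ1.continuous z1 hζc.deriv
  have iD2 := integrable_mul_of_eventually_zero
    ((hc0.pow 2).mul hζ2.continuous.continuousOn) hζ.continuous hζs hζc
  have iD3 := integrable_mul_of_eventually_zero
    (((hc0.mul hc1).mul hζ1.continuous.continuousOn)) hζ.continuous hζs hζc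
  have iD : Integrable D := by
    refine ((iD1.add iD2).add (iD3.const_mul 2)).congr (Eventually.of_forall fun r => ?_)
    simp only [hD, Pi.add_apply, Pi.mul_apply, Pi.pow_apply]
    ring
  have iM := integrable_mul_of_eventually_zero
    ((hζ.continuous.continuousOn).mul (hc0.mul (hc.neg.add ((continuousOn_potential ν).mul hc0))))
    hζ.continuous hζs hζc
  have h0 := integral_eq_zero_of_hasDerivAt_of_integrable hW iD iW
  rw [← setIntegral_eq_integral_of_forall_compl_eq_zero (s := Ioi (0 : ℝ))] at h0
  swap
  · intro r hr
    simp [hD, (hζs r (not_lt.1 hr)).eq_of_nhds, (z1 r (not_lt.1 hr)).eq_of_nhds]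
  have iall : IntegrableOn (fun r => ζ r ^ 2 * (f r * (-f₂ r + (ν ^ 2 - 1 / 4) / r ^ 2 * f r)) +
        deriv ζ r ^ 2 * f r ^ 2) (Ioi (0 : ℝ)) := by
    refine ((iM.add iD1).congr (Eventually.of_forall fun r => ?_)).integrableOn
    simp only [Pi.add_apply, Pi.neg_apply, Pi.mul_apply, Pi.pow_apply]
    ring
  have hsum := integral_sub iall iD.integrableOn
  rw [h0, sub_zero] at hsum
  suffices hform : ⟪testToL2 u, besselToL2 ν u⟫_ℂ = ((∫ r in Ioi (0 : ℝ),
      (ζ r ^ 2 * (f r * (-f₂ r + (ν ^ 2 - 1 / 4) / r ^ 2 * f r)) +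
        deriv ζ r ^ 2 * f r ^ 2 - D r) : ℝ) : ℂ) by
    rw [← hsum, form, besselOp_apply, hform, Complex.ofReal_re]
  rw [inner_eq_integral (testToL2_ae u) (besselToL2_ae ν u), ← integral_complex_ofReal]
  refine setIntegral_congr_fun measurableSet_Ioi fun r hr => ?_
  simp only [besselExpr]
  rw [ddu r hr, hu, Complex.conj_ofReal]
  simp only [hD]
  push_cast
  ring

/-! ### The functions `r ^ p * exp (-b r ^ 2)` -/

/-- The function `r ^ p * exp (-b r ^ 2)`. -/
noncomputable def powGauss (p b r : ℝ) : ℝ := r ^ p * Real.exp (-b * r ^ 2)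

theorem powGauss_pos (p b : ℝ) {r : ℝ} (hr : 0 < r) : 0 < powGauss p b r := by
  unfold powGauss
  positivity

theorem measurable_powGauss (p b : ℝ) : Measurable (powGauss p b) := by
  unfold powGauss
  fun_prop

theorem powGauss_mul_powGauss (p q b c : ℝ) {r : ℝ} (hr : 0 < r) :
    powGauss p b r * powGauss q c r = powGauss (p + q) (b + c) r := by
  simp only [powGauss]
  rw [Real.rpow_add hr, show -(b + c) * r ^ 2 = -b * r ^ 2 + -c * r ^ 2 by ring, Real.exp_add]
  ring

theorem powGauss_sq (p b : ℝ) {r : ℝ} (hr : 0 < r) :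
    powGauss p b r ^ 2 = powGauss (2 * p) (2 * b) r := by
  rw [pow_two, powGauss_mul_powGauss _ _ _ _ hr, two_mul, two_mul]

theorem rpow_mul_powGauss (p q b : ℝ) {r : ℝ} (hr : 0 < r) :
    r ^ q * powGauss p b r = powGauss (p + q) b r := by
  simp only [powGauss]
  rw [Real.rpow_add hr]
  ring

theorem sq_mul_powGauss (p b : ℝ) {r : ℝ} (hr : 0 < r) :
    r ^ 2 * powGauss p b r = powGauss (p + 2) b r := by
  rw [← rpow_mul_powGauss p 2 b hr, Real.rpow_two]

theorem integrableOn_powGauss {p b : ℝ} (hp : -1 < p) (hb : 0 < b) :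
    IntegrableOn (powGauss p b) (Ioi 0) :=
  integrableOn_rpow_mul_exp_neg_mul_sq hb hp

theorem integral_powGauss {p b : ℝ} (hp : -1 < p) (hb : 0 < b) :
    ∫ r in Ioi (0 : ℝ), powGauss p b r =
      b ^ (-(p + 1) / 2) * (1 / 2) * Real.Gamma ((p + 1) / 2) := by
  rw [← integral_rpow_mul_exp_neg_mul_rpow (p := 2) two_pos hp hb]
  simp only [powGauss, Real.rpow_two]

theorem memLp_powGauss {p b : ℝ} (hp : -1 / 2 < p) (hb : 0 < b) :
    MemLp (fun r => (powGauss p b r : ℂ)) 2 (volume.restrict (Ioi (0 : ℝ))) := by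
  have hm : AEStronglyMeasurable (fun r => (powGauss p b r : ℂ)) (volume.restrict (Ioi (0 : ℝ))) :=
    (Complex.measurable_ofReal.comp (measurable_powGauss p b)).aestronglyMeasurable
  rw [memLp_two_iff_integrable_sq_norm hm]
  refine IntegrableOn.congr_fun (integrableOn_powGauss (p := 2 * p) (b := 2 * b) (by linarith)
    (by linarith)) (fun r hr => ?_) measurableSet_Ioi
  rw [← powGauss_sq p b hr, Complex.norm_real, Real.norm_eq_abs, sq_abs]

/-- The element `r ^ p * exp (-b r ^ 2)` of `L²((0, ∞))`. -/
noncomputable def powGaussL2 (p b : ℝ) (hp : -1 / 2 < p) (hb : 0 < b) : L2HalfLine :=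
  (memLp_powGauss hp hb).toLp

theorem powGaussL2_ae {p b : ℝ} (hp : -1 / 2 < p) (hb : 0 < b) :
    powGaussL2 p b hp hb =ᵐ[volume.restrict (Ioi (0 : ℝ))] fun r => (powGauss p b r : ℂ) :=
  MemLp.coeFn_toLp _

theorem exists_rpow_mul_exp_le {p c : ℝ} (hp : 0 ≤ p) (hc : 0 < c) :
    ∃ M, 0 ≤ M ∧ ∀ x : ℝ, 0 ≤ x → x ^ p * Real.exp (-c * x) ≤ M := by
  obtain ⟨n, hn⟩ := exists_nat_ge p
  -- With n ≥ p, x^p ≤ 1 + x^n, while (c x)^n / n! ≤ exp (c x) and 1 ≤ exp (c x).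
  refine ⟨1 + n.factorial / c ^ n, by positivity, fun x hx => ?_⟩
  have h1 : x ^ p ≤ 1 + x ^ n := by
    rcases le_total x 1 with h | h
    · have := Real.rpow_le_one hx h hp
      have : 0 ≤ x ^ n := by positivity
      linarith
    · have := Real.rpow_le_rpow_of_exponent_le h hn
      rw [Real.rpow_natCast] at this
      linarith
  have h2 := Real.pow_div_factorial_le_exp (c * x) (by positivity) n
  have h3 : x ^ n ≤ n.factorial / c ^ n * Real.exp (c * x) := by
    rw [mul_pow, div_le_iff₀ (by positivity)] at h2
    rw [div_mul_eq_mul_div, le_div_iff₀ (by positivity)]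
    linarith
  have h4 : 1 ≤ Real.exp (c * x) := Real.one_le_exp (by positivity)
  have h5 : Real.exp (c * x) * Real.exp (-c * x) = 1 := by
    rw [← Real.exp_add]
    simp
  calc x ^ p * Real.exp (-c * x)
      ≤ ((1 + n.factorial / c ^ n) * Real.exp (c * x)) * Real.exp (-c * x) := by
        gcongr
        linarith
    _ = _ := by rw [mul_assoc, h5, mul_one]

theorem hasDerivAt_powGauss (p b : ℝ) {r : ℝ} (hr : 0 < r) :
    HasDerivAt (powGauss p b) ((p / r - 2 * b * r) * powGauss p b r) r := by
  have h1 : HasDerivAt (fun r : ℝ => r ^ p) (p * r ^ (p - 1)) r :=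
    Real.hasDerivAt_rpow_const (Or.inl hr.ne')
  have h2 : HasDerivAt (fun r : ℝ => Real.exp (-b * r ^ 2))
      (Real.exp (-b * r ^ 2) * (-b * (2 * r))) r := by
    simpa using ((hasDerivAt_pow 2 r).const_mul (-b)).exp
  convert! h1.mul h2 using 1
  rw [powGauss, Real.rpow_sub hr, Real.rpow_one]
  field_simp
  ring

theorem hasDerivAt_deriv_powGauss (p b : ℝ) {r : ℝ} (hr : 0 < r) :
    HasDerivAt (fun r => (p / r - 2 * b * r) * powGauss p b r)
      (((p / r - 2 * b * r) ^ 2 - p / r ^ 2 - 2 * b) * powGauss p b r) r := by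
  have h1 : HasDerivAt (fun r : ℝ => p / r - 2 * b * r) (-p / r ^ 2 - 2 * b) r := by
    have := ((hasDerivAt_inv hr.ne').const_mul p).sub ((hasDerivAt_id r).const_mul (2 * b))
    convert! this using 1
    ring
  convert! h1.mul (hasDerivAt_powGauss p b hr) using 1
  ring

theorem continuousOn_powGauss (p b : ℝ) : ContinuousOn (powGauss p b) (Ioi 0) :=
  fun _ hr => (hasDerivAt_powGauss p b hr).continuousAt.continuousWithinAt

theorem contDiffAt_powGauss (p b : ℝ) {r : ℝ} (hr : 0 < r) : ContDiffAt ℝ ∞ (powGauss p b) r :=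
  (Real.contDiffAt_rpow_const_of_ne hr.ne').mul (by fun_prop)

theorem continuousOn_deriv_deriv_powGauss (p b : ℝ) :
    ContinuousOn (fun r => ((p / r - 2 * b * r) ^ 2 - p / r ^ 2 - 2 * b) * powGauss p b r)
      (Ioi 0) := by
  have h1 : ContinuousOn (fun r : ℝ => p / r) (Ioi 0) :=
    continuousOn_const.div continuousOn_id fun r hr => ne_of_gt hr
  have h2 : ContinuousOn (fun r : ℝ => p / r ^ 2) (Ioi 0) :=
    continuousOn_const.div (by fun_prop) fun r hr => pow_ne_zero 2 (ne_of_gt hr)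
  exact ((((h1.sub (by fun_prop)).pow 2).sub h2).sub continuousOn_const).mul
    (continuousOn_powGauss p b)

/-- The differential expression applied to `r ^ (ν + 1/2) * exp (-b r ^ 2)`. -/
theorem bessel_powGauss (ν b : ℝ) {r : ℝ} (hr : 0 < r) :
    -((((ν + 1 / 2) / r - 2 * b * r) ^ 2 - (ν + 1 / 2) / r ^ 2 - 2 * b) *
      powGauss (ν + 1 / 2) b r) + (ν ^ 2 - 1 / 4) / r ^ 2 * powGauss (ν + 1 / 2) b r =
    4 * b * (ν + 1) * powGauss (ν + 1 / 2) b r - 4 * b ^ 2 * powGauss (ν + 1 / 2 + 2) b r := by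
  rw [← sq_mul_powGauss _ _ hr]
  field_simp
  ring

/-! ### A logarithmic cutoff -/

/-- A smooth bump function on the real line. -/
noncomputable def bump : ContDiffBump (0 : ℝ) := ⟨1, 2, one_pos, one_lt_two⟩

/-- The logarithmic cutoff on the half-line, equal to `1` for `|log r| ≤ n + 1` and to `0` for
`|log r| ≥ 2 (n + 1)`. -/
noncomputable def logCutoff (n : ℕ) (r : ℝ) : ℝ := if 0 < r then bump (Real.log r / (n + 1)) else 0

theorem logCutoff_of_pos (n : ℕ) {r : ℝ} (hr : 0 < r) :
    logCutoff n r = bump (Real.log r / (n + 1)) := if_pos hr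

theorem logCutoff_nonneg (n : ℕ) (r : ℝ) : 0 ≤ logCutoff n r := by
  unfold logCutoff
  split_ifs
  exacts [bump.nonneg, le_rfl]

theorem logCutoff_le_one (n : ℕ) (r : ℝ) : logCutoff n r ≤ 1 := by
  unfold logCutoff
  split_ifs
  exacts [bump.le_one, zero_le_one]

theorem logCutoff_eq_zero (n : ℕ) {r : ℝ}
    (hr : r ∉ Icc (Real.exp (-(2 * (n + 1)))) (Real.exp (2 * (n + 1)))) : logCutoff n r = 0 := by
  unfold logCutoff
  split_ifs with h
  · refine bump.zero_of_le_dist ?_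
    by_contra! hlt
    apply hr
    rw [Real.dist_eq, sub_zero, abs_div, abs_of_pos (by positivity : (0 : ℝ) < n + 1),
      div_lt_iff₀ (by positivity)] at hlt
    change _ < 2 * _ at hlt
    rw [abs_lt] at hlt
    exact ⟨(Real.le_log_iff_exp_le h).1 hlt.1.le, (Real.log_le_iff_le_exp h).1 hlt.2.le⟩
  · rfl

theorem eventually_logCutoff_eq_zero (n : ℕ) {r : ℝ} (hr : r ≤ 0) : logCutoff n =ᶠ[𝓝 r] 0 := by
  filter_upwards [Iio_mem_nhds (hr.trans_lt (Real.exp_pos (-(2 * (n + 1) : ℝ))))] with x hx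
  exact logCutoff_eq_zero n fun h => absurd h.1 (not_le.2 hx)

theorem contDiff_logCutoff (n : ℕ) : ContDiff ℝ ∞ (logCutoff n) := by
  rw [contDiff_iff_contDiffAt]
  intro r
  rcases le_or_gt r 0 with hr | hr
  · exact contDiffAt_const.congr_of_eventuallyEq (eventually_logCutoff_eq_zero n hr)
  · have h1 : ContDiffAt ℝ ∞ (fun r => bump (Real.log r / (n + 1))) r :=
      ContDiffAt.comp (g := (bump : ℝ → ℝ)) r bump.contDiff.contDiffAt
        ((Real.contDiffAt_log.2 hr.ne').div_const _)
    refine h1.congr_of_eventuallyEq ?_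
    filter_upwards [Ioi_mem_nhds hr] with x hx
    exact logCutoff_of_pos n hx

theorem tsupport_logCutoff_subset (n : ℕ) :
    tsupport (logCutoff n) ⊆ Icc (Real.exp (-(2 * (n + 1)))) (Real.exp (2 * (n + 1))) :=
  closure_minimal (fun _ hr => by_contra fun h => hr (logCutoff_eq_zero n h)) isClosed_Icc

theorem hasCompactSupport_logCutoff (n : ℕ) : HasCompactSupport (logCutoff n) :=
  isCompact_Icc.of_isClosed_subset (isClosed_tsupport _) (tsupport_logCutoff_subset n)

theorem tendsto_logCutoff {r : ℝ} (hr : 0 < r) :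
    Tendsto (fun n => logCutoff n r) atTop (𝓝 1) := by
  refine tendsto_const_nhds.congr' ?_
  obtain ⟨N, hN⟩ := exists_nat_ge |Real.log r|
  filter_upwards [eventually_ge_atTop N] with n hn
  have : (N : ℝ) ≤ n := by exact_mod_cast hn
  rw [logCutoff_of_pos n hr, bump.one_of_mem_closedBall]
  rw [mem_closedBall_zero_iff, Real.norm_eq_abs, abs_div,
    abs_of_pos (by positivity : (0 : ℝ) < n + 1), div_le_iff₀ (by positivity)]
  change _ ≤ 1 * _
  linarith

/-- By the chain rule through log r / (n+1), a derivative costs only 1/((n+1) r). The constant comes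
from the fixed bump, hence is uniform in n. -/
theorem exists_deriv_logCutoff_bound : ∃ C : ℝ, 0 ≤ C ∧ ∀ (n : ℕ) (r : ℝ), 0 < r →
    deriv (logCutoff n) r ^ 2 ≤ C / ((n + 1) ^ 2 * r ^ 2) := by
  have h1 : ContDiff ℝ 1 bump := bump.contDiff
  obtain ⟨C, hC⟩ := bump.hasCompactSupport.deriv.exists_bound_of_continuous
    (h1.continuous_deriv le_rfl)
  refine ⟨C ^ 2, by positivity, fun n r hr => ?_⟩
  have h2 : HasDerivAt (fun r => bump (Real.log r / (n + 1)))
      (deriv bump (Real.log r / (n + 1)) * (r⁻¹ / (n + 1))) r :=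
    ((h1.differentiable one_ne_zero _).hasDerivAt).comp r ((Real.hasDerivAt_log hr.ne').div_const _)
  have h3 : deriv (logCutoff n) r = deriv bump (Real.log r / (n + 1)) * (r⁻¹ / (n + 1)) := by
    rw [← h2.deriv]
    refine Filter.EventuallyEq.deriv_eq ?_
    filter_upwards [Ioi_mem_nhds hr] with x hx
    exact logCutoff_of_pos n hx
  have h4 : deriv bump (Real.log r / (n + 1)) ^ 2 ≤ C ^ 2 := by
    rw [← sq_abs]
    exact pow_le_pow_left₀ (abs_nonneg _) (hC _) 2
  rw [h3, mul_pow, div_pow, inv_pow, div_eq_mul_inv _ ((n + 1 : ℝ) ^ 2), ← mul_inv,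
    ← div_eq_mul_inv, mul_comm (r ^ 2)]
  gcongr

theorem deriv_logCutoff_eq_zero (n : ℕ) {r : ℝ}
    (hr : r ∉ Icc (Real.exp (-(2 * (n + 1)))) (Real.exp (2 * (n + 1)))) :
    deriv (logCutoff n) r = 0 :=
  image_eq_zero_of_notMem_tsupport
    fun h => hr (tsupport_logCutoff_subset n (tsupport_deriv_subset h))

/-! ### The functions `r ^ (ν + 1/2) * exp (-b r ^ 2)` are in the Friedrichs domain -/

theorem norm_sq_eq_integral {u : L2HalfLine} {f : ℝ → ℝ}
    (hu : u =ᵐ[volume.restrict (Ioi (0 : ℝ))] fun r => (f r : ℂ)) :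
    ‖u‖ ^ 2 = ∫ r in Ioi (0 : ℝ), f r ^ 2 := by
  have h1 : ((‖u‖ ^ 2 : ℝ) : ℂ) = ((∫ r in Ioi (0 : ℝ), f r ^ 2 : ℝ) : ℂ) := by
    have h2 : ⟪u, u⟫_ℂ = ((‖u‖ ^ 2 : ℝ) : ℂ) := by
      rw [inner_self_eq_norm_sq_to_K]
      norm_cast
    rw [← h2, inner_eq_integral hu hu, ← integral_complex_ofReal]
    refine integral_congr_ae (Eventually.of_forall fun r => ?_)
    simp [pow_two]
  exact_mod_cast h1

theorem contDiff_cutoff_mul {ζ f : ℝ → ℝ} (hζ : ContDiff ℝ ∞ ζ) (hζs : ∀ r ≤ 0, ζ =ᶠ[𝓝 r] 0)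
    (hf : ∀ r, 0 < r → ContDiffAt ℝ ∞ f r) : ContDiff ℝ ∞ fun r => ζ r * f r := by
  rw [contDiff_iff_contDiffAt]
  intro r
  rcases le_or_gt r 0 with hr | hr
  · refine (contDiffAt_const (c := (0 : ℝ))).congr_of_eventuallyEq ?_
    filter_upwards [hζs r hr] with x hx
    simp [hx]
  · exact hζ.contDiffAt.mul (hf r hr)

/-- The test function `logCutoff n r * r ^ p * exp (-b r ^ 2)`. -/
noncomputable def cutoffGauss (p b : ℝ) (n : ℕ) : 𝓓(halfLine, ℂ) :=
  testOfReal (fun r => logCutoff n r * powGauss p b r)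
    (contDiff_cutoff_mul (contDiff_logCutoff n) (fun _ hr => eventually_logCutoff_eq_zero n hr)
      fun _ hr => contDiffAt_powGauss p b hr)
    (hasCompactSupport_logCutoff n).mul_right
    ((tsupport_mul_subset_left).trans
      ((tsupport_logCutoff_subset n).trans fun _ hr => (Real.exp_pos _).trans_le hr.1))

theorem cutoffGauss_apply (p b : ℝ) (n : ℕ) (r : ℝ) :
    cutoffGauss p b n r = (logCutoff n r * powGauss p b r : ℝ) := rfl

theorem measurable_logCutoff (n : ℕ) : Measurable (logCutoff n) :=
  (contDiff_logCutoff n).continuous.measurable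

theorem tendsto_integral_one_sub_logCutoff {F : ℝ → ℝ} (hF : IntegrableOn F (Ioi 0)) :
    Tendsto (fun n => ∫ r in Ioi (0 : ℝ), (1 - logCutoff n r) ^ 2 * F r) atTop (𝓝 0) := by
  have h1 : Tendsto (fun n => ∫ r in Ioi (0 : ℝ), (1 - logCutoff n r) ^ 2 * F r) atTop
      (𝓝 (∫ r in Ioi (0 : ℝ), (0 : ℝ))) := by
    refine tendsto_integral_of_dominated_convergence (fun r => ‖F r‖) (fun n => ?_) hF.norm
      (fun n => ?_) ?_
    · exact (((measurable_logCutoff n).const_sub 1).pow_const 2).aestronglyMeasurable.mul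
        hF.aestronglyMeasurable
    · refine Eventually.of_forall fun r => ?_
      rw [norm_mul, Real.norm_eq_abs, abs_of_nonneg (sq_nonneg _)]
      refine mul_le_of_le_one_left (norm_nonneg _) ?_
      have h1 := logCutoff_nonneg n r
      have h2 := logCutoff_le_one n r
      nlinarith
    · filter_upwards [ae_restrict_mem measurableSet_Ioi] with r hr
      have := (((tendsto_logCutoff hr).const_sub 1).pow 2).mul_const (F r)
      simpa using this
  simpa using h1

theorem tendsto_cutoffGauss {p b : ℝ} (hp : -1 / 2 < p) (hb : 0 < b) :
    Tendsto (fun n => testToL2 (cutoffGauss p b n)) atTop (𝓝 (powGaussL2 p b hp hb)) := by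
  rw [tendsto_iff_norm_sub_tendsto_zero]
  have h1 : ∀ n, ‖testToL2 (cutoffGauss p b n) - powGaussL2 p b hp hb‖ ^ 2 =
      ∫ r in Ioi (0 : ℝ), (1 - logCutoff n r) ^ 2 * powGauss p b r ^ 2 := by
    intro n
    rw [norm_sq_eq_integral (f := fun r => -((1 - logCutoff n r) * powGauss p b r))]
    · simp only [neg_sq, mul_pow]
    · filter_upwards [Lp.coeFn_sub (testToL2 (cutoffGauss p b n)) (powGaussL2 p b hp hb),
        testToL2_ae (cutoffGauss p b n), powGaussL2_ae hp hb] with r e1 e2 e3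
      rw [e1, Pi.sub_apply, e2, e3, cutoffGauss_apply]
      push_cast
      ring
  have h2 : IntegrableOn (fun r => powGauss p b r ^ 2) (Ioi 0) :=
    IntegrableOn.congr_fun (integrableOn_powGauss (p := 2 * p) (b := 2 * b) (by linarith)
      (by linarith)) (fun r hr => (powGauss_sq p b hr).symm) measurableSet_Ioi
  have h3 := (tendsto_integral_one_sub_logCutoff h2).sqrt
  rw [Real.sqrt_zero] at h3
  refine h3.congr fun n => ?_
  rw [← h1, Real.sqrt_sq (norm_nonneg _)]

theorem integrableOn_deriv_logCutoff_sq_mul (n : ℕ) (p b : ℝ) :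
    IntegrableOn (fun r => deriv (logCutoff n) r ^ 2 * powGauss p b r ^ 2) (Ioi 0) := by
  have h := integrable_mul_of_eventually_zero
    (((continuousOn_powGauss p b).pow 2).mul
      ((contDiff_infty_iff_deriv).1 (contDiff_logCutoff n)).2.continuous.continuousOn)
    ((contDiff_infty_iff_deriv).1 (contDiff_logCutoff n)).2.continuous
    (fun r hr => eventually_zero_deriv (eventually_logCutoff_eq_zero n hr))
    (hasCompactSupport_logCutoff n).deriv
  refine (h.congr (Eventually.of_forall fun r => ?_)).integrableOn
  simp only [Pi.mul_apply, Pi.pow_apply]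
  ring

/-- For p ≥ 1/2 the square of the function is at most M r, so the integrand is at most C M / ((n+1)²
r). The support has logarithmic length 4(n+1), and the integral is O(1/(n+1)). At p = 1/2, that is ν
= 0, a cutoff at scale ε in r itself would leave an energy of order 1, hence the logarithm. -/
theorem tendsto_integral_deriv_logCutoff {p b : ℝ} (hp : 1 / 2 ≤ p) (hb : 0 < b) :
    Tendsto (fun n => ∫ r in Ioi (0 : ℝ), deriv (logCutoff n) r ^ 2 * powGauss p b r ^ 2) atTop
      (𝓝 0) := by
  obtain ⟨C, hC0, hC⟩ := exists_deriv_logCutoff_bound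
  obtain ⟨M, hM0, hM⟩ := exists_rpow_mul_exp_le (p := p - 1 / 2) (c := 2 * b) (by linarith)
    (by linarith)
  have hfM : ∀ r, 0 < r → powGauss p b r ^ 2 ≤ M * r := by
    intro r hr
    have h1 := hM (r ^ 2) (by positivity)
    have h2 : (r ^ 2) ^ (p - 1 / 2) * r = r ^ (2 * p) := by
      rw [← Real.rpow_two, ← Real.rpow_mul hr.le, ← Real.rpow_add_one hr.ne']
      congr 1
      ring
    calc powGauss p b r ^ 2 = (r ^ 2) ^ (p - 1 / 2) * Real.exp (-(2 * b) * r ^ 2) * r := by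
          rw [powGauss_sq p b hr, powGauss, ← h2]
          ring
      _ ≤ M * r := by gcongr
  have hle : ∀ n : ℕ, ∫ r in Ioi (0 : ℝ), deriv (logCutoff n) r ^ 2 * powGauss p b r ^ 2 ≤
      4 * C * M / (n + 1) := by
    intro n
    set N : ℝ := n + 1 with hN
    have hNpos : 0 < N := by positivity
    set I := Icc (Real.exp (-(2 * N))) (Real.exp (2 * N)) with hI
    have hI0 : ∀ r ∈ I, 0 < r := fun r hr => (Real.exp_pos _).trans_le hr.1
    have hIsub : I ⊆ Ioi 0 := hI0
    have e1 : ∫ r in Ioi (0 : ℝ), deriv (logCutoff n) r ^ 2 * powGauss p b r ^ 2 =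
        ∫ r in I, deriv (logCutoff n) r ^ 2 * powGauss p b r ^ 2 := by
      refine (setIntegral_eq_of_subset_of_forall_sdiff_eq_zero measurableSet_Ioi hIsub
        fun r hr => ?_)
      rw [deriv_logCutoff_eq_zero n hr.2]
      ring
    have hii : IntegrableOn (fun r : ℝ => C * M / N ^ 2 * r⁻¹) I :=
      (continuousOn_const.mul (continuousOn_id.inv₀ fun r hr => (hI0 r hr).ne')).integrableOn_compact
        isCompact_Icc
    have e2 : ∫ r in I, C * M / N ^ 2 * r⁻¹ = 4 * C * M / N := by
      rw [integral_const_mul, integral_Icc_eq_integral_Ioc,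
        ← intervalIntegral.integral_of_le (Real.exp_le_exp.2 (by linarith)),
        integral_inv_of_pos (Real.exp_pos _) (Real.exp_pos _), ← Real.exp_sub, Real.log_exp]
      field_simp
      ring
    rw [e1, ← e2]
    refine setIntegral_mono_on ((integrableOn_deriv_logCutoff_sq_mul n p b).mono_set hIsub) hii
      measurableSet_Icc fun r hr => ?_
    have hr0 := hI0 r hr
    calc deriv (logCutoff n) r ^ 2 * powGauss p b r ^ 2 ≤ C / (N ^ 2 * r ^ 2) * (M * r) :=
          mul_le_mul (hC n r hr0) (hfM r hr0) (sq_nonneg _) (by positivity)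
      _ = C * M / N ^ 2 * r⁻¹ := by field_simp
  have hlim : Tendsto (fun n : ℕ => 4 * C * M / ((n : ℝ) + 1)) atTop (𝓝 0) := by
    have := (tendsto_one_div_add_atTop_nhds_zero_nat (𝕜 := ℝ)).const_mul (4 * C * M)
    simpa [div_eq_mul_inv] using this
  exact squeeze_zero (fun n => setIntegral_nonneg measurableSet_Ioi fun r _ =>
    mul_nonneg (sq_nonneg _) (sq_nonneg _)) hle hlim

/-- The truncations ζ_n f are Cauchy for the form: by `form_besselOp_mul`, the form of (ζ_n - ζ_m) f
is the integral of (ζ_n - ζ_m)² f · Tf + (ζ_n' - ζ_m')² f². The first term tends to zero because f ·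
Tf is integrable, the second by the logarithmic cutoff. -/
theorem powGaussL2_mem_formDomain {ν b : ℝ} (hν : 0 ≤ ν) (hb : 0 < b) :
    powGaussL2 (ν + 1 / 2) b (by linarith) hb ∈ formDomain (besselOp ν) (besselOp_isNonneg ν) := by
  set p := ν + 1 / 2 with hp
  have hp' : 1 / 2 ≤ p := by linarith
  set F : ℝ → ℝ := fun r => |powGauss p b r *
    (4 * b * (ν + 1) * powGauss p b r - 4 * b ^ 2 * powGauss (p + 2) b r)| with hF
  have hFi : IntegrableOn F (Ioi 0) := by
    refine Integrable.abs (IntegrableOn.congr_fun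
      (f := fun r => 4 * b * (ν + 1) * powGauss (p + p) (b + b) r -
        4 * b ^ 2 * powGauss (p + (p + 2)) (b + b) r) ?_ (fun r hr => ?_) measurableSet_Ioi)
    · exact ((integrableOn_powGauss (by linarith) (by linarith)).const_mul _).sub
        ((integrableOn_powGauss (by linarith) (by linarith)).const_mul _)
    · simp only
      rw [← powGauss_mul_powGauss p p b b hr, ← powGauss_mul_powGauss p (p + 2) b b hr]
      ring
  refine ⟨fun n => ⟨testToL2 (cutoffGauss p b n), LinearMap.mem_range_self _ _⟩,
    tendsto_cutoffGauss _ hb, ?_⟩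
  set a : ℕ → ℝ := fun n => ∫ r in Ioi (0 : ℝ), (1 - logCutoff n r) ^ 2 * F r with ha
  set c : ℕ → ℝ := fun n => ∫ r in Ioi (0 : ℝ), deriv (logCutoff n) r ^ 2 * powGauss p b r ^ 2
    with hc
  have iA : ∀ n, IntegrableOn (fun r => (1 - logCutoff n r) ^ 2 * F r) (Ioi 0) := fun n => by
    refine Integrable.mono' hFi ((((measurable_logCutoff n).const_sub
      1).pow_const 2).aestronglyMeasurable.mul hFi.aestronglyMeasurable)
      (Eventually.of_forall fun r => ?_)
    rw [norm_mul, Real.norm_eq_abs, abs_of_nonneg (sq_nonneg _), Real.norm_eq_abs,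
      abs_of_nonneg (abs_nonneg _)]
    refine mul_le_of_le_one_left (abs_nonneg _) ?_
    have h1 := logCutoff_nonneg n r
    have h2 := logCutoff_le_one n r
    nlinarith
  have iC := fun n => integrableOn_deriv_logCutoff_sq_mul n p b
  have hlim : Tendsto (fun n => a n + c n) atTop (𝓝 0) := by
    simpa using (tendsto_integral_one_sub_logCutoff hFi).add
      (tendsto_integral_deriv_logCutoff hp' hb)
  have hlim2 : Tendsto (fun q : ℕ × ℕ => 2 * (a q.1 + c q.1) + 2 * (a q.2 + c q.2)) atTop
      (𝓝 0) := by
    rw [← prod_atTop_atTop_eq]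
    have h1 : Tendsto (fun q : ℕ × ℕ => 2 * (a q.1 + c q.1)) (atTop ×ˢ atTop) (𝓝 (2 * 0)) :=
      (hlim.comp tendsto_fst).const_mul 2
    have h2 : Tendsto (fun q : ℕ × ℕ => 2 * (a q.2 + c q.2)) (atTop ×ˢ atTop) (𝓝 (2 * 0)) :=
      (hlim.comp tendsto_snd).const_mul 2
    simpa using h1.add h2
  refine squeeze_zero (fun q => besselOp_isNonneg ν _) (fun q => ?_) hlim2
  obtain ⟨n, m⟩ := q
  have hsub : (⟨testToL2 (cutoffGauss p b n), LinearMap.mem_range_self _ _⟩ -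
      ⟨testToL2 (cutoffGauss p b m), LinearMap.mem_range_self _ _⟩ : (besselOp ν).domain) =
      ⟨testToL2 (cutoffGauss p b n - cutoffGauss p b m), LinearMap.mem_range_self _ _⟩ :=
    Subtype.ext (map_sub testToL2 _ _).symm
  have hdiff : ∀ k, ∀ r, DifferentiableAt ℝ (logCutoff k) r := fun k r =>
    (contDiff_logCutoff k).differentiable (by simp) r
  rw [hsub, form_besselOp_mul ν (ζ := fun r => logCutoff n r - logCutoff m r)
    ((contDiff_logCutoff n).sub (contDiff_logCutoff m))
    ((hasCompactSupport_logCutoff n).sub (hasCompactSupport_logCutoff m))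
    (fun r hr => by
      filter_upwards [eventually_logCutoff_eq_zero n hr, eventually_logCutoff_eq_zero m hr]
        with x h1 h2
      simp [h1, h2])
    (fun r hr => hasDerivAt_powGauss p b hr) (fun r hr => hasDerivAt_deriv_powGauss p b hr)
    (continuousOn_deriv_deriv_powGauss p b) _ (fun r => by
      rw [FunLike.coe_sub, Pi.sub_apply, cutoffGauss_apply, cutoffGauss_apply]
      push_cast
      ring)]
  set Φ : ℕ → ℝ → ℝ := fun k r =>
    (1 - logCutoff k r) ^ 2 * F r + deriv (logCutoff k) r ^ 2 * powGauss p b r ^ 2 with hΦ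
  have iΦ : ∀ k, IntegrableOn (Φ k) (Ioi 0) := fun k => (iA k).add (iC k)
  have eΦ : ∀ k, ∫ r in Ioi (0 : ℝ), Φ k r = a k + c k := fun k => integral_add (iA k) (iC k)
  have nF : ∀ r, 0 ≤ F r := fun r => abs_nonneg _
  have nΦ : ∀ k r, 0 ≤ Φ k r := fun k r => add_nonneg (mul_nonneg (sq_nonneg _) (nF r))
    (mul_nonneg (sq_nonneg _) (sq_nonneg _))
  simp only
  rw [← eΦ, ← eΦ, ← integral_const_mul, ← integral_const_mul,
    ← integral_add ((iΦ n).const_mul 2) ((iΦ m).const_mul 2)]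
  -- If the integrand were not integrable, its integral would be 0 by convention and the bound would
  -- hold trivially, so its integrability need not be established.
  by_cases hint : IntegrableOn (fun r => (logCutoff n r - logCutoff m r) ^ 2 *
      (powGauss p b r * (-(((p / r - 2 * b * r) ^ 2 - p / r ^ 2 - 2 * b) * powGauss p b r) +
        (ν ^ 2 - 1 / 4) / r ^ 2 * powGauss p b r)) +
      deriv (fun r => logCutoff n r - logCutoff m r) r ^ 2 * powGauss p b r ^ 2) (Ioi 0)
  · refine setIntegral_mono_on hint (((iΦ n).const_mul 2).add ((iΦ m).const_mul 2))
      measurableSet_Ioi fun r hr => ?_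
    have hd : deriv (fun r => logCutoff n r - logCutoff m r) r =
        deriv (logCutoff n) r - deriv (logCutoff m) r := deriv_fun_sub (hdiff n r) (hdiff m r)
    rw [hd, bessel_powGauss ν b hr]
    have h1 : powGauss p b r *
        (4 * b * (ν + 1) * powGauss p b r - 4 * b ^ 2 * powGauss (p + 2) b r) ≤ F r := le_abs_self _
    have h2 : (logCutoff n r - logCutoff m r) ^ 2 ≤
        2 * (1 - logCutoff n r) ^ 2 + 2 * (1 - logCutoff m r) ^ 2 := by
      nlinarith [sq_nonneg ((1 - logCutoff n r) + (1 - logCutoff m r))]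
    have h3 : (deriv (logCutoff n) r - deriv (logCutoff m) r) ^ 2 ≤
        2 * deriv (logCutoff n) r ^ 2 + 2 * deriv (logCutoff m) r ^ 2 := by
      nlinarith [sq_nonneg (deriv (logCutoff n) r + deriv (logCutoff m) r)]
    have h4 := mul_le_mul_of_nonneg_left h1 (sq_nonneg (logCutoff n r - logCutoff m r))
    have h5 := mul_le_mul_of_nonneg_right h2 (nF r)
    have h6 := mul_le_mul_of_nonneg_right h3 (sq_nonneg (powGauss p b r))
    simp only [hΦ]
    linarith
  · rw [integral_undef hint]
    exact integral_nonneg fun r => add_nonneg (mul_nonneg zero_le_two (nΦ n r))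
      (mul_nonneg zero_le_two (nΦ m r))

/-- The Friedrichs extension of `T_ν` maps `r ^ (ν + 1/2) * exp (-b r ^ 2)` to
`(4 b (ν + 1) - 4 b ^ 2 r ^ 2) * r ^ (ν + 1/2) * exp (-b r ^ 2)`. -/
theorem besselFriedrichs_powGauss {ν b : ℝ} (hν : 0 ≤ ν) (hb : 0 < b) :
    ∃ h : powGaussL2 (ν + 1 / 2) b (by linarith) hb ∈ (besselFriedrichs ν).domain,
      besselFriedrichs ν ⟨powGaussL2 (ν + 1 / 2) b (by linarith) hb, h⟩ =
        ((4 * b * (ν + 1) : ℝ) : ℂ) • powGaussL2 (ν + 1 / 2) b (by linarith) hb -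
          ((4 * b ^ 2 : ℝ) : ℂ) • powGaussL2 (ν + 1 / 2 + 2) b (by linarith) hb := by
  refine exists_friedrichsExtension_eq (besselOp_isNonneg ν) (besselOp_dense ν)
    (powGaussL2_mem_formDomain hν hb) ?_
  rintro ⟨_, u, rfl⟩
  rw [besselOp_apply]
  have hw : (((4 * b * (ν + 1) : ℝ) : ℂ) • powGaussL2 (ν + 1 / 2) b (by linarith) hb -
      ((4 * b ^ 2 : ℝ) : ℂ) • powGaussL2 (ν + 1 / 2 + 2) b (by linarith) hb : L2HalfLine)
      =ᵐ[volume.restrict (Ioi (0 : ℝ))] fun r =>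
        ((4 * b * (ν + 1) * powGauss (ν + 1 / 2) b r -
          4 * b ^ 2 * powGauss (ν + 1 / 2 + 2) b r : ℝ) : ℂ) := by
    refine (Lp.coeFn_sub _ _).trans ?_
    filter_upwards [Lp.coeFn_smul ((4 * b * (ν + 1) : ℝ) : ℂ)
        (powGaussL2 (ν + 1 / 2) b (by linarith) hb),
      Lp.coeFn_smul ((4 * b ^ 2 : ℝ) : ℂ) (powGaussL2 (ν + 1 / 2 + 2) b (by linarith) hb),
      powGaussL2_ae (p := ν + 1 / 2) (by linarith) hb,
      powGaussL2_ae (p := ν + 1 / 2 + 2) (by linarith) hb] with r e1 e2 e3 e4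
    rw [Pi.sub_apply, e1, e2, Pi.smul_apply, Pi.smul_apply, e3, e4]
    simp only [smul_eq_mul]
    push_cast
    ring
  have hcont := Complex.continuous_ofReal.comp_continuousOn
    (continuousOn_deriv_deriv_powGauss (ν + 1 / 2) b)
  rw [inner_eq_integral hw (testToL2_ae u),
    inner_eq_integral (powGaussL2_ae (by linarith) hb) (besselToL2_ae ν u),
    integral_conj_mul_besselExpr ν
      (fun r hr => (hasDerivAt_powGauss (ν + 1 / 2) b hr).ofReal_comp)
      (fun r hr => (hasDerivAt_deriv_powGauss (ν + 1 / 2) b hr).ofReal_comp) hcont u]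
  refine setIntegral_congr_fun measurableSet_Ioi fun r hr => ?_
  rw [← bessel_powGauss ν b hr]
  congr 2
  push_cast
  ring

/-! ### The heat flow of the functions `r ^ (ν + 1/2) * exp (-a r ^ 2)` -/

/-- The pairing of `g` with `r ^ p * exp (-b r ^ 2)`. -/
noncomputable def gaussPairing (p : ℝ) (g : L2HalfLine) (b : ℝ) : ℂ :=
  ∫ r in Ioi (0 : ℝ), starRingEnd ℂ (g r) * powGauss p b r

theorem gaussPairing_eq_inner {p b : ℝ} (hp : -1 / 2 < p) (hb : 0 < b) (g : L2HalfLine) :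
    gaussPairing p g b = ⟪g, powGaussL2 p b hp hb⟫_ℂ :=
  (inner_eq_integral (ae_eq_refl _) (powGaussL2_ae hp hb)).symm

theorem aestronglyMeasurable_conj (g : L2HalfLine) :
    AEStronglyMeasurable (fun r => starRingEnd ℂ ((g : ℝ → ℂ) r))
      (volume.restrict (Ioi (0 : ℝ))) :=
  Complex.continuous_conj.comp_aestronglyMeasurable (Lp.aestronglyMeasurable g)

theorem integrableOn_conj_mul_powGauss {p b : ℝ} (hp : -1 / 2 < p) (hb : 0 < b)
    (g : L2HalfLine) :
    IntegrableOn (fun r => starRingEnd ℂ ((g : ℝ → ℂ) r) * (powGauss p b r : ℂ)) (Ioi 0) :=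
  MemLp.integrable_mul (p := 2) (q := 2) (Lp.memLp g).star (memLp_powGauss hp hb)

theorem hasDerivAt_powGauss_right (p r b : ℝ) :
    HasDerivAt (fun b => powGauss p b r) (-(r ^ 2 * powGauss p b r)) b := by
  have h : HasDerivAt (fun b : ℝ => Real.exp (-b * r ^ 2))
      (Real.exp (-b * r ^ 2) * (-1 * r ^ 2)) b :=
    (((hasDerivAt_id b).neg).mul_const (r ^ 2)).exp
  convert! h.const_mul (r ^ p) using 1
  rw [powGauss]
  ring

theorem hasDerivAt_gaussPairing {p b : ℝ} (hp : -1 / 2 < p) (hb : 0 < b) (g : L2HalfLine) :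
    HasDerivAt (gaussPairing p g) (-gaussPairing (p + 2) g b) b := by
  have hmeas : ∀ q c, AEStronglyMeasurable
      (fun r => starRingEnd ℂ ((g : ℝ → ℂ) r) * (powGauss q c r : ℂ))
      (volume.restrict (Ioi (0 : ℝ))) := fun q c =>
    (aestronglyMeasurable_conj g).mul
      (Complex.measurable_ofReal.comp (measurable_powGauss q c)).aestronglyMeasurable
  -- The Gaussian factor decreases in its parameter, so for c > b/2 the derivative is dominated by
  -- its value at b/2.
  have key := (hasDerivAt_integral_of_dominated_loc_of_deriv_le (𝕜 := ℝ)
    (μ := volume.restrict (Ioi (0 : ℝ)))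
    (F := fun c r => starRingEnd ℂ ((g : ℝ → ℂ) r) * (powGauss p c r : ℂ))
    (F' := fun c r => -(starRingEnd ℂ ((g : ℝ → ℂ) r) * (powGauss (p + 2) c r : ℂ)))
    (bound := fun r => ‖starRingEnd ℂ ((g : ℝ → ℂ) r) * (powGauss (p + 2) (b / 2) r : ℂ)‖)
    (x₀ := b) (Ioi_mem_nhds (half_lt_self hb)) (Eventually.of_forall fun c => hmeas p c)
    (integrableOn_conj_mul_powGauss hp hb g) (hmeas (p + 2) b).neg ?_
    (integrableOn_conj_mul_powGauss (by linarith) (by linarith) g).norm ?_).2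
  · rw [integral_neg] at key
    exact key
  · filter_upwards [ae_restrict_mem measurableSet_Ioi] with r hr c hc
    rw [norm_neg, norm_mul, norm_mul, Complex.norm_real, Complex.norm_real]
    refine mul_le_mul_of_nonneg_left ?_ (norm_nonneg _)
    rw [Real.norm_of_nonneg (powGauss_pos _ _ hr).le, Real.norm_of_nonneg (powGauss_pos _ _ hr).le]
    have hr' : (0 : ℝ) < r := hr
    unfold powGauss
    have : b / 2 ≤ c := le_of_lt hc
    gcongr
  · filter_upwards [ae_restrict_mem measurableSet_Ioi] with r hr c _
    have h := ((hasDerivAt_powGauss_right p r c).ofReal_comp).const_mul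
      (starRingEnd ℂ ((g : ℝ → ℂ) r))
    rw [sq_mul_powGauss p c hr] at h
    convert! h using 1
    push_cast
    ring

theorem norm_powGaussL2 {p b : ℝ} (hp : -1 / 2 < p) (hb : 0 < b) :
    ‖powGaussL2 p b hp hb‖ ^ 2 =
      (2 * b) ^ (-(2 * p + 1) / 2) * (1 / 2) * Real.Gamma ((2 * p + 1) / 2) := by
  rw [norm_sq_eq_integral (powGaussL2_ae hp hb),
    ← integral_powGauss (by linarith : -1 < 2 * p) (by linarith : 0 < 2 * b)]
  exact setIntegral_congr_fun measurableSet_Ioi fun r hr => powGauss_sq p b hr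

/-- The pairing of `g` with the heat flow at time `t` of `r ^ (ν + 1/2) * exp (-a r ^ 2)`. -/
noncomputable def heatPairing (ν a : ℝ) (g : L2HalfLine) (t : ℝ) : ℂ :=
  ((1 + 4 * a * t) ^ (-(ν + 1)) : ℝ) * gaussPairing (ν + 1 / 2) g (a / (1 + 4 * a * t))

theorem heatPairing_zero (ν a : ℝ) (g : L2HalfLine) :
    heatPairing ν a g 0 = gaussPairing (ν + 1 / 2) g a := by
  simp [heatPairing]

/-- The explicit flow does not increase the L² norm, so the bound is ‖g‖ times the norm at t = 0.
With y = 1 + 4at, the squared norm of the Gaussian scales as y^(ν+1) and the squared prefactor as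
y^(-2(ν+1)), leaving y^(-(ν+1)) ≤ 1. -/
theorem exists_heatPairing_bound {ν a : ℝ} (hν : 0 ≤ ν) (ha : 0 < a) (g : L2HalfLine) :
    ∃ C, ∀ t, 0 ≤ t → ‖heatPairing ν a g t‖ ≤ C := by
  refine ⟨‖g‖ * √((2 * a) ^ (-(2 * (ν + 1 / 2) + 1) / 2) * (1 / 2) *
    Real.Gamma ((2 * (ν + 1 / 2) + 1) / 2)), fun t ht => ?_⟩
  set y := 1 + 4 * a * t with hy
  have hy1 : 1 ≤ y := by
    have : 0 ≤ 4 * a * t := by positivity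
    linarith
  have hy0 : 0 < y := by linarith
  have hb : 0 < a / y := by positivity
  have hp : -1 / 2 < ν + 1 / 2 := by linarith
  have hG : 0 ≤ Real.Gamma ((2 * (ν + 1 / 2) + 1) / 2) :=
    (Real.Gamma_pos_of_pos (by linarith)).le
  rw [heatPairing, gaussPairing_eq_inner hp hb, norm_mul, Complex.norm_real,
    Real.norm_of_nonneg (by positivity)]
  calc y ^ (-(ν + 1)) * ‖⟪g, powGaussL2 (ν + 1 / 2) (a / y) hp hb⟫_ℂ‖
      ≤ y ^ (-(ν + 1)) * (‖g‖ * ‖powGaussL2 (ν + 1 / 2) (a / y) hp hb‖) := by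
        gcongr
        exact norm_inner_le_norm _ _
    _ = ‖g‖ * (y ^ (-(ν + 1)) * ‖powGaussL2 (ν + 1 / 2) (a / y) hp hb‖) := by ring
    _ ≤ _ := by
        gcongr
        refine Real.le_sqrt_of_sq_le ?_
        rw [mul_pow, norm_powGaussL2, ← mul_assoc, ← mul_assoc]
        gcongr
        rw [show 2 * (a / y) = 2 * a / y by ring, Real.div_rpow (by positivity) hy0.le,
          ← Real.rpow_natCast, ← Real.rpow_mul hy0.le, mul_div_assoc', mul_comm, mul_div_assoc,
          ← Real.rpow_sub hy0]
        refine mul_le_of_le_one_right (by positivity) ?_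
        refine Real.rpow_le_one_of_one_le_of_nonpos hy1 ?_
        push_cast
        linarith

/-- This is the heat equation in weak form. For y = 1 + 4at and b = a/y one has b' = -4b² and
(y^(-(ν+1)))' = -4b(ν+1) y^(-(ν+1)), and these are the two coefficients of T_ν on the Gaussian with
parameter b. -/
theorem hasDerivAt_heatPairing {ν a t : ℝ} (hν : 0 ≤ ν) (ha : 0 < a) (ht : 0 ≤ t)
    (g : L2HalfLine) (hb : 0 < a / (1 + 4 * a * t)) :
    HasDerivAt (heatPairing ν a g) (-(((1 + 4 * a * t) ^ (-(ν + 1)) : ℝ) *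
      ⟪g, ((4 * (a / (1 + 4 * a * t)) * (ν + 1) : ℝ) : ℂ) •
          powGaussL2 (ν + 1 / 2) (a / (1 + 4 * a * t)) (by linarith) hb -
        ((4 * (a / (1 + 4 * a * t)) ^ 2 : ℝ) : ℂ) •
          powGaussL2 (ν + 1 / 2 + 2) (a / (1 + 4 * a * t)) (by linarith) hb⟫_ℂ)) t := by
  have hy0 : 0 < 1 + 4 * a * t := by positivity
  have h1 : HasDerivAt (fun t => 1 + 4 * a * t) (4 * a) t := by
    simpa using ((hasDerivAt_id t).const_mul (4 * a)).const_add 1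
  have h2 : HasDerivAt (fun t => a / (1 + 4 * a * t)) (-(4 * (a / (1 + 4 * a * t)) ^ 2)) t := by
    have := (h1.inv hy0.ne').const_mul a
    convert! this using 1
    field_simp
  have h3 : HasDerivAt (fun t => (1 + 4 * a * t) ^ (-(ν + 1)))
      (-(4 * (a / (1 + 4 * a * t)) * (ν + 1) * (1 + 4 * a * t) ^ (-(ν + 1)))) t := by
    have := h1.rpow_const (p := -(ν + 1)) (Or.inl hy0.ne')
    convert! this using 1
    rw [Real.rpow_sub_one hy0.ne']
    field_simp
  have h4 := (hasDerivAt_gaussPairing (p := ν + 1 / 2) (by linarith) hb g).scomp t h2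
  convert! h3.ofReal_comp.mul h4 using 1
  rw [inner_sub_right, inner_smul_right, inner_smul_right,
    ← gaussPairing_eq_inner (by linarith) hb, ← gaussPairing_eq_inner (by linarith) hb,
    Complex.real_smul]
  simp only [Function.comp]
  push_cast
  ring

theorem continuousOn_heatPairing {ν a : ℝ} (hν : 0 ≤ ν) (ha : 0 < a) (g : L2HalfLine) :
    ContinuousOn (heatPairing ν a g) (Ici 0) := fun t ht =>
  (hasDerivAt_heatPairing hν ha ht g (by
    have : (0 : ℝ) ≤ t := ht
    positivity)).continuousAt.continuousWithinAt

theorem integrableOn_pow_mul_exp_neg (n : ℕ) :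
    IntegrableOn (fun t : ℝ => t ^ n * Real.exp (-t)) (Ioi 0) := by
  refine (Real.GammaIntegral_convergent (s := n + 1) (by positivity)).congr_fun (fun t _ => ?_)
    measurableSet_Ioi
  simp only [add_sub_cancel_right, Real.rpow_natCast]
  ring

theorem integrableOn_pow_mul_exp_neg_mul_heatPairing {ν a : ℝ} (hν : 0 ≤ ν) (ha : 0 < a)
    (g : L2HalfLine) (n : ℕ) :
    IntegrableOn (fun t : ℝ => ((t ^ n * Real.exp (-t) : ℝ) : ℂ) * heatPairing ν a g t)
      (Ioi 0) := by
  obtain ⟨C, hC⟩ := exists_heatPairing_bound hν ha g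
  refine Integrable.mul_bdd (c := C) (integrableOn_pow_mul_exp_neg n).ofReal
    (((continuousOn_heatPairing hν ha g).mono Ioi_subset_Ici_self).aestronglyMeasurable
      measurableSet_Ioi) ?_
  filter_upwards [ae_restrict_mem measurableSet_Ioi] with t ht
  exact hC t (le_of_lt ht)

theorem tendsto_pow_mul_exp_neg_mul_heatPairing {ν a : ℝ} (hν : 0 ≤ ν) (ha : 0 < a)
    (g : L2HalfLine) (n : ℕ) :
    Tendsto (fun t : ℝ => ((t ^ n * Real.exp (-t) : ℝ) : ℂ) * heatPairing ν a g t) atTop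
      (𝓝 0) := by
  obtain ⟨C, hC⟩ := exists_heatPairing_bound hν ha g
  have h1 := (Real.tendsto_pow_mul_exp_neg_atTop_nhds_zero n).mul_const C
  rw [zero_mul] at h1
  refine squeeze_zero_norm' ?_ h1
  filter_upwards [eventually_ge_atTop 0] with t ht
  rw [norm_mul, Complex.norm_real, Real.norm_of_nonneg (by positivity)]
  exact mul_le_mul_of_nonneg_left (hC t ht) (by positivity)

/-- If `g` is weakly equal to `(T_ν + 1) k` on the functions `r ^ (ν + 1/2) * exp (-b r ^ 2)`, then
the heat flow satisfies the corresponding differential equation. -/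
theorem hasDerivAt_exp_neg_mul_heatPairing {ν a t : ℝ} (hν : 0 ≤ ν) (ha : 0 < a) (ht : 0 ≤ t)
    {k g : L2HalfLine} (hk : ∀ (b : ℝ) (hb : 0 < b),
      ⟪k, ((4 * b * (ν + 1) : ℝ) : ℂ) • powGaussL2 (ν + 1 / 2) b (by linarith) hb -
        ((4 * b ^ 2 : ℝ) : ℂ) • powGaussL2 (ν + 1 / 2 + 2) b (by linarith) hb +
          powGaussL2 (ν + 1 / 2) b (by linarith) hb⟫_ℂ =
        ⟪g, powGaussL2 (ν + 1 / 2) b (by linarith) hb⟫_ℂ) :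
    HasDerivAt (fun t : ℝ => (Real.exp (-t) : ℂ) * heatPairing ν a k t)
      (-((Real.exp (-t) : ℂ) * heatPairing ν a g t)) t := by
  have hb : 0 < a / (1 + 4 * a * t) := by positivity
  have h1 : HasDerivAt (fun t : ℝ => Real.exp (-t)) (-Real.exp (-t)) t := by
    simpa using (hasDerivAt_neg t).exp
  have h2 := h1.ofReal_comp.mul (hasDerivAt_heatPairing hν ha ht k hb)
  convert! h2 using 1
  have h3 := hk _ hb
  rw [inner_add_right] at h3
  rw [eq_sub_of_add_eq h3, ← gaussPairing_eq_inner, ← gaussPairing_eq_inner, heatPairing,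
    heatPairing]
  push_cast
  ring

/-- Integrate the equation of `hasDerivAt_exp_neg_mul_heatPairing` over t > 0: the term at infinity
vanishes by boundedness of the flow, and the term at 0 is the pairing of k. -/
theorem gaussPairing_eq_integral_heatPairing {ν a : ℝ} (hν : 0 ≤ ν) (ha : 0 < a)
    {k g : L2HalfLine} (hk : ∀ (b : ℝ) (hb : 0 < b),
      ⟪k, ((4 * b * (ν + 1) : ℝ) : ℂ) • powGaussL2 (ν + 1 / 2) b (by linarith) hb -
        ((4 * b ^ 2 : ℝ) : ℂ) • powGaussL2 (ν + 1 / 2 + 2) b (by linarith) hb +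
          powGaussL2 (ν + 1 / 2) b (by linarith) hb⟫_ℂ =
        ⟪g, powGaussL2 (ν + 1 / 2) b (by linarith) hb⟫_ℂ) :
    gaussPairing (ν + 1 / 2) k a =
      ∫ t in Ioi (0 : ℝ), (Real.exp (-t) : ℂ) * heatPairing ν a g t := by
  have h1 := integrableOn_pow_mul_exp_neg_mul_heatPairing hν ha g 0
  have h2 := tendsto_pow_mul_exp_neg_mul_heatPairing hν ha k 0
  simp only [pow_zero, one_mul] at h1 h2
  have h3 := integral_Ioi_of_hasDerivAt_of_tendsto' (a := 0)
    (fun t ht => hasDerivAt_exp_neg_mul_heatPairing hν ha ht hk) h1.neg h2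
  rw [integral_neg, heatPairing_zero] at h3
  simp only [neg_zero, Real.exp_zero, Complex.ofReal_one, one_mul, zero_sub, neg_inj] at h3
  exact h3.symm

/-- Integration by parts in t for t^(n+1) e^(-t) times the heat pairing of k, which vanishes at both
ends. Each application of the resolvent thus trades one power of t for a factor n + 1. -/
theorem integral_pow_mul_heatPairing_succ {ν a : ℝ} (hν : 0 ≤ ν) (ha : 0 < a)
    {k g : L2HalfLine} (hk : ∀ (b : ℝ) (hb : 0 < b),
      ⟪k, ((4 * b * (ν + 1) : ℝ) : ℂ) • powGaussL2 (ν + 1 / 2) b (by linarith) hb -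
        ((4 * b ^ 2 : ℝ) : ℂ) • powGaussL2 (ν + 1 / 2 + 2) b (by linarith) hb +
          powGaussL2 (ν + 1 / 2) b (by linarith) hb⟫_ℂ =
        ⟪g, powGaussL2 (ν + 1 / 2) b (by linarith) hb⟫_ℂ) (n : ℕ) :
    ((n : ℂ) + 1) * ∫ t in Ioi (0 : ℝ), ((t ^ n * Real.exp (-t) : ℝ) : ℂ) * heatPairing ν a k t =
      ∫ t in Ioi (0 : ℝ), ((t ^ (n + 1) * Real.exp (-t) : ℝ) : ℂ) * heatPairing ν a g t := by
  have i1 := (integrableOn_pow_mul_exp_neg_mul_heatPairing hν ha k n).const_mul ((n : ℂ) + 1)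
  have i2 := integrableOn_pow_mul_exp_neg_mul_heatPairing hν ha g (n + 1)
  have hd : ∀ t ∈ Ici (0 : ℝ), HasDerivAt
      (fun t : ℝ => ((t ^ (n + 1) * Real.exp (-t) : ℝ) : ℂ) * heatPairing ν a k t)
      (((n : ℂ) + 1) * (((t ^ n * Real.exp (-t) : ℝ) : ℂ) * heatPairing ν a k t) -
        ((t ^ (n + 1) * Real.exp (-t) : ℝ) : ℂ) * heatPairing ν a g t) t := by
    intro t ht
    have h1 := ((hasDerivAt_pow (n + 1) t).ofReal_comp).mul
      (hasDerivAt_exp_neg_mul_heatPairing hν ha ht hk)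
    convert! h1 using 1
    · funext t
      simp only [Pi.mul_apply]
      push_cast
      ring
    · push_cast
      ring
  have h3 := integral_Ioi_of_hasDerivAt_of_tendsto' hd (i1.sub i2)
    (tendsto_pow_mul_exp_neg_mul_heatPairing hν ha k (n + 1))
  rw [integral_sub i1 i2, integral_const_mul] at h3
  simpa [sub_eq_zero] using h3

/-- The powers of the resolvent of the Friedrichs extension of `T_ν`, on the functions
`r ^ (ν + 1/2) * exp (-a r ^ 2)`, as Laplace transforms of the heat flow. -/
theorem inner_resolvent_pow_powGaussL2 {ν a : ℝ} (hν : 0 ≤ ν) (ha : 0 < a)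
    {R : L2HalfLine →L[ℂ] L2HalfLine} (hR : IsResolvent (besselFriedrichs ν) 1 R) (n : ℕ) :
    ∀ g : L2HalfLine, (n.factorial : ℂ) *
        ⟪g, (R ^ (n + 1)) (powGaussL2 (ν + 1 / 2) a (by linarith) ha)⟫_ℂ =
      ∫ t in Ioi (0 : ℝ), ((t ^ n * Real.exp (-t) : ℝ) : ℂ) * heatPairing ν a g t := by
  -- Moving R onto g as its adjoint makes k = R* g a weak solution of (T_ν + 1) k = g on the
  -- Gaussians. Self-adjointness of R is not needed.
  have hk : ∀ g : L2HalfLine, ∀ (b : ℝ) (hb : 0 < b),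
      ⟪R.adjoint g, ((4 * b * (ν + 1) : ℝ) : ℂ) • powGaussL2 (ν + 1 / 2) b (by linarith) hb -
        ((4 * b ^ 2 : ℝ) : ℂ) • powGaussL2 (ν + 1 / 2 + 2) b (by linarith) hb +
          powGaussL2 (ν + 1 / 2) b (by linarith) hb⟫_ℂ =
        ⟪g, powGaussL2 (ν + 1 / 2) b (by linarith) hb⟫_ℂ := by
    intro g b hb
    obtain ⟨h1, h2⟩ := besselFriedrichs_powGauss hν hb
    have h3 := hR.2 ⟨_, h1⟩
    rw [h2, one_smul] at h3
    rw [ContinuousLinearMap.adjoint_inner_left, h3]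
  induction n with
  | zero =>
    intro g
    rw [zero_add, pow_one, ← ContinuousLinearMap.adjoint_inner_left, ← gaussPairing_eq_inner,
      gaussPairing_eq_integral_heatPairing hν ha (hk g)]
    simp
  | succ n ih =>
    intro g
    rw [pow_succ', mul_apply_eq_comp, ← ContinuousLinearMap.adjoint_inner_left,
      ← integral_pow_mul_heatPairing_succ hν ha (hk g), ← ih, Nat.factorial_succ]
    push_cast
    ring

/-- A vector orthogonal to the range is a weak solution with right side 0. Its pairing with e^(-t)
u_t is then constant in t, and it decays, so it is zero. -/
theorem inner_powGaussL2_eq_zero_of_range {ν a : ℝ} (hν : 0 ≤ ν) (ha : 0 < a) {g : L2HalfLine}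
    (hg : ∀ u : (besselFriedrichs ν).domain, ⟪g, besselFriedrichs ν u + u⟫_ℂ = 0) :
    ⟪g, powGaussL2 (ν + 1 / 2) a (by linarith) ha⟫_ℂ = 0 := by
  have hz : ∀ t, heatPairing ν a 0 t = 0 := by
    intro t
    have : gaussPairing (ν + 1 / 2) 0 (a / (1 + 4 * a * t)) = 0 := by
      refine integral_eq_zero_of_ae ?_
      filter_upwards [Lp.coeFn_zero ℂ 2 (volume.restrict (Ioi (0 : ℝ)))] with r hr
      rw [hr]
      simp
    rw [heatPairing, this, mul_zero]
  rw [← gaussPairing_eq_inner, gaussPairing_eq_integral_heatPairing hν ha (g := 0) fun b hb => ?_]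
  · simp [hz]
  · obtain ⟨h1, h2⟩ := besselFriedrichs_powGauss hν hb
    have h3 := hg ⟨_, h1⟩
    rw [h2] at h3
    rw [h3, inner_zero_left]

/-! ### Density of the functions `r ^ p * exp (-a r ^ 2)` -/

section Laplace

open ProbabilityTheory

/-- The positive part of the function `ρ` on the half-line, as a measure. -/
noncomputable def posPartMeasure (ρ : ℝ → ℝ) : Measure ℝ :=
  (volume.restrict (Ioi (0 : ℝ))).withDensity fun r => ENNReal.ofReal (ρ r)

theorem isFiniteMeasure_posPartMeasure {ρ : ℝ → ℝ} (hρ : IntegrableOn ρ (Ioi 0)) :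
    IsFiniteMeasure (posPartMeasure ρ) :=
  isFiniteMeasure_withDensity_ofReal hρ.2

theorem integrable_posPartMeasure {ρ : ℝ → ℝ} (hρ : IntegrableOn ρ (Ioi 0)) {F : ℝ → ℝ}
    (hF : Measurable F) (h : IntegrableOn (fun r => ρ r * F r) (Ioi 0)) :
    Integrable F (posPartMeasure ρ) := by
  rw [posPartMeasure, integrable_withDensity_iff_integrable_smul₀'
    hρ.aestronglyMeasurable.aemeasurable.ennreal_ofReal
    (Eventually.of_forall fun _ => ENNReal.ofReal_lt_top)]
  refine h.norm.mono' ?_ (Eventually.of_forall fun r => ?_)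
  · exact (hρ.aestronglyMeasurable.aemeasurable.ennreal_ofReal.ennreal_toReal.smul
      hF.aemeasurable).aestronglyMeasurable
  · rw [smul_eq_mul, norm_mul, norm_mul, ENNReal.toReal_ofReal']
    refine mul_le_mul_of_nonneg_right ?_ (norm_nonneg _)
    rw [Real.norm_of_nonneg (le_max_right _ _)]
    exact max_le (le_abs_self _) (abs_nonneg _)

/-- Jordan decomposition of ρ: the positive part of -ρ is the negative part of ρ. -/
theorem integral_posPartMeasure_sub {ρ : ℝ → ℝ} (hρ : IntegrableOn ρ (Ioi 0)) {F : ℝ → ℝ}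
    (hF : Measurable F) (h : IntegrableOn (fun r => ρ r * F r) (Ioi 0)) :
    ∫ r, F r ∂posPartMeasure ρ - ∫ r, F r ∂posPartMeasure (fun r => -ρ r) =
      ∫ r in Ioi (0 : ℝ), ρ r * F r := by
  have hm := hρ.aestronglyMeasurable.aemeasurable
  have hm' : AEMeasurable (fun r => -ρ r) (volume.restrict (Ioi (0 : ℝ))) := hm.neg
  have i1 := integrable_posPartMeasure hρ hF h
  have i2 := integrable_posPartMeasure (ρ := fun r => -ρ r) hρ.neg hF (by simpa using h.neg)
  rw [posPartMeasure, integrable_withDensity_iff_integrable_smul₀' hm.ennreal_ofReal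
    (Eventually.of_forall fun _ => ENNReal.ofReal_lt_top)] at i1
  rw [posPartMeasure, integrable_withDensity_iff_integrable_smul₀' hm'.ennreal_ofReal
    (Eventually.of_forall fun _ => ENNReal.ofReal_lt_top)] at i2
  rw [posPartMeasure, posPartMeasure, integral_withDensity_eq_integral_toReal_smul₀
      hm.ennreal_ofReal (Eventually.of_forall fun _ => ENNReal.ofReal_lt_top),
    integral_withDensity_eq_integral_toReal_smul₀
      hm'.ennreal_ofReal (Eventually.of_forall fun _ => ENNReal.ofReal_lt_top),
    ← integral_sub i1 i2]
  refine integral_congr_ae (Eventually.of_forall fun r => ?_)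
  simp only [smul_eq_mul, ENNReal.toReal_ofReal']
  rw [← sub_mul]
  congr 1
  rcases le_total (ρ r) 0 with h | h
  · rw [max_eq_right h, max_eq_left (by linarith)]
    ring
  · rw [max_eq_left h, max_eq_right (by linarith)]
    ring

/-- Injectivity of the Laplace transform in the variable `r ^ 2`. -/
theorem ae_eq_zero_of_integral_mul_exp_sq {ρ : ℝ → ℝ}
    (hρ : ∀ t < (1 : ℝ), IntegrableOn (fun r => ρ r * Real.exp (t * r ^ 2)) (Ioi 0))
    (h0 : ∀ t < (1 : ℝ), ∫ r in Ioi (0 : ℝ), ρ r * Real.exp (t * r ^ 2) = 0) :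
    ρ =ᵐ[volume.restrict (Ioi (0 : ℝ))] 0 := by
  have hρ0 : IntegrableOn ρ (Ioi 0) := by simpa using hρ 0 one_pos
  have hm := hρ0.aestronglyMeasurable.aemeasurable
  set μ₁ := posPartMeasure ρ with hμ₁
  set μ₂ := posPartMeasure (fun r => -ρ r) with hμ₂
  have f₁ : IsFiniteMeasure μ₁ := isFiniteMeasure_posPartMeasure hρ0
  have f₂ : IsFiniteMeasure μ₂ := isFiniteMeasure_posPartMeasure (ρ := fun r => -ρ r) hρ0.neg
  set X : ℝ → ℝ := fun r => r ^ 2 with hX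
  have hXm : Measurable X := by fun_prop
  have hexp : ∀ t : ℝ, Measurable fun r => Real.exp (t * X r) := fun t => by fun_prop
  have s₁ : Iio 1 ⊆ integrableExpSet X μ₁ := fun t ht =>
    integrable_posPartMeasure hρ0 (hexp t) (hρ t ht)
  have s₂ : Iio 1 ⊆ integrableExpSet X μ₂ := fun t ht =>
    integrable_posPartMeasure (ρ := fun r => -ρ r) hρ0.neg (hexp t) (by simpa using (hρ t ht).neg)
  have hU : ∀ {μ : Measure ℝ}, Iio 1 ⊆ integrableExpSet X μ →
      {z : ℂ | z.re < 1} ⊆ {z | z.re ∈ interior (integrableExpSet X μ)} := fun h z hz =>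
    interior_maximal h isOpen_Iio hz
  have hreal : ∀ t : ℝ, t < 1 → complexMGF X μ₁ t = complexMGF X μ₂ t := by
    intro t ht
    rw [complexMGF_ofReal, complexMGF_ofReal, mgf, mgf, ← sub_eq_zero, ← Complex.ofReal_sub,
      integral_posPartMeasure_sub hρ0 (hexp t) (hρ t ht), h0 t ht, Complex.ofReal_zero]
  -- The complex moment generating functions of r² under the two parts of ρ are analytic for Re z <
  -- 1 and agree on the real axis near 0, hence throughout. On the imaginary axis they are
  -- characteristic functions.
  have hEq : EqOn (complexMGF X μ₁) (complexMGF X μ₂) {z | z.re < 1} := by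
    refine AnalyticOnNhd.eqOn_of_preconnected_of_frequently_eq (z₀ := ((0 : ℝ) : ℂ))
      (analyticOnNhd_complexMGF.mono (hU s₁)) (analyticOnNhd_complexMGF.mono (hU s₂))
      (convex_halfSpace_re_lt 1).isPreconnected (by simp) ?_
    have ht : Tendsto (fun x : ℝ => (x : ℂ)) (𝓝[≠] 0) (𝓝[≠] ((0 : ℝ) : ℂ)) :=
      Complex.continuous_ofReal.continuousWithinAt.tendsto_nhdsWithin
        fun x hx => Complex.ofReal_injective.ne hx
    refine ht.frequently (Eventually.frequently ?_)
    filter_upwards [nhdsWithin_le_nhds (Iio_mem_nhds one_pos)] with x hx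
    exact hreal x hx
  have hmap : μ₁.map X = μ₂.map X := by
    refine Measure.ext_of_charFun ?_
    funext t
    rw [← complexMGF_mul_I hXm.aemeasurable, ← complexMGF_mul_I hXm.aemeasurable]
    exact hEq (by simp)
  -- Both measures live on the half-line, where the square root inverts r ↦ r², so the push-forwards
  -- determine them.
  have hsqrt : ∀ {μ : Measure ℝ}, μ ≪ volume.restrict (Ioi (0 : ℝ)) →
      (μ.map X).map Real.sqrt = μ := by
    intro μ hμ
    rw [Measure.map_map Real.continuous_sqrt.measurable hXm]
    conv_rhs => rw [← Measure.map_id (μ := μ)]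
    refine Measure.map_congr ?_
    filter_upwards [hμ.ae_le (ae_restrict_mem measurableSet_Ioi)] with r hr
    exact Real.sqrt_sq (le_of_lt hr)
  have hμ : μ₁ = μ₂ := by
    have e₁ : μ₁ ≪ volume.restrict (Ioi (0 : ℝ)) := withDensity_absolutelyContinuous _ _
    have e₂ : μ₂ ≪ volume.restrict (Ioi (0 : ℝ)) := withDensity_absolutelyContinuous _ _
    rw [← hsqrt e₁, ← hsqrt e₂, hmap]
  have hae := (withDensity_eq_iff_of_sigmaFinite hm.ennreal_ofReal hm.neg.ennreal_ofReal).1 hμ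
  filter_upwards [hae] with r hr
  have hr' := congrArg ENNReal.toReal hr
  rw [ENNReal.toReal_ofReal', ENNReal.toReal_ofReal'] at hr'
  change max (ρ r) 0 = max (-ρ r) 0 at hr'
  rw [Pi.zero_apply]
  rcases le_total (ρ r) 0 with h | h
  · rw [max_eq_right h, max_eq_left (by linarith)] at hr'
    linarith
  · rw [max_eq_left h, max_eq_right (by linarith)] at hr'
    linarith

end Laplace

theorem eq_zero_of_inner_powGaussL2_eq_zero {p : ℝ} (hp : -1 / 2 < p) {g : L2HalfLine}
    (hg : ∀ (a : ℝ) (ha : 0 < a), ⟪g, powGaussL2 p a hp ha⟫_ℂ = 0) : g = 0 := by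
  -- Absorbing the Gaussian with parameter 1 into the density turns the parameters a > 0 into
  -- exponents t = 1 - a < 1, a range that contains a neighbourhood of 0.
  set G : ℝ → ℂ := fun r => starRingEnd ℂ ((g : ℝ → ℂ) r) * (powGauss p 1 r : ℂ) with hG
  have hGe : ∀ t r : ℝ, G r * (Real.exp (t * r ^ 2) : ℂ) =
      starRingEnd ℂ ((g : ℝ → ℂ) r) * (powGauss p (1 - t) r : ℂ) := by
    intro t r
    simp only [hG, powGauss]
    rw [show -(1 - t) * r ^ 2 = -1 * r ^ 2 + t * r ^ 2 by ring, Real.exp_add]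
    push_cast
    ring
  have hi : ∀ t < (1 : ℝ), IntegrableOn (fun r => G r * (Real.exp (t * r ^ 2) : ℂ)) (Ioi 0) := by
    intro t ht
    simp only [hGe]
    exact integrableOn_conj_mul_powGauss hp (by linarith) g
  have h0 : ∀ t < (1 : ℝ), ∫ r in Ioi (0 : ℝ), G r * (Real.exp (t * r ^ 2) : ℂ) = 0 := by
    intro t ht
    simp only [hGe]
    have := gaussPairing_eq_inner hp (by linarith : 0 < 1 - t) g
    rw [hg] at this
    exact this
  have hre : (fun r => (G r).re) =ᵐ[volume.restrict (Ioi (0 : ℝ))] 0 := by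
    refine ae_eq_zero_of_integral_mul_exp_sq (fun t ht => ?_) fun t ht => ?_
    · exact (hi t ht).re.congr (Eventually.of_forall fun r => Complex.re_mul_ofReal _ _)
    · have h := congrArg Complex.re (h0 t ht)
      have h2 := integral_re (hi t ht)
      simp only [RCLike.re_to_complex, Complex.re_mul_ofReal] at h2
      rw [h2, h, Complex.zero_re]
  have him : (fun r => (G r).im) =ᵐ[volume.restrict (Ioi (0 : ℝ))] 0 := by
    refine ae_eq_zero_of_integral_mul_exp_sq (fun t ht => ?_) fun t ht => ?_
    · exact (hi t ht).im.congr (Eventually.of_forall fun r => Complex.im_mul_ofReal _ _)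
    · have h := congrArg Complex.im (h0 t ht)
      have h2 := integral_im (hi t ht)
      simp only [RCLike.im_to_complex, Complex.im_mul_ofReal] at h2
      rw [h2, h, Complex.zero_im]
  rw [Lp.eq_zero_iff_ae_eq_zero]
  filter_upwards [hre, him, ae_restrict_mem measurableSet_Ioi] with r h1 h2 hr
  have h3 : G r = 0 := Complex.ext h1 h2
  have h4 : (powGauss p 1 r : ℂ) ≠ 0 := Complex.ofReal_ne_zero.2 (powGauss_pos p 1 hr).ne'
  simpa [hG, h4] using h3

/-- The span of the functions `r ^ p * exp (-a r ^ 2)` is dense in `L²((0, ∞))`. -/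
theorem span_powGaussL2_dense {p : ℝ} (hp : -1 / 2 < p) :
    (Submodule.span ℂ {u : L2HalfLine | ∃ (a : ℝ) (ha : 0 < a),
      u = powGaussL2 p a hp ha}).topologicalClosure = ⊤ := by
  rw [Submodule.topologicalClosure_eq_top_iff, Submodule.eq_bot_iff]
  intro g hg
  refine eq_zero_of_inner_powGaussL2_eq_zero hp fun a ha => ?_
  rw [← inner_conj_symm, (Submodule.mem_orthogonal _ _).1 hg _
    (Submodule.subset_span ⟨a, ha, rfl⟩), map_zero]

theorem existsUnique_isResolvent {ν : ℝ} (hν : 0 ≤ ν) :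
    ∃! R : L2HalfLine →L[ℂ] L2HalfLine, IsResolvent (besselFriedrichs ν) 1 R := by
  obtain ⟨R, hR⟩ := exists_isResolvent (besselOp_isNonneg ν) (besselOp_isFormalAdjoint ν)
    (besselOp_dense ν) fun g hg => eq_zero_of_inner_powGaussL2_eq_zero (p := ν + 1 / 2)
      (by linarith) fun a ha => inner_powGaussL2_eq_zero_of_range hν ha hg
  exact ⟨R, hR, fun R' hR' => hR'.unique hR⟩

/-! ### Mellin transforms of superpositions -/

/-- The scaling rule of the Mellin transform for the absolute integrand, which Fubini requires in
the next lemma. -/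
theorem integral_norm_cpow_mul_comp_mul_left (f : ℝ → ℂ) (s : ℂ) {c : ℝ} (hc : 0 < c) :
    ∫ x in Ioi (0 : ℝ), ‖(x : ℂ) ^ (s - 1) * f (c * x)‖ =
      ‖(c : ℂ) ^ (-s)‖ * ∫ x in Ioi (0 : ℝ), ‖(x : ℂ) ^ (s - 1) * f x‖ := by
  have h1 := integral_comp_mul_left_Ioi (fun x : ℝ => ‖(x : ℂ) ^ (s - 1) * f x‖) 0 hc
  rw [mul_zero, smul_eq_mul] at h1
  have h2 : ∫ x in Ioi (0 : ℝ), ‖((c * x : ℝ) : ℂ) ^ (s - 1) * f (c * x)‖ =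
      c ^ (s.re - 1) * ∫ x in Ioi (0 : ℝ), ‖(x : ℂ) ^ (s - 1) * f (c * x)‖ := by
    rw [← integral_const_mul]
    refine setIntegral_congr_fun measurableSet_Ioi fun x hx => ?_
    have hx' : 0 < x := hx
    rw [norm_mul, norm_mul, Complex.norm_cpow_eq_rpow_re_of_pos (mul_pos hc hx'),
      Complex.norm_cpow_eq_rpow_re_of_pos hx', Real.mul_rpow hc.le hx'.le, mul_assoc]
    simp
  rw [h2] at h1
  rw [Complex.norm_cpow_eq_rpow_re_of_pos hc]
  have h3 : c ^ (-s).re * c ^ (s.re - 1) = c⁻¹ := by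
    rw [← Real.rpow_add hc, Complex.neg_re, ← Real.rpow_neg_one]
    congr 1
    ring
  have h4 : c ^ (-s).re ≠ 0 := (Real.rpow_pos_of_pos hc _).ne'
  have h5 : c ^ (s.re - 1) ≠ 0 := (Real.rpow_pos_of_pos hc _).ne'
  rw [← h3, mul_comm (c ^ (-s).re), mul_assoc] at h1
  exact mul_left_cancel₀ h5 h1

/-- The Mellin transform of a superposition of dilates. -/
theorem hasMellin_superposition {S : Set ℝ} (hS : MeasurableSet S) {g f : ℝ → ℂ} {κ : ℝ → ℝ}
    (hκ : Measurable κ) (hg : Measurable g) (hf : Measurable f) (hκ0 : ∀ v ∈ S, 0 < κ v) {s : ℂ}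
    (hfs : MellinConvergent f s) (hgs : IntegrableOn (fun v => g v * (κ v : ℂ) ^ (-s)) S) :
    HasMellin (fun x => ∫ v in S, g v * f (κ v * x)) s
      ((∫ v in S, g v * (κ v : ℂ) ^ (-s)) * mellin f s) := by
  set Φ : ℝ → ℝ → ℂ := fun v x => g v * ((x : ℂ) ^ (s - 1) * f (κ v * x)) with hΦ
  have hm : AEStronglyMeasurable (Function.uncurry Φ)
      ((volume.restrict S).prod (volume.restrict (Ioi (0 : ℝ)))) := by
    refine Measurable.aestronglyMeasurable ?_
    simp only [hΦ, Function.uncurry_def]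
    fun_prop
  -- For fixed v the L¹ norm in x is ‖g v · κ(v)^(-s)‖ times the absolute Mellin integral of f, so
  -- the two integrability hypotheses combine to absolute convergence.
  have hi : Integrable (Function.uncurry Φ)
      ((volume.restrict S).prod (volume.restrict (Ioi (0 : ℝ)))) := by
    refine (integrable_prod_iff hm).2 ⟨?_, ?_⟩
    · filter_upwards [ae_restrict_mem hS] with v hv
      have h := (MellinConvergent.comp_mul_left (hκ0 v hv)).2 hfs
      exact Integrable.const_mul h (g v)
    · refine (hgs.norm.mul_const (∫ x in Ioi (0 : ℝ), ‖(x : ℂ) ^ (s - 1) * f x‖)).congr ?_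
      filter_upwards [ae_restrict_mem hS] with v hv
      simp only [Function.uncurry, hΦ, norm_mul (g v)]
      rw [integral_const_mul, integral_norm_cpow_mul_comp_mul_left f s (hκ0 v hv), mul_assoc]
  have hpt : ∀ x : ℝ, ∫ v in S, Φ v x = (x : ℂ) ^ (s - 1) • ∫ v in S, g v * f (κ v * x) := by
    intro x
    rw [smul_eq_mul, ← integral_const_mul]
    refine integral_congr_ae (Eventually.of_forall fun v => ?_)
    simp only [hΦ]
    ring
  refine ⟨?_, ?_⟩
  · refine hi.integral_prod_right.congr (Eventually.of_forall fun x => ?_)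
    exact hpt x
  · rw [mellin]
    simp only [← hpt]
    rw [← integral_integral_swap hi, ← integral_mul_const]
    refine setIntegral_congr_fun hS fun v hv => ?_
    simp only [hΦ]
    rw [integral_const_mul]
    have h := mellin_comp_mul_left f s (hκ0 v hv)
    simp only [mellin, smul_eq_mul] at h
    rw [h, mellin]
    simp only [smul_eq_mul]
    ring

/-! ### The exponentially scaled modified Bessel function -/

theorem integral_beta {s t : ℂ} (hs : 0 < s.re) (ht : 0 < t.re) :
    IntegrableOn (fun v : ℝ => (v : ℂ) ^ (s - 1) * (2 - (v : ℂ)) ^ (t - 1)) (Ioo 0 2) ∧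
    ∫ v in Ioo (0 : ℝ) 2, (v : ℂ) ^ (s - 1) * (2 - (v : ℂ)) ^ (t - 1) =
      (2 : ℂ) ^ (s + t - 1) * (Complex.Gamma s * Complex.Gamma t / Complex.Gamma (s + t)) := by
  have hst : 0 < (s + t).re := by
    rw [Complex.add_re]
    positivity
  have h1 := Complex.betaIntegral_scaled s t (two_pos : (0 : ℝ) < 2)
  rw [intervalIntegral.integral_of_le (by norm_num), integral_Ioc_eq_integral_Ioo] at h1
  have h2 : ∫ v in Ioo (0 : ℝ) 2, (v : ℂ) ^ (s - 1) * (2 - (v : ℂ)) ^ (t - 1) =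
      (2 : ℂ) ^ (s + t - 1) * (Complex.Gamma s * Complex.Gamma t / Complex.Gamma (s + t)) := by
    rw [Complex.Gamma_mul_Gamma_eq_betaIntegral hs ht,
      mul_div_cancel_left₀ _ (Complex.Gamma_ne_zero_of_re_pos hst)]
    simpa using h1
  -- A Bochner integral with nonzero value comes from an integrable function, so integrability is
  -- read off from the formula.
  refine ⟨Integrable.of_integral_ne_zero ?_, h2⟩
  rw [h2]
  have h3 : (2 : ℂ) ^ (s + t - 1) ≠ 0 := by simp [Complex.cpow_eq_zero_iff]
  exact mul_ne_zero h3 (div_ne_zero (mul_ne_zero (Complex.Gamma_ne_zero_of_re_pos hs)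
    (Complex.Gamma_ne_zero_of_re_pos ht)) (Complex.Gamma_ne_zero_of_re_pos hst))

/-- The weight in the integral representation of the scaled Bessel function. -/
noncomputable def besselWeight (ν v : ℝ) : ℝ :=
  (√Real.pi * Real.Gamma (ν + 1 / 2))⁻¹ * (v ^ (-1 / 2 : ℝ) * (2 - v) ^ (ν - 1 / 2))

/-- The function `e ^ (-x) * I_ν x`, where `I_ν` is the modified Bessel function. -/
noncomputable def scaledBesselI (ν x : ℝ) : ℝ :=
  ∫ v in Ioo (0 : ℝ) 2, besselWeight ν v * ((v * x / 2) ^ ν * Real.exp (-(v * x)))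

theorem measurable_besselWeight (ν : ℝ) : Measurable (besselWeight ν) := by
  unfold besselWeight
  fun_prop

theorem besselWeight_nonneg {ν v : ℝ} (hν : 0 ≤ ν) (hv : v ∈ Ioo (0 : ℝ) 2) :
    0 ≤ besselWeight ν v := by
  have h1 : 0 < Real.Gamma (ν + 1 / 2) := Real.Gamma_pos_of_pos (by linarith)
  have h2 : 0 ≤ 2 - v := by linarith [hv.2]
  have h3 : 0 ≤ v := hv.1.le
  unfold besselWeight
  positivity

/-- In Poisson's integral for I_ν, with (1-u²)^(ν-1/2) e^(xu) on (-1,1), put v = 1 - u: then 1 - u²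
= v(2-v), and e^(-x) I_ν(x) becomes a superposition of the dilates y = vx of (y/2)^ν e^(-y). Moving
v^ν into the dilate leaves v^(-1/2) in the weight, so its Mellin factor is a beta integrand. -/
theorem ofReal_besselWeight_mul_cpow (ν : ℝ) (a : ℂ) {v : ℝ} (hv : v ∈ Ioo (0 : ℝ) 2) :
    (besselWeight ν v : ℂ) * (v : ℂ) ^ (-a) = (((√Real.pi * Real.Gamma (ν + 1 / 2))⁻¹ : ℝ) : ℂ) *
      ((v : ℂ) ^ ((1 / 2 - a) - 1) * (2 - (v : ℂ)) ^ ((ν + 1 / 2 : ℂ) - 1)) := by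
  have h2 : 0 ≤ 2 - v := by linarith [hv.2]
  have hv0 : (v : ℂ) ≠ 0 := Complex.ofReal_ne_zero.2 hv.1.ne'
  rw [besselWeight, Complex.ofReal_mul, Complex.ofReal_mul, Complex.ofReal_cpow hv.1.le,
    Complex.ofReal_cpow h2,
    show (1 / 2 - a) - 1 = ((-1 / 2 : ℝ) : ℂ) + -a by push_cast; ring, Complex.cpow_add _ _ hv0,
    show ((ν + 1 / 2 : ℂ) - 1) = ((ν - 1 / 2 : ℝ) : ℂ) by push_cast; ring]
  push_cast
  ring

theorem integrableOn_besselWeight {ν : ℝ} (hν : 0 ≤ ν) : IntegrableOn (besselWeight ν) (Ioo 0 2) := by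
  have h := (integral_beta (s := 1 / 2 - 0) (t := ν + 1 / 2) (by norm_num) (by
    simp
    linarith)).1.const_mul (((√Real.pi * Real.Gamma (ν + 1 / 2))⁻¹ : ℝ) : ℂ)
  have h2 : IntegrableOn (fun v => (besselWeight ν v : ℂ)) (Ioo 0 2) := by
    refine IntegrableOn.congr_fun h (fun v hv => ?_) measurableSet_Ioo
    rw [← ofReal_besselWeight_mul_cpow ν 0 hv, neg_zero, Complex.cpow_zero, mul_one]
  exact h2.re

theorem measurable_scaledBesselI (ν : ℝ) : Measurable (scaledBesselI ν) := by
  refine (StronglyMeasurable.integral_prod_right (f := fun x v =>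
    besselWeight ν v * ((v * x / 2) ^ ν * Real.exp (-(v * x)))) ?_).measurable
  refine Measurable.stronglyMeasurable ?_
  have := measurable_besselWeight ν
  simp only [Function.uncurry_def]
  fun_prop

theorem exists_bessel_integrand_bound {ν : ℝ} (hν : 0 ≤ ν) :
    ∃ M, 0 ≤ M ∧ ∀ v ∈ Ioo (0 : ℝ) 2, ∀ x, 0 ≤ x →
      ‖besselWeight ν v * ((v * x / 2) ^ ν * Real.exp (-(v * x)))‖ ≤ besselWeight ν v * M := by
  -- In the variable y = v x / 2 the function is y^ν e^(-2y), hence c = 2.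
  obtain ⟨M, hM0, hM⟩ := exists_rpow_mul_exp_le (p := ν) (c := 2) hν two_pos
  refine ⟨M, hM0, fun v hv x hx => ?_⟩
  have h1 : 0 ≤ v * x / 2 := by
    have := hv.1
    positivity
  rw [Real.norm_of_nonneg (mul_nonneg (besselWeight_nonneg hν hv) (by positivity))]
  refine mul_le_mul_of_nonneg_left ?_ (besselWeight_nonneg hν hv)
  convert! hM _ h1 using 3
  ring

theorem scaledBesselI_nonneg {ν x : ℝ} (hν : 0 ≤ ν) (hx : 0 ≤ x) : 0 ≤ scaledBesselI ν x := by
  refine setIntegral_nonneg measurableSet_Ioo fun v hv => ?_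
  have h1 := besselWeight_nonneg hν hv
  have h2 := hv.1
  positivity

theorem exists_scaledBesselI_le {ν : ℝ} (hν : 0 ≤ ν) :
    ∃ M, 0 ≤ M ∧ ∀ x, 0 ≤ x → scaledBesselI ν x ≤ M := by
  obtain ⟨M, hM0, hM⟩ := exists_bessel_integrand_bound hν
  refine ⟨∫ v in Ioo (0 : ℝ) 2, besselWeight ν v * M, setIntegral_nonneg measurableSet_Ioo
    fun v hv => mul_nonneg (besselWeight_nonneg hν hv) hM0, fun x hx => ?_⟩
  rw [scaledBesselI]
  refine (Real.le_norm_self _).trans (norm_integral_le_of_norm_le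
    ((integrableOn_besselWeight hν).mul_const M) ?_)
  filter_upwards [ae_restrict_mem measurableSet_Ioo] with v hv
  exact hM v hv x hx

theorem continuousOn_scaledBesselI {ν : ℝ} (hν : 0 ≤ ν) :
    ContinuousOn (scaledBesselI ν) (Ici 0) := by
  obtain ⟨M, hM0, hM⟩ := exists_bessel_integrand_bound hν
  refine continuousOn_of_dominated (bound := fun v => besselWeight ν v * M) (fun x _ => ?_)
    (fun x hx => ?_) ((integrableOn_besselWeight hν).mul_const M) ?_
  · have := measurable_besselWeight ν
    exact Measurable.aestronglyMeasurable (by fun_prop)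
  · filter_upwards [ae_restrict_mem measurableSet_Ioo] with v hv
    exact hM v hv x hx
  · filter_upwards with v
    have h1 : Continuous fun x : ℝ => (v * x / 2) ^ ν :=
      (Real.continuous_rpow_const hν).comp (by fun_prop)
    fun_prop

/-- The Mellin transform of the scaled Bessel function. -/
theorem hasMellin_scaledBesselI {ν : ℝ} {a : ℂ} (ha1 : -ν < a.re)
    (ha2 : a.re < 1 / 2) :
    HasMellin (fun x => (scaledBesselI ν x : ℂ)) a
      (Complex.Gamma (1 / 2 - a) * Complex.Gamma (a + ν) /
        ((√Real.pi : ℂ) * 2 ^ a * Complex.Gamma (1 + ν - a))) := by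
  set f : ℝ → ℂ := fun y => (((y / 2) ^ ν * Real.exp (-y) : ℝ) : ℂ) with hf
  set c : ℂ := (((√Real.pi * Real.Gamma (ν + 1 / 2))⁻¹ : ℝ) : ℂ) with hc
  have hfm : HasMellin f a ((2 : ℂ) ^ (-(ν : ℂ)) * Complex.Gamma (a + ν)) := by
    have hre : 0 < (a + ν).re := by
      simp
      linarith
    have e : ∀ y ∈ Ioi (0 : ℝ), (y : ℂ) ^ (a - 1) • f y =
        (2 : ℂ) ^ (-(ν : ℂ)) * ((Real.exp (-y) : ℂ) * (y : ℂ) ^ (a + ν - 1)) := by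
      intro y hy
      have hy' : (0 : ℝ) < y := hy
      have hy0 : (y : ℂ) ≠ 0 := Complex.ofReal_ne_zero.2 hy'.ne'
      simp only [hf, smul_eq_mul]
      rw [Real.div_rpow hy'.le two_pos.le, Complex.ofReal_mul, Complex.ofReal_div,
        Complex.ofReal_cpow hy'.le, Complex.ofReal_cpow two_pos.le,
        show a + ν - 1 = (a - 1) + ν by ring, Complex.cpow_add _ _ hy0, Complex.cpow_neg]
      push_cast
      ring
    refine ⟨?_, ?_⟩
    · exact IntegrableOn.congr_fun ((Complex.GammaIntegral_convergent hre).const_mul _)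
        (fun y hy => (e y hy).symm) measurableSet_Ioi
    · rw [mellin, setIntegral_congr_fun measurableSet_Ioi e, integral_const_mul,
        Complex.Gamma_eq_integral hre, Complex.GammaIntegral]
  -- The beta integral at v = 0 needs Re a < 1/2. Positivity of ν + 1/2 follows from the two bounds
  -- on Re a together.
  have hb := integral_beta (s := 1 / 2 - a) (t := ν + 1 / 2) (by
    simp only [Complex.sub_re]
    norm_num
    linarith) (by
    simp
    linarith)
  have hgi : IntegrableOn (fun v : ℝ => (besselWeight ν v : ℂ) * (v : ℂ) ^ (-a)) (Ioo 0 2) :=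
    IntegrableOn.congr_fun (hb.1.const_mul c)
      (fun v hv => (ofReal_besselWeight_mul_cpow ν a hv).symm) measurableSet_Ioo
  have hgv : ∫ v in Ioo (0 : ℝ) 2, (besselWeight ν v : ℂ) * (v : ℂ) ^ (-a) =
      c * ((2 : ℂ) ^ (ν - a) * (Complex.Gamma (1 / 2 - a) * Complex.Gamma (ν + 1 / 2) /
        Complex.Gamma (1 + ν - a))) := by
    rw [setIntegral_congr_fun measurableSet_Ioo
      fun v hv => ofReal_besselWeight_mul_cpow ν a hv, integral_const_mul, hb.2]
    congr 3
    · ring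
    · congr 1
      ring
  have key := hasMellin_superposition measurableSet_Ioo (κ := fun v => v) measurable_id
    (Complex.measurable_ofReal.comp (measurable_besselWeight ν)) (f := f) (by
      simp only [hf]
      fun_prop) (fun v hv => hv.1) hfm.1 hgi
  have hfun : (fun x => (scaledBesselI ν x : ℂ)) =
      fun x => ∫ v in Ioo (0 : ℝ) 2, (Complex.ofReal ∘ besselWeight ν) v * f (v * x) := by
    funext x
    rw [scaledBesselI, ← integral_complex_ofReal]
    simp only [hf, Function.comp, Complex.ofReal_mul]
  rw [hfun]
  convert! key using 1
  simp only [Function.comp]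
  rw [hgv, hfm.2, hc]
  have hG : Complex.Gamma (ν + 1 / 2) ≠ 0 := Complex.Gamma_ne_zero_of_re_pos (by
    simp
    linarith)
  have hpi : (√Real.pi : ℂ) ≠ 0 := Complex.ofReal_ne_zero.2 (Real.sqrt_pos.2 Real.pi_pos).ne'
  have h2 : (2 : ℂ) ^ a ≠ 0 := by simp [Complex.cpow_eq_zero_iff]
  have h2' : (2 : ℂ) ^ (ν : ℂ) ≠ 0 := by simp [Complex.cpow_eq_zero_iff]
  have hGr : ((Real.Gamma (ν + 1 / 2) : ℝ) : ℂ) = Complex.Gamma (ν + 1 / 2) := by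
    rw [← Complex.Gamma_ofReal]
    push_cast
    rfl
  rw [Complex.ofReal_inv, Complex.ofReal_mul, hGr, Complex.cpow_sub _ _ two_ne_zero,
    Complex.cpow_neg]
  generalize Complex.Gamma (1 / 2 - a) = A
  generalize Complex.Gamma (ν + 1 / 2) = B at hG ⊢
  field_simp

/-! ### A Gaussian integral of the scaled Bessel function -/

/-- Tonelli: for a nonnegative integrand the inner integral of the norm is the inner integral
itself, so knowing the latter explicitly is enough. -/
theorem integrable_uncurry_of_nonneg {α β : Type*} [MeasurableSpace α] [MeasurableSpace β]
    {μ : Measure α} {μ' : Measure β} [SFinite μ'] {H : α → β → ℝ}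
    (hm : AEStronglyMeasurable (Function.uncurry H) (μ.prod μ'))
    (h0 : ∀ᵐ x ∂μ, ∀ᵐ y ∂μ', 0 ≤ H x y) (hi : ∀ᵐ x ∂μ, Integrable (H x) μ')
    (hφ : Integrable (fun x => ∫ y, H x y ∂μ') μ) :
    Integrable (Function.uncurry H) (μ.prod μ') := by
  refine (integrable_prod_iff hm).2 ⟨hi, hφ.congr ?_⟩
  filter_upwards [h0] with x hx
  refine integral_congr_ae ?_
  filter_upwards [hx] with y hy
  exact (Real.norm_of_nonneg hy).symm

/-- Substituting y = q² and shifting by x² turns this into a gamma integral; the shift produces exp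
(-P x²). The value is positive, which yields integrability. -/
theorem integral_mul_exp_neg_mul_sq_Ioi_abs {P μ : ℝ} (hP : 0 < P) (hμ : -1 < μ) (x : ℝ) :
    IntegrableOn (fun q => q * ((q ^ 2 - x ^ 2) ^ μ * Real.exp (-P * q ^ 2))) (Ioi |x|) ∧
    ∫ q in Ioi |x|, q * ((q ^ 2 - x ^ 2) ^ μ * Real.exp (-P * q ^ 2)) =
      (1 / P) ^ (μ + 1) * Real.Gamma (μ + 1) / 2 * Real.exp (-P * x ^ 2) := by
  have hval : ∫ q in Ioi |x|, q * ((q ^ 2 - x ^ 2) ^ μ * Real.exp (-P * q ^ 2)) =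
      (1 / P) ^ (μ + 1) * Real.Gamma (μ + 1) / 2 * Real.exp (-P * x ^ 2) := by
    have h1 := integral_comp_rpow_Ioi_of_pos' (g := fun y => (y - x ^ 2) ^ μ * Real.exp (-P * y))
      (p := 2) two_pos (c := x ^ 2) (sq_nonneg x)
    have h2 : (x ^ 2) ^ (2 : ℝ)⁻¹ = |x| := by
      rw [← Real.sqrt_sq_eq_abs, Real.sqrt_eq_rpow, one_div]
    have h3 : ∫ y in Ioi (x ^ 2), (y - x ^ 2) ^ μ * Real.exp (-P * y) =
        Real.exp (-P * x ^ 2) * ((1 / P) ^ (μ + 1) * Real.Gamma (μ + 1)) := by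
      rw [← Real.integral_rpow_mul_exp_neg_mul_Ioi (by linarith) hP, ← integral_const_mul,
        ← integral_indicator measurableSet_Ioi, ← integral_indicator measurableSet_Ioi,
        ← integral_sub_right_eq_self ((Ioi (0 : ℝ)).indicator fun t =>
          Real.exp (-P * x ^ 2) * (t ^ (μ + 1 - 1) * Real.exp (-(P * t)))) (x ^ 2)]
      congr 1
      funext y
      by_cases hy : y ∈ Ioi (x ^ 2)
      · have hy' : y - x ^ 2 ∈ Ioi (0 : ℝ) := mem_Ioi.2 (sub_pos.2 (mem_Ioi.1 hy))
        rw [indicator_of_mem hy, indicator_of_mem hy', add_sub_cancel_right,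
          show -P * y = -P * x ^ 2 + -(P * (y - x ^ 2)) by ring, Real.exp_add]
        ring
      · have hy' : y - x ^ 2 ∉ Ioi (0 : ℝ) := fun h => hy (mem_Ioi.2 (sub_pos.1 (mem_Ioi.1 h)))
        rw [indicator_of_notMem hy, indicator_of_notMem hy']
    rw [h2, h3] at h1
    have h4 : ∫ q in Ioi |x|, q * ((q ^ 2 - x ^ 2) ^ μ * Real.exp (-P * q ^ 2)) =
        (1 / 2) * ∫ q in Ioi |x|, ((2 : ℝ) * q ^ ((2 : ℝ) - 1)) •
          ((q ^ (2 : ℝ) - x ^ 2) ^ μ * Real.exp (-P * q ^ (2 : ℝ))) := by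
      rw [← integral_const_mul]
      refine setIntegral_congr_fun measurableSet_Ioi fun q hq => ?_
      simp only [smul_eq_mul, Real.rpow_two]
      rw [show (2 : ℝ) - 1 = 1 by norm_num, Real.rpow_one]
      ring
    rw [h4, h1]
    ring
  refine ⟨Integrable.of_integral_ne_zero ?_, hval⟩
  rw [hval]
  have : 0 < Real.Gamma (μ + 1) := Real.Gamma_pos_of_pos (by linarith)
  positivity

theorem integral_exp_quadratic {P : ℝ} (hP : 0 < P) (c : ℝ) :
    Integrable (fun x : ℝ => Real.exp (-P * x ^ 2) * Real.exp (c * x)) ∧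
    ∫ x : ℝ, Real.exp (-P * x ^ 2) * Real.exp (c * x) =
      √(Real.pi / P) * Real.exp (c ^ 2 / (4 * P)) := by
  have h1 : ∀ x : ℝ, Real.exp (-P * x ^ 2) * Real.exp (c * x) =
      Real.exp (-P * (x - c / (2 * P)) ^ 2) * Real.exp (c ^ 2 / (4 * P)) := by
    intro x
    rw [← Real.exp_add, ← Real.exp_add]
    congr 1
    field_simp
    ring
  simp only [h1]
  refine ⟨((integrable_exp_neg_mul_sq hP).comp_sub_right (c / (2 * P))).mul_const _, ?_⟩
  rw [integral_mul_const, integral_sub_right_eq_self (fun x => Real.exp (-P * x ^ 2)),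
    integral_gaussian]

/-- The substitution x = q - q v returns to Poisson's integral, now over |x| < q. In this form q
occurs only in q² - x², in the range of x and in elementary factors, so the order of integration in
x and q can be exchanged. -/
theorem scaledBesselI_mul (ν : ℝ) {c q : ℝ} (hc : 0 < c) (hq : 0 < q) :
    scaledBesselI ν (c * q) = (√Real.pi * Real.Gamma (ν + 1 / 2))⁻¹ * (c / 2) ^ ν * q ^ (-ν) *
      Real.exp (-(c * q)) *
        ∫ x in Ioo (-q) q, (q ^ 2 - x ^ 2) ^ (ν - 1 / 2) * Real.exp (c * x) := by
  set C := (√Real.pi * Real.Gamma (ν + 1 / 2))⁻¹ with hC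
  set F : ℝ → ℝ := fun x => (q ^ 2 - x ^ 2) ^ (ν - 1 / 2) * Real.exp (c * x) with hF
  have h1 := intervalIntegral.integral_comp_sub_mul (a := 0) (b := 2) F hq.ne' q
  rw [show q - q * 2 = -q by ring, show q - q * 0 = q by ring,
    intervalIntegral.integral_of_le (by norm_num : (0 : ℝ) ≤ 2),
    intervalIntegral.integral_of_le (by linarith : -q ≤ q), integral_Ioc_eq_integral_Ioo,
    integral_Ioc_eq_integral_Ioo, smul_eq_mul] at h1
  have h2 : scaledBesselI ν (c * q) = C * (c / 2) ^ ν * q ^ (1 - ν) * Real.exp (-(c * q)) *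
      ∫ v in Ioo (0 : ℝ) 2, F (q - q * v) := by
    rw [scaledBesselI, ← integral_const_mul]
    refine setIntegral_congr_fun measurableSet_Ioo fun v hv => ?_
    have hv0 : 0 < v := hv.1
    have hv2 : 0 < 2 - v := by linarith [hv.2]
    simp only [hF, besselWeight]
    rw [show q ^ 2 - (q - q * v) ^ 2 = q ^ 2 * (v * (2 - v)) by ring,
      Real.mul_rpow (by positivity) (by positivity), Real.mul_rpow hv0.le hv2.le,
      show v * (c * q) / 2 = v * (c / 2 * q) by ring, Real.mul_rpow hv0.le (by positivity),
      Real.mul_rpow (by positivity) hq.le, ← Real.rpow_natCast, ← Real.rpow_mul hq.le,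
      show -(v * (c * q)) = -(c * q) + c * (q - q * v) by ring, Real.exp_add,
      show ν - 1 / 2 = -1 / 2 + ν by ring, Real.rpow_add hv0]
    have h3 : q ^ ν = q ^ (1 - ν) * q ^ (((2 : ℕ) : ℝ) * (-1 / 2 + ν)) := by
      rw [← Real.rpow_add hq]
      congr 1
      push_cast
      ring
    rw [h3]
    ring
  rw [h2, h1, Real.rpow_sub hq, Real.rpow_one, Real.rpow_neg hq.le]
  field_simp

/-- The integral of `r ^ (ν + 1) * exp (-P r ^ 2) * I_ν (c r)` over the half-line. -/
theorem integral_scaledBesselI_mul_gauss {ν c P : ℝ} (hν : 0 ≤ ν) (hc : 0 < c) (hP : 0 < P) :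
    ∫ q in Ioi (0 : ℝ), q ^ (ν + 1) * Real.exp (-P * q ^ 2) *
        (Real.exp (c * q) * scaledBesselI ν (c * q)) =
      (c / 2) ^ ν / (2 * P ^ (ν + 1)) * Real.exp (c ^ 2 / (4 * P)) := by
  set C := (√Real.pi * Real.Gamma (ν + 1 / 2))⁻¹ with hC
  -- The integrand on the region |x| < q. Integrating in q first gives a gamma factor that cancels
  -- Γ(ν + 1/2) and leaves a shifted Gaussian integral in x.
  set H : ℝ → ℝ → ℝ := fun x q => (Ioi |x|).indicator
    (fun q => q * ((q ^ 2 - x ^ 2) ^ (ν - 1 / 2) * Real.exp (-P * q ^ 2)) * Real.exp (c * x)) q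
    with hH
  have hset : MeasurableSet {p : ℝ × ℝ | |p.1| < p.2} :=
    measurableSet_lt (by fun_prop) (by fun_prop)
  have hm : Measurable (Function.uncurry H) := by
    have : Function.uncurry H = {p : ℝ × ℝ | |p.1| < p.2}.indicator fun p =>
        p.2 * ((p.2 ^ 2 - p.1 ^ 2) ^ (ν - 1 / 2) * Real.exp (-P * p.2 ^ 2)) *
          Real.exp (c * p.1) := by
      funext p
      simp only [hH, Function.uncurry, indicator, mem_Ioi, mem_ofPred_eq]
    rw [this]
    exact Measurable.indicator (by fun_prop) hset
  have hinner := fun x => integral_mul_exp_neg_mul_sq_Ioi_abs (μ := ν - 1 / 2) hP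
    (by linarith) x
  set D := (1 / P) ^ (ν - 1 / 2 + 1) * Real.Gamma (ν - 1 / 2 + 1) / 2 with hD
  have hH0 : ∀ x q, 0 ≤ H x q := by
    intro x q
    refine indicator_nonneg (fun q hq => ?_) q
    have h1 : |x| < q := hq
    have h2 : 0 ≤ q := (abs_nonneg x).trans h1.le
    have h3 : 0 ≤ q ^ 2 - x ^ 2 := by
      rw [sub_nonneg, ← sq_abs x]
      exact pow_le_pow_left₀ (abs_nonneg x) h1.le 2
    positivity
  have hH1 : ∀ x, Integrable (H x) := by
    intro x
    rw [integrable_indicator_iff measurableSet_Ioi]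
    exact (hinner x).1.mul_const _
  have hH2 : ∀ x, ∫ q, H x q = D * (Real.exp (-P * x ^ 2) * Real.exp (c * x)) := by
    intro x
    rw [integral_indicator measurableSet_Ioi, integral_mul_const, (hinner x).2]
    ring
  have hi : Integrable (Function.uncurry H) (volume.prod volume) := by
    refine integrable_uncurry_of_nonneg hm.aestronglyMeasurable
      (Eventually.of_forall fun x => Eventually.of_forall fun q => hH0 x q)
      (Eventually.of_forall hH1) ?_
    simp only [hH2]
    exact (integral_exp_quadratic hP c).1.const_mul D
  have hswap := integral_integral_swap hi
  simp only [hH2] at hswap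
  rw [integral_const_mul, (integral_exp_quadratic hP c).2] at hswap
  have hq : ∀ q, 0 < q → q ^ (ν + 1) * Real.exp (-P * q ^ 2) *
      (Real.exp (c * q) * scaledBesselI ν (c * q)) = C * (c / 2) ^ ν * ∫ x, H x q := by
    intro q hq
    have h1 : ∫ x, H x q = q * Real.exp (-P * q ^ 2) *
        ∫ x in Ioo (-q) q, (q ^ 2 - x ^ 2) ^ (ν - 1 / 2) * Real.exp (c * x) := by
      rw [← integral_const_mul, ← integral_indicator measurableSet_Ioo]
      congr 1
      funext x
      by_cases hx : |x| < q
      · have hx' : x ∈ Ioo (-q) q := abs_lt.1 hx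
        rw [indicator_of_mem hx']
        simp only [hH]
        rw [indicator_of_mem (show q ∈ Ioi |x| from hx)]
        ring
      · have hx' : x ∉ Ioo (-q) q := fun h => hx (abs_lt.2 h)
        rw [indicator_of_notMem hx']
        simp only [hH]
        rw [indicator_of_notMem (show q ∉ Ioi |x| from hx)]
    rw [h1, scaledBesselI_mul ν hc hq, ← hC, Real.rpow_neg hq.le, Real.rpow_add_one hq.ne',
      Real.exp_neg]
    generalize (∫ x in Ioo (-q) q, (q ^ 2 - x ^ 2) ^ (ν - 1 / 2) * Real.exp (c * x)) = J
    clear_value C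
    have := (Real.rpow_pos_of_pos hq ν).ne'
    have := (Real.exp_pos (c * q)).ne'
    field_simp
  rw [setIntegral_congr_fun measurableSet_Ioi hq, integral_const_mul]
  -- For q ≤ 0 no x satisfies |x| < q.
  have hneg : ∫ q in Ioi (0 : ℝ), ∫ x, H x q = ∫ q, ∫ x, H x q := by
    refine setIntegral_eq_integral_of_forall_compl_eq_zero fun q hq => ?_
    refine integral_eq_zero_of_ae (Eventually.of_forall fun x => ?_)
    simp only [hH]
    exact indicator_of_notMem (fun h : |x| < q => hq ((abs_nonneg x).trans_lt h)) _
  rw [hneg, ← hswap, hD, hC, show ν - 1 / 2 + 1 = ν + 1 / 2 by ring,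
    Real.sqrt_div Real.pi_pos.le]
  have hG := (Real.Gamma_pos_of_pos (by linarith : 0 < ν + 1 / 2)).ne'
  have hpi := (Real.sqrt_pos.2 Real.pi_pos).ne'
  have hsP := (Real.sqrt_pos.2 hP).ne'
  have hP1 : P ^ (ν + 1) = P ^ (ν + 1 / 2) * √P := by
    rw [Real.sqrt_eq_rpow, ← Real.rpow_add hP]
    congr 1
    ring
  rw [hP1, Real.div_rpow zero_le_one hP.le, Real.one_rpow]
  have := (Real.rpow_pos_of_pos hP (ν + 1 / 2)).ne'
  field_simp

/-! ### The heat kernel and the kernel of the powers of the resolvent -/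

/-- The heat kernel of `-∂ᵣ² + r⁻² (ν² - 1/4)`. -/
noncomputable def besselHeatKernel (ν t r q : ℝ) : ℝ :=
  √(r * q) * ((2 * t)⁻¹ * Real.exp (-(r - q) ^ 2 / (4 * t)) * scaledBesselI ν (r * q / (2 * t)))

/-- The integral kernel of `(T_ν + 1) ^ (-d - 1)`. -/
noncomputable def resolventPowKernel (ν : ℝ) (d : ℕ) (r q : ℝ) : ℝ :=
  (d.factorial : ℝ)⁻¹ *
    ∫ t in Ioi (0 : ℝ), t ^ d * Real.exp (-t) * besselHeatKernel ν t r q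

theorem measurable_besselHeatKernel (ν : ℝ) :
    Measurable fun x : ℝ × ℝ × ℝ => besselHeatKernel ν x.1 x.2.1 x.2.2 := by
  have := measurable_scaledBesselI ν
  unfold besselHeatKernel
  fun_prop

theorem besselHeatKernel_nonneg {ν t r q : ℝ} (hν : 0 ≤ ν) (ht : 0 < t) (hr : 0 < r)
    (hq : 0 < q) : 0 ≤ besselHeatKernel ν t r q := by
  have := scaledBesselI_nonneg hν (show 0 ≤ r * q / (2 * t) by positivity)
  unfold besselHeatKernel
  positivity

/-- Collecting the exponentials gives the integral of `integral_scaledBesselI_mul_gauss` with P =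
(1+4at)/(4t) and c = r/(2t). The right side is the explicit flow of `heatPairing`, so this kernel
reproduces it. -/
theorem integral_besselHeatKernel_mul_powGauss {ν a t r : ℝ} (hν : 0 ≤ ν) (ha : 0 < a)
    (ht : 0 < t) (hr : 0 < r) :
    ∫ q in Ioi (0 : ℝ), besselHeatKernel ν t r q * powGauss (ν + 1 / 2) a q =
      (1 + 4 * a * t) ^ (-(ν + 1)) * powGauss (ν + 1 / 2) (a / (1 + 4 * a * t)) r := by
  have hD : 0 < 1 + 4 * a * t := by positivity
  have h1 : ∀ q ∈ Ioi (0 : ℝ), besselHeatKernel ν t r q * powGauss (ν + 1 / 2) a q =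
      (√r * (2 * t)⁻¹ * Real.exp (-r ^ 2 / (4 * t))) *
        (q ^ (ν + 1) * Real.exp (-((1 + 4 * a * t) / (4 * t)) * q ^ 2) *
          (Real.exp (r / (2 * t) * q) * scaledBesselI ν (r / (2 * t) * q))) := by
    intro q hq
    have hq := mem_Ioi.1 hq
    have e1 : q ^ (ν + 1) = q ^ (ν + 1 / 2) * √q := by
      rw [Real.sqrt_eq_rpow, ← Real.rpow_add hq]
      congr 1
      ring
    have e2 : Real.exp (-(r - q) ^ 2 / (4 * t)) * Real.exp (-a * q ^ 2) =
        Real.exp (-r ^ 2 / (4 * t)) * Real.exp (-((1 + 4 * a * t) / (4 * t)) * q ^ 2) *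
          Real.exp (r / (2 * t) * q) := by
      rw [← Real.exp_add, ← Real.exp_add, ← Real.exp_add]
      congr 1
      field_simp
      ring
    rw [besselHeatKernel, powGauss, e1, Real.sqrt_mul hr.le,
      show r * q / (2 * t) = r / (2 * t) * q by ring]
    linear_combination (√r * √q * (2 * t)⁻¹ * scaledBesselI ν (r / (2 * t) * q) *
      q ^ (ν + 1 / 2)) * e2
  rw [setIntegral_congr_fun measurableSet_Ioi h1, integral_const_mul,
    integral_scaledBesselI_mul_gauss hν (by positivity) (by positivity), powGauss,
    Real.div_rpow hD.le (by positivity), show r / (2 * t) / 2 = r / (4 * t) by ring,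
    Real.div_rpow hr.le (by positivity), Real.rpow_add_one (by positivity : (4 * t) ≠ 0),
    Real.rpow_neg hD.le, Real.rpow_add hr, ← Real.sqrt_eq_rpow]
  have e3 : Real.exp (-r ^ 2 / (4 * t)) *
      Real.exp ((r / (2 * t)) ^ 2 / (4 * ((1 + 4 * a * t) / (4 * t)))) =
      Real.exp (-(a / (1 + 4 * a * t)) * r ^ 2) := by
    rw [← Real.exp_add]
    congr 1
    field_simp
    ring
  rw [← e3]
  have := (Real.rpow_pos_of_pos hD (ν + 1)).ne'
  have := (Real.rpow_pos_of_pos (show 0 < 4 * t by positivity) ν).ne'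
  field_simp
  norm_num

theorem integrableOn_besselHeatKernel_mul_powGauss {ν a t r : ℝ} (hν : 0 ≤ ν) (ha : 0 < a)
    (ht : 0 < t) (hr : 0 < r) :
    IntegrableOn (fun q => besselHeatKernel ν t r q * powGauss (ν + 1 / 2) a q) (Ioi 0) := by
  refine Integrable.of_integral_ne_zero ?_
  rw [integral_besselHeatKernel_mul_powGauss hν ha ht hr]
  have := powGauss_pos (ν + 1 / 2) (a / (1 + 4 * a * t)) hr
  positivity

/-- With ρ = |r - q|, the exponent satisfies -t - ρ²/(4t) ≤ -ρ/2 - t/2, the difference being (t² +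
(t-ρ)²)/(4t). The Bessel factor is bounded, and d ≥ 1 absorbs the factor 1/t. The same bound serves
for continuity and for decay off the diagonal. -/
theorem exists_besselHeatKernel_le {ν : ℝ} (hν : 0 ≤ ν) : ∃ M, 0 ≤ M ∧ ∀ (d : ℕ), 1 ≤ d →
    ∀ t r q : ℝ, 0 < t → 0 < r → 0 < q →
      t ^ d * Real.exp (-t) * ((2 * t)⁻¹ * Real.exp (-(r - q) ^ 2 / (4 * t)) *
        scaledBesselI ν (r * q / (2 * t))) ≤
      M * Real.exp (-|r - q| / 2) * (t ^ (d - 1) * Real.exp (-(t / 2))) := by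
  obtain ⟨M, hM0, hM⟩ := exists_scaledBesselI_le hν
  refine ⟨M / 2, by positivity, fun d hd t r q ht hr hq => ?_⟩
  have h1 : Real.exp (-t) * Real.exp (-(r - q) ^ 2 / (4 * t)) ≤
      Real.exp (-|r - q| / 2) * Real.exp (-(t / 2)) := by
    rw [← Real.exp_add, ← Real.exp_add, Real.exp_le_exp, ← sq_abs (r - q)]
    have : -|r - q| / 2 + -(t / 2) - (-t + -|r - q| ^ 2 / (4 * t)) =
        (t ^ 2 + (t - |r - q|) ^ 2) / (4 * t) := by
      field_simp
      ring
    have : 0 ≤ (t ^ 2 + (t - |r - q|) ^ 2) / (4 * t) := by positivity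
    linarith
  have h2 : t ^ d = t ^ (d - 1) * t := by
    rw [← pow_succ, Nat.sub_add_cancel hd]
  have h3 := hM (r * q / (2 * t)) (by positivity)
  have h4 := scaledBesselI_nonneg hν (show 0 ≤ r * q / (2 * t) by positivity)
  calc _ = t ^ (d - 1) * (1 / 2) * ((Real.exp (-t) * Real.exp (-(r - q) ^ 2 / (4 * t))) *
        scaledBesselI ν (r * q / (2 * t))) := by
        rw [h2]
        field_simp
    _ ≤ t ^ (d - 1) * (1 / 2) * ((Real.exp (-|r - q| / 2) * Real.exp (-(t / 2))) * M) := by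
        gcongr
    _ = _ := by ring

theorem integrableOn_pow_mul_exp_neg_half (n : ℕ) :
    IntegrableOn (fun t : ℝ => t ^ n * Real.exp (-(t / 2))) (Ioi 0) := by
  have h := integrableOn_rpow_mul_exp_neg_mul_rpow (p := 1) (s := n) (b := 1 / 2)
    (by have : (0 : ℝ) ≤ n := n.cast_nonneg
        linarith) one_pos (by norm_num)
  refine h.congr_fun (fun t ht => ?_) measurableSet_Ioi
  simp only [Real.rpow_natCast, Real.rpow_one]
  ring_nf

theorem aestronglyMeasurable_pow_mul_besselHeatKernel (ν : ℝ) (d : ℕ) (r q : ℝ) :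
    AEStronglyMeasurable (fun t => t ^ d * Real.exp (-t) * ((2 * t)⁻¹ *
      Real.exp (-(r - q) ^ 2 / (4 * t)) * scaledBesselI ν (r * q / (2 * t))))
      (volume.restrict (Ioi (0 : ℝ))) := by
  have := measurable_scaledBesselI ν
  refine Measurable.aestronglyMeasurable ?_
  fun_prop

theorem resolventPowKernel_eq (ν : ℝ) (d : ℕ) (r q : ℝ) :
    resolventPowKernel ν d r q = (d.factorial : ℝ)⁻¹ * √(r * q) *
      ∫ t in Ioi (0 : ℝ), t ^ d * Real.exp (-t) * ((2 * t)⁻¹ *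
        Real.exp (-(r - q) ^ 2 / (4 * t)) * scaledBesselI ν (r * q / (2 * t))) := by
  rw [resolventPowKernel, mul_assoc, ← integral_const_mul (√(r * q))]
  congr 2
  funext t
  rw [besselHeatKernel]
  ring

theorem continuousOn_resolventPowKernel {ν : ℝ} (hν : 0 ≤ ν) {d : ℕ} (hd : 1 ≤ d) :
    ContinuousOn (Function.uncurry (resolventPowKernel ν d)) (Ioi 0 ×ˢ Ioi 0) := by
  obtain ⟨M, hM0, hM⟩ := exists_besselHeatKernel_le hν
  have h1 : Function.uncurry (resolventPowKernel ν d) = fun x : ℝ × ℝ =>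
      (d.factorial : ℝ)⁻¹ * √(x.1 * x.2) *
      ∫ t in Ioi (0 : ℝ), t ^ d * Real.exp (-t) * ((2 * t)⁻¹ *
        Real.exp (-(x.1 - x.2) ^ 2 / (4 * t)) * scaledBesselI ν (x.1 * x.2 / (2 * t))) := by
    funext x
    exact resolventPowKernel_eq ν d x.1 x.2
  rw [h1]
  refine ContinuousOn.mul (by fun_prop) ?_
  refine continuousOn_of_dominated
    (bound := fun t => M * (t ^ (d - 1) * Real.exp (-(t / 2))))
    (fun x _ => aestronglyMeasurable_pow_mul_besselHeatKernel ν d x.1 x.2) ?_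
    ((integrableOn_pow_mul_exp_neg_half (d - 1)).const_mul M) ?_
  · rintro ⟨r, q⟩ ⟨hr, hq⟩
    have hr := mem_Ioi.1 hr
    have hq := mem_Ioi.1 hq
    filter_upwards [ae_restrict_mem measurableSet_Ioi] with t ht
    have ht := mem_Ioi.1 ht
    have h2 := scaledBesselI_nonneg hν (show 0 ≤ r * q / (2 * t) by positivity)
    rw [Real.norm_of_nonneg (by positivity)]
    refine (hM d hd t r q ht hr hq).trans ?_
    have h3 : Real.exp (-|r - q| / 2) ≤ 1 :=
      Real.exp_le_one_iff.2 (by linarith [abs_nonneg (r - q)])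
    have h4 : M * Real.exp (-|r - q| / 2) ≤ M := mul_le_of_le_one_right hM0 h3
    exact mul_le_mul_of_nonneg_right h4 (by positivity)
  · filter_upwards [ae_restrict_mem measurableSet_Ioi] with t ht
    have ht := mem_Ioi.1 ht
    refine ContinuousOn.mul (by fun_prop) (ContinuousOn.mul (by fun_prop) ?_)
    refine (continuousOn_scaledBesselI hν).comp (by fun_prop) ?_
    rintro ⟨r, q⟩ ⟨hr, hq⟩
    have hr := mem_Ioi.1 hr
    have hq := mem_Ioi.1 hq
    exact mem_Ici.2 (by positivity)

theorem exists_resolventPowKernel_le {ν : ℝ} (hν : 0 ≤ ν) {d : ℕ} (hd : 1 ≤ d) :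
    ∃ C, 0 ≤ C ∧ ∀ r q : ℝ, 0 < r → 0 < q → 0 ≤ resolventPowKernel ν d r q ∧
      resolventPowKernel ν d r q ≤ C * √(r * q) * Real.exp (-|r - q| / 2) := by
  obtain ⟨M, hM0, hM⟩ := exists_besselHeatKernel_le hν
  have hI : 0 ≤ ∫ t in Ioi (0 : ℝ), t ^ (d - 1) * Real.exp (-(t / 2)) :=
    setIntegral_nonneg measurableSet_Ioi fun t ht => by
      have := mem_Ioi.1 ht
      positivity
  refine ⟨(d.factorial : ℝ)⁻¹ * (M * ∫ t in Ioi (0 : ℝ), t ^ (d - 1) * Real.exp (-(t / 2))),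
    by positivity, fun r q hr hq => ?_⟩
  have hpos : ∀ t ∈ Ioi (0 : ℝ), 0 ≤ t ^ d * Real.exp (-t) * ((2 * t)⁻¹ *
        Real.exp (-(r - q) ^ 2 / (4 * t)) * scaledBesselI ν (r * q / (2 * t))) := fun t ht => by
    have ht := mem_Ioi.1 ht
    have h2 := scaledBesselI_nonneg hν (show 0 ≤ r * q / (2 * t) by positivity)
    positivity
  have h0 := setIntegral_nonneg (μ := volume) measurableSet_Ioi hpos
  have h1 : ∫ t in Ioi (0 : ℝ), t ^ d * Real.exp (-t) * ((2 * t)⁻¹ *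
        Real.exp (-(r - q) ^ 2 / (4 * t)) * scaledBesselI ν (r * q / (2 * t))) ≤
      ∫ t in Ioi (0 : ℝ), M * Real.exp (-|r - q| / 2) * (t ^ (d - 1) * Real.exp (-(t / 2))) := by
    refine integral_mono_of_nonneg ?_
      ((integrableOn_pow_mul_exp_neg_half (d - 1)).const_mul _) ?_
    · filter_upwards [ae_restrict_mem measurableSet_Ioi] with t ht using hpos t ht
    · filter_upwards [ae_restrict_mem measurableSet_Ioi] with t ht using
        hM d hd t r q (mem_Ioi.1 ht) hr hq
  rw [integral_const_mul] at h1
  rw [resolventPowKernel_eq]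
  refine ⟨by positivity, ?_⟩
  calc _ ≤ (d.factorial : ℝ)⁻¹ * √(r * q) * (M * Real.exp (-|r - q| / 2) *
        ∫ t in Ioi (0 : ℝ), t ^ (d - 1) * Real.exp (-(t / 2))) := by gcongr
    _ = _ := by ring

/-- Exponential decay in |r - q| puts each row of the kernel in L², so applying the kernel to f at r
is an inner product, continuous in f for every r. -/
theorem memLp_resolventPowKernel {ν : ℝ} (hν : 0 ≤ ν) {d : ℕ} (hd : 1 ≤ d) {r : ℝ}
    (hr : 0 < r) :
    MemLp (fun q => (resolventPowKernel ν d r q : ℂ)) 2 (volume.restrict (Ioi (0 : ℝ))) := by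
  obtain ⟨C, hC0, hC⟩ := exists_resolventPowKernel_le hν hd
  have hcont : ContinuousOn (resolventPowKernel ν d r) (Ioi 0) :=
    (continuousOn_resolventPowKernel hν hd).comp (f := fun q => (r, q)) (by fun_prop)
      fun q hq => ⟨hr, hq⟩
  have hm : AEStronglyMeasurable (fun q => (resolventPowKernel ν d r q : ℂ))
      (volume.restrict (Ioi (0 : ℝ))) :=
    (Complex.continuous_ofReal.comp_continuousOn hcont).aestronglyMeasurable measurableSet_Ioi
  rw [memLp_two_iff_integrable_sq_norm hm]
  refine Integrable.mono' ((integrableOn_pow_mul_exp_neg 1).const_mul (C ^ 2 * r * Real.exp r))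
    (hm.norm.pow 2) ?_
  filter_upwards [ae_restrict_mem measurableSet_Ioi] with q hq
  have hq := mem_Ioi.1 hq
  obtain ⟨h1, h2⟩ := hC r q hr hq
  rw [Complex.norm_real, Real.norm_of_nonneg h1, Real.norm_of_nonneg (by positivity)]
  calc resolventPowKernel ν d r q ^ 2 ≤ (C * √(r * q) * Real.exp (-|r - q| / 2)) ^ 2 := by
        gcongr
    _ = C ^ 2 * (r * q) * Real.exp (-|r - q|) := by
        rw [mul_pow, mul_pow, Real.sq_sqrt (by positivity), ← Real.exp_nat_mul]
        congr 2
        push_cast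
        ring
    _ ≤ C ^ 2 * (r * q) * (Real.exp r * Real.exp (-q)) := by
        rw [← Real.exp_add]
        gcongr
        linarith [neg_le_abs (r - q)]
    _ = _ := by ring

/-! ### The powers of the resolvent as integral operators -/

theorem measurable_heatFlow (ν a : ℝ) (d : ℕ) :
    Measurable fun x : ℝ × ℝ => x.1 ^ d * Real.exp (-x.1) *
      ((1 + 4 * a * x.1) ^ (-(ν + 1)) * powGauss (ν + 1 / 2) (a / (1 + 4 * a * x.1)) x.2) := by
  unfold powGauss
  fun_prop

/-- Exchange of the t and q integrals. The integrand is nonnegative, and its q-integral is the flow,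
bounded in t by t^d e^(-t) r^(ν+1/2). -/
theorem integral_resolventPowKernel_mul_powGauss {ν a r : ℝ} (hν : 0 ≤ ν) (ha : 0 < a) (d : ℕ)
    (hr : 0 < r) :
    ∫ q in Ioi (0 : ℝ), resolventPowKernel ν d r q * powGauss (ν + 1 / 2) a q =
      (d.factorial : ℝ)⁻¹ * ∫ t in Ioi (0 : ℝ), t ^ d * Real.exp (-t) *
        ((1 + 4 * a * t) ^ (-(ν + 1)) * powGauss (ν + 1 / 2) (a / (1 + 4 * a * t)) r) := by
  set H : ℝ → ℝ → ℝ := fun t q =>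
    t ^ d * Real.exp (-t) * (besselHeatKernel ν t r q * powGauss (ν + 1 / 2) a q) with hH
  have hm : AEStronglyMeasurable (Function.uncurry H)
      ((volume.restrict (Ioi (0 : ℝ))).prod (volume.restrict (Ioi (0 : ℝ)))) := by
    have h1 := measurable_besselHeatKernel ν
    have h2 := measurable_powGauss (ν + 1 / 2) a
    have h3 : Measurable fun x : ℝ × ℝ => besselHeatKernel ν x.1 r x.2 :=
      h1.comp (measurable_fst.prodMk (measurable_const.prodMk measurable_snd))
    refine Measurable.aestronglyMeasurable ?_
    simp only [hH, Function.uncurry_def]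
    fun_prop
  have hval : ∀ t ∈ Ioi (0 : ℝ), ∫ q in Ioi (0 : ℝ), H t q = t ^ d * Real.exp (-t) *
      ((1 + 4 * a * t) ^ (-(ν + 1)) * powGauss (ν + 1 / 2) (a / (1 + 4 * a * t)) r) := by
    intro t ht
    simp only [hH]
    rw [integral_const_mul, integral_besselHeatKernel_mul_powGauss hν ha (mem_Ioi.1 ht) hr]
  have hi : Integrable (Function.uncurry H)
      ((volume.restrict (Ioi (0 : ℝ))).prod (volume.restrict (Ioi (0 : ℝ)))) := by
    refine integrable_uncurry_of_nonneg hm ?_ ?_ ?_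
    · filter_upwards [ae_restrict_mem measurableSet_Ioi] with t ht
      filter_upwards [ae_restrict_mem measurableSet_Ioi] with q hq
      have ht := mem_Ioi.1 ht
      have h1 := besselHeatKernel_nonneg hν ht hr (mem_Ioi.1 hq)
      have h2 := (powGauss_pos (ν + 1 / 2) a (mem_Ioi.1 hq)).le
      simp only [hH]
      positivity
    · filter_upwards [ae_restrict_mem measurableSet_Ioi] with t ht
      exact (integrableOn_besselHeatKernel_mul_powGauss hν ha (mem_Ioi.1 ht) hr).const_mul _
    · have h1 : IntegrableOn (fun t : ℝ => t ^ d * Real.exp (-t) *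
          ((1 + 4 * a * t) ^ (-(ν + 1)) * powGauss (ν + 1 / 2) (a / (1 + 4 * a * t)) r))
          (Ioi 0) := by
        refine Integrable.mono' ((integrableOn_pow_mul_exp_neg d).mul_const (r ^ (ν + 1 / 2)))
          ((measurable_heatFlow ν a d).comp
            (measurable_id.prodMk measurable_const)).aestronglyMeasurable ?_
        filter_upwards [ae_restrict_mem measurableSet_Ioi] with t ht
        have ht := mem_Ioi.1 ht
        have h2 := (powGauss_pos (ν + 1 / 2) (a / (1 + 4 * a * t)) hr).le
        have h3 : (1 + 4 * a * t) ^ (-(ν + 1)) ≤ 1 :=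
          Real.rpow_le_one_of_one_le_of_nonpos (by nlinarith [mul_pos ha ht]) (by linarith)
        have h4 : powGauss (ν + 1 / 2) (a / (1 + 4 * a * t)) r ≤ r ^ (ν + 1 / 2) := by
          refine mul_le_of_le_one_right (by positivity) (Real.exp_le_one_iff.2 ?_)
          have : 0 ≤ a / (1 + 4 * a * t) * r ^ 2 := by positivity
          linarith
        rw [Real.norm_of_nonneg (by positivity)]
        refine mul_le_mul_of_nonneg_left ?_ (by positivity)
        exact (mul_le_of_le_one_left h2 h3).trans h4
      exact h1.congr_fun (fun t ht => (hval t ht).symm) measurableSet_Ioi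
  rw [← setIntegral_congr_fun measurableSet_Ioi hval, integral_integral_swap hi,
    ← integral_const_mul]
  congr 1
  funext q
  rw [resolventPowKernel, mul_assoc, ← integral_mul_const]
  congr 2
  funext t
  simp only [hH]
  ring

/-- Only pairings with the resolvent power are known. Pairing with indicators of sets of finite
measure determines its integral over each of them, and hence the function almost everywhere. -/
theorem resolvent_pow_powGaussL2_ae {ν a : ℝ} (hν : 0 ≤ ν) (ha : 0 < a)
    {R : L2HalfLine →L[ℂ] L2HalfLine} (hR : IsResolvent (besselFriedrichs ν) 1 R) (d : ℕ) :
    ((R ^ (d + 1)) (powGaussL2 (ν + 1 / 2) a (by linarith) ha) : ℝ → ℂ)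
      =ᵐ[volume.restrict (Ioi (0 : ℝ))] fun r =>
        ((∫ q in Ioi (0 : ℝ), resolventPowKernel ν d r q * powGauss (ν + 1 / 2) a q : ℝ) : ℂ) := by
  set H : ℝ → ℝ → ℝ := fun t r => t ^ d * Real.exp (-t) *
        ((1 + 4 * a * t) ^ (-(ν + 1)) * powGauss (ν + 1 / 2) (a / (1 + 4 * a * t)) r) with hH
  set u := (R ^ (d + 1)) (powGaussL2 (ν + 1 / 2) a (by linarith) ha) with hu
  have key : ∀ s : Set ℝ, MeasurableSet s → volume.restrict (Ioi (0 : ℝ)) s < ⊤ →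
      Integrable (Function.uncurry H)
        ((volume.restrict (Ioi (0 : ℝ))).prod ((volume.restrict (Ioi (0 : ℝ))).restrict s)) ∧
      (∫ t in Ioi (0 : ℝ), ∫ r in s, H t r ∂volume.restrict (Ioi (0 : ℝ)) : ℝ) =
        (d.factorial : ℂ) * ∫ r in s, u r ∂volume.restrict (Ioi (0 : ℝ)) := by
    intro s hs hμs
    set g : L2HalfLine := indicatorConstLp 2 hs hμs.ne (1 : ℂ) with hg
    have hpair : ∀ t ∈ Ioi (0 : ℝ), ((t ^ d * Real.exp (-t) : ℝ) : ℂ) * heatPairing ν a g t =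
        ((∫ r in s, H t r ∂volume.restrict (Ioi (0 : ℝ)) : ℝ) : ℂ) := by
      intro t ht
      have ht := mem_Ioi.1 ht
      have hb : 0 < a / (1 + 4 * a * t) := by positivity
      rw [heatPairing, gaussPairing_eq_inner (by linarith) hb, hg,
        L2.inner_indicatorConstLp_one, integral_congr_ae
          (ae_restrict_of_ae (powGaussL2_ae (p := ν + 1 / 2) (by linarith) hb)),
        integral_complex_ofReal]
      simp only [hH]
      rw [integral_const_mul, integral_const_mul]
      push_cast
      ring
    refine ⟨integrable_uncurry_of_nonneg (measurable_heatFlow ν a d).aestronglyMeasurable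
      ?_ ?_ ?_, ?_⟩
    · filter_upwards [ae_restrict_mem measurableSet_Ioi] with t ht
      filter_upwards [ae_restrict_of_ae (ae_restrict_mem measurableSet_Ioi)] with r hr
      have ht := mem_Ioi.1 ht
      have := (powGauss_pos (ν + 1 / 2) (a / (1 + 4 * a * t)) (mem_Ioi.1 hr)).le
      simp only [hH]
      positivity
    · filter_upwards [ae_restrict_mem measurableSet_Ioi] with t ht
      have ht := mem_Ioi.1 ht
      have h1 : IntegrableOn (powGauss (ν + 1 / 2) (a / (1 + 4 * a * t))) (Ioi 0) :=
        integrableOn_powGauss (by linarith) (by positivity)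
      exact ((h1.integrable.restrict (s := s)).const_mul _).const_mul _
    · have h1 := (integrableOn_pow_mul_exp_neg_mul_heatPairing hν ha g d).congr_fun hpair
        measurableSet_Ioi
      exact h1.re
    · rw [← integral_complex_ofReal, ← setIntegral_congr_fun measurableSet_Ioi hpair,
        ← inner_resolvent_pow_powGaussL2 hν ha hR d g, hg, L2.inner_indicatorConstLp_one]
  have hfac : (d.factorial : ℂ) ≠ 0 := Nat.cast_ne_zero.2 d.factorial_ne_zero
  have hY : (fun r => ((∫ q in Ioi (0 : ℝ),
      resolventPowKernel ν d r q * powGauss (ν + 1 / 2) a q : ℝ) : ℂ))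
      =ᵐ[volume.restrict (Ioi (0 : ℝ))] fun r =>
        (d.factorial : ℂ)⁻¹ * ((∫ t in Ioi (0 : ℝ), H t r : ℝ) : ℂ) := by
    filter_upwards [ae_restrict_mem measurableSet_Ioi] with r hr
    rw [integral_resolventPowKernel_mul_powGauss hν ha d (mem_Ioi.1 hr)]
    push_cast
    rfl
  refine EventuallyEq.trans ?_ hY.symm
  refine ae_eq_of_forall_setIntegral_eq_of_sigmaFinite (fun s hs hμs => ?_) (fun s hs hμs => ?_)
    fun s hs hμs => ?_
  · exact integrableOn_Lp_of_measure_ne_top u fact_one_le_two_ennreal.elim hμs.ne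
  · exact ((key s hs hμs).1.integral_prod_right.ofReal).const_mul _
  · obtain ⟨h1, h2⟩ := key s hs hμs
    rw [integral_const_mul, integral_complex_ofReal, ← integral_integral_swap h1, h2,
      inv_mul_cancel_left₀ hfac]

/-- The vectors f with this property form a closed subspace: an L²-convergent sequence of images has
an a.e. convergent subsequence, while the inner products converge at every r. -/
theorem ae_eq_inner_of_dense {A : L2HalfLine →L[ℂ] L2HalfLine} {κ : ℝ → L2HalfLine}
    {S : Set L2HalfLine} (hS : (Submodule.span ℂ S).topologicalClosure = ⊤)
    (h : ∀ f ∈ S, (A f : ℝ → ℂ) =ᵐ[volume.restrict (Ioi (0 : ℝ))] fun r => ⟪κ r, f⟫_ℂ)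
    (f : L2HalfLine) :
    (A f : ℝ → ℂ) =ᵐ[volume.restrict (Ioi (0 : ℝ))] fun r => ⟪κ r, f⟫_ℂ := by
  set V : Submodule ℂ L2HalfLine :=
    { carrier := {f | (A f : ℝ → ℂ) =ᵐ[volume.restrict (Ioi (0 : ℝ))] fun r => ⟪κ r, f⟫_ℂ}
      zero_mem' := by
        simp only [mem_ofPred_eq, map_zero, inner_zero_right]
        exact Lp.coeFn_zero _ _ _
      add_mem' := by
        intro u v hu hv
        simp only [mem_ofPred_eq, map_add] at hu hv ⊢
        filter_upwards [hu, hv, Lp.coeFn_add (A u) (A v)] with r h1 h2 h3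
        rw [h3, Pi.add_apply, h1, h2, inner_add_right]
      smul_mem' := by
        intro c u hu
        simp only [mem_ofPred_eq, map_smul] at hu ⊢
        filter_upwards [hu, Lp.coeFn_smul c (A u)] with r h1 h3
        rw [h3, Pi.smul_apply, h1, inner_smul_right, smul_eq_mul] } with hV
  have hcl : IsClosed (V : Set L2HalfLine) := by
    refine IsSeqClosed.isClosed fun x u hx hxu => ?_
    have h1 : Tendsto (fun n => A (x n)) atTop (𝓝 (A u)) := (A.continuous.tendsto u).comp hxu
    obtain ⟨ns, hns, h2⟩ := (tendstoInMeasure_of_tendsto_Lp h1).exists_seq_tendsto_ae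
    have h3 : ∀ᵐ r ∂volume.restrict (Ioi (0 : ℝ)), ∀ n, (A (x n) : ℝ → ℂ) r = ⟪κ r, x n⟫_ℂ :=
      ae_all_iff.2 fun n => hx n
    change (A u : ℝ → ℂ) =ᵐ[volume.restrict (Ioi (0 : ℝ))] fun r => ⟪κ r, u⟫_ℂ
    filter_upwards [h2, h3] with r h4 h5
    refine tendsto_nhds_unique h4 ?_
    simp only [h5]
    exact tendsto_const_nhds.inner (hxu.comp hns.tendsto_atTop)
  have hle : (Submodule.span ℂ S).topologicalClosure ≤ V :=
    Submodule.topologicalClosure_minimal _ (Submodule.span_le.2 h) hcl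
  exact hle (hS ▸ Submodule.mem_top)

/-- Both sides are known to agree on the Gaussians, whose span is dense; `ae_eq_inner_of_dense`,
applied to the rows of the kernel, extends this to all of L². -/
theorem isContinuousKernel_resolventPowKernel {ν : ℝ} (hν : 0 ≤ ν)
    {R : L2HalfLine →L[ℂ] L2HalfLine} (hR : IsResolvent (besselFriedrichs ν) 1 R) {d : ℕ}
    (hd : 1 ≤ d) :
    IsContinuousKernel (R ^ (d + 1)) fun r q => (resolventPowKernel ν d r q : ℂ) := by
  have hp : -1 / 2 < ν + 1 / 2 := by linarith
  set κ : ℝ → L2HalfLine := fun r =>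
    if hr : 0 < r then (memLp_resolventPowKernel hν hd hr).toLp else 0 with hκ
  have hκ_inner : ∀ r : ℝ, 0 < r → ∀ (f : L2HalfLine) (φ : ℝ → ℂ),
      f =ᵐ[volume.restrict (Ioi (0 : ℝ))] φ →
      ⟪κ r, f⟫_ℂ = ∫ q in Ioi (0 : ℝ), (resolventPowKernel ν d r q : ℂ) * φ q := by
    intro r hr f φ hf
    have h1 : κ r =ᵐ[volume.restrict (Ioi (0 : ℝ))] fun q => (resolventPowKernel ν d r q : ℂ) := by
      simp only [hκ, dif_pos hr]
      exact MemLp.coeFn_toLp _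
    rw [inner_eq_integral h1 hf]
    simp only [Complex.conj_ofReal]
  refine ⟨Complex.continuous_ofReal.comp_continuousOn (continuousOn_resolventPowKernel hν hd),
    fun f => ?_⟩
  have h1 := ae_eq_inner_of_dense (A := R ^ (d + 1)) (κ := κ) (span_powGaussL2_dense hp) (by
    rintro _ ⟨a, ha, rfl⟩
    filter_upwards [resolvent_pow_powGaussL2_ae hν ha hR d, ae_restrict_mem measurableSet_Ioi]
      with r h2 hr
    rw [h2, hκ_inner r hr _ _ (powGaussL2_ae hp ha), ← integral_complex_ofReal]
    push_cast
    rfl) f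
  filter_upwards [h1, ae_restrict_mem measurableSet_Ioi] with r h2 hr
  exact ⟨MemLp.integrable_mul (p := 2) (q := 2) (memLp_resolventPowKernel hν hd (mem_Ioi.1 hr))
    (Lp.memLp f), by rw [h2, hκ_inner r hr f f (ae_eq_refl _)]⟩

/-! ### Uniqueness of continuous kernels -/

/-- If the difference D of the kernels is nonzero at (r, q), it stays within half its size of D (r,
q) on a small square. Applying both kernels to the indicator of the q-side gives ∫ D (x, ·) = 0 for
a.e. x, which is impossible for x near r. -/
theorem IsContinuousKernel.eqOn {A : L2HalfLine →L[ℂ] L2HalfLine} {k k' : ℝ → ℝ → ℂ}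
    (hk : IsContinuousKernel A k) (hk' : IsContinuousKernel A k') {r q : ℝ} (hr : 0 < r)
    (hq : 0 < q) : k r q = k' r q := by
  by_contra hne
  set D : ℝ × ℝ → ℂ := fun x => Function.uncurry k x - Function.uncurry k' x with hD
  have hD0 : D (r, q) ≠ 0 := sub_ne_zero.2 hne
  have hc : ContinuousAt D (r, q) := (hk.1.sub hk'.1).continuousAt
    (prod_mem_nhds (Ioi_mem_nhds hr) (Ioi_mem_nhds hq))
  obtain ⟨ε, hε, hball⟩ := Metric.continuousAt_iff.1 hc (‖D (r, q)‖ / 2)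
    (by have := norm_pos_iff.2 hD0; positivity)
  -- The bounds by r and q keep the square inside the open quadrant.
  set δ := min ε (min r q) with hδ
  have hδ0 : 0 < δ := lt_min hε (lt_min hr hq)
  have hδq : Ioo (q - δ) (q + δ) ⊆ Ioi 0 := fun x hx => by
    have : δ ≤ q := (min_le_right _ _).trans (min_le_right _ _)
    exact mem_Ioi.2 (by linarith [hx.1])
  have hδr : Ioo (r - δ) (r + δ) ⊆ Ioi 0 := fun x hx => by
    have : δ ≤ r := (min_le_right _ _).trans (min_le_left _ _)
    exact mem_Ioi.2 (by linarith [hx.1])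
  have hμ : volume.restrict (Ioi (0 : ℝ)) (Ioo (q - δ) (q + δ)) ≠ ⊤ :=
    ((Measure.restrict_apply_le _ _).trans_lt measure_Ioo_lt_top).ne
  set f : L2HalfLine := indicatorConstLp 2 measurableSet_Ioo hμ (1 : ℂ) with hf
  have hfv : ∀ φ : ℝ → ℂ, (fun x => φ x * f x) =ᵐ[volume.restrict (Ioi (0 : ℝ))]
      (Ioo (q - δ) (q + δ)).indicator φ := fun φ => by
    filter_upwards [indicatorConstLp_coeFn (p := 2) (hs := measurableSet_Ioo) (hμs := hμ)
      (c := (1 : ℂ))] with x hx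
    rw [hf, hx]
    by_cases h : x ∈ Ioo (q - δ) (q + δ)
    · rw [indicator_of_mem h, indicator_of_mem h, mul_one]
    · rw [indicator_of_notMem h, indicator_of_notMem h, mul_zero]
  have hnull : ∀ᵐ x ∂volume.restrict (Ioi (0 : ℝ)), x ∉ Ioo (r - δ) (r + δ) := by
    filter_upwards [hk.2 f, hk'.2 f] with x h1 h2 hx
    have h3 : IntegrableOn (fun y => D (x, y)) (Ioo (q - δ) (q + δ)) ∧
        ∫ y in Ioo (q - δ) (q + δ), D (x, y) = 0 := by
      have e1 := (integrable_indicator_iff measurableSet_Ioo).1 (h1.1.congr (hfv _))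
      have e2 := (integrable_indicator_iff measurableSet_Ioo).1 (h2.1.congr (hfv _))
      rw [IntegrableOn, Measure.restrict_restrict_of_subset hδq] at e1 e2
      refine ⟨e1.sub e2, ?_⟩
      have e3 := h1.2.symm.trans h2.2
      rw [integral_congr_ae (hfv _), integral_congr_ae (hfv _),
        integral_indicator measurableSet_Ioo, integral_indicator measurableSet_Ioo,
        Measure.restrict_restrict_of_subset hδq] at e3
      simp only [hD, Function.uncurry_apply_pair]
      rw [integral_sub e1 e2, e3, sub_self]
    have h4 : ∀ y ∈ Ioo (q - δ) (q + δ), ‖D (x, y) - D (r, q)‖ ≤ ‖D (r, q)‖ / 2 := by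
      intro y hy
      have h5 : dist (x, y) (r, q) < ε := by
        rw [Prod.dist_eq, max_lt_iff, Real.dist_eq, Real.dist_eq, abs_lt, abs_lt]
        have : δ ≤ ε := min_le_left _ _
        exact ⟨⟨by linarith [hx.1], by linarith [hx.2]⟩, ⟨by linarith [hy.1], by linarith [hy.2]⟩⟩
      exact (dist_eq_norm (D (x, y)) _ ▸ hball h5).le
    have h6 := norm_setIntegral_le_of_norm_le_const (μ := volume)
      (measure_Ioo_lt_top (a := q - δ) (b := q + δ)) h4
    rw [integral_sub h3.1 (integrableOn_const (by simp)), h3.2, zero_sub, norm_neg,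
      setIntegral_const, norm_smul, Real.volume_real_Ioo_of_le (by linarith),
      Real.norm_of_nonneg (by linarith)] at h6
    have := norm_pos_iff.2 hD0
    nlinarith
  rw [ae_restrict_iff' measurableSet_Ioi] at hnull
  have h0 : volume (Ioo (r - δ) (r + δ)) = 0 := by
    refine measure_mono_null (fun x hx => ?_) hnull
    exact fun h => h (hδr hx) hx
  rw [Real.volume_Ioo, ENNReal.ofReal_eq_zero] at h0
  linarith

/-! ### The Mellin transform of the kernel on the diagonal -/

/-- On the diagonal the Gaussian in r - q is 1 and √(r·r) = r, which leaves r times a superposition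
of dilates of the scaled Bessel function at r². -/
theorem resolventPowKernel_diag (ν : ℝ) (d : ℕ) {r : ℝ} (hr : 0 < r) :
    (resolventPowKernel ν d r r : ℂ) = (d.factorial : ℂ)⁻¹ * (r * ∫ t in Ioi (0 : ℝ),
      ((t ^ d * Real.exp (-t) * (2 * t)⁻¹ : ℝ) : ℂ) *
        (scaledBesselI ν ((2 * t)⁻¹ * r ^ (2 : ℝ)) : ℂ)) := by
  rw [resolventPowKernel_eq, Real.sqrt_mul_self hr.le]
  push_cast
  rw [← integral_complex_ofReal, mul_assoc]
  congr 3
  funext t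
  rw [sub_self, Real.rpow_two, show (2 * t)⁻¹ * r ^ 2 = r * r / (2 * t) by ring]
  simp
  ring

theorem integral_gamma_weight {a : ℂ} (d : ℕ) (ha : 0 < (d + a).re) :
    IntegrableOn (fun t : ℝ => ((t ^ d * Real.exp (-t) * (2 * t)⁻¹ : ℝ) : ℂ) *
      (((2 * t)⁻¹ : ℝ) : ℂ) ^ (-a)) (Ioi 0) ∧
    ∫ t in Ioi (0 : ℝ), ((t ^ d * Real.exp (-t) * (2 * t)⁻¹ : ℝ) : ℂ) *
      (((2 * t)⁻¹ : ℝ) : ℂ) ^ (-a) = 2 ^ (a - 1) * Complex.Gamma (d + a) := by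
  have h1 : ∀ t ∈ Ioi (0 : ℝ), ((t ^ d * Real.exp (-t) * (2 * t)⁻¹ : ℝ) : ℂ) *
      (((2 * t)⁻¹ : ℝ) : ℂ) ^ (-a) =
      2 ^ (a - 1) * ((Real.exp (-t) : ℂ) * (t : ℂ) ^ (d + a - 1)) := by
    intro t ht
    have ht := mem_Ioi.1 ht
    have ht0 : (t : ℂ) ≠ 0 := Complex.ofReal_ne_zero.2 ht.ne'
    have e1 : (((2 * t)⁻¹ : ℝ) : ℂ) ^ (-a) = 2 ^ a * (t : ℂ) ^ a := by
      rw [Complex.ofReal_inv, Complex.inv_cpow _ _ (by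
        rw [Complex.arg_ofReal_of_nonneg (by positivity)]
        exact Real.pi_ne_zero.symm), Complex.cpow_neg, inv_inv, Complex.ofReal_mul,
        Complex.mul_cpow_ofReal_nonneg zero_le_two ht.le, Complex.ofReal_ofNat]
    rw [e1, Complex.cpow_sub _ _ two_ne_zero, Complex.cpow_sub _ _ ht0, Complex.cpow_add _ _ ht0,
      Complex.cpow_natCast, Complex.cpow_one, Complex.cpow_one]
    push_cast
    field_simp
  rw [setIntegral_congr_fun measurableSet_Ioi h1, integral_const_mul,
    Complex.Gamma_eq_integral ha, Complex.GammaIntegral]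
  exact ⟨IntegrableOn.congr_fun ((Complex.GammaIntegral_convergent ha).const_mul _)
    (fun t ht => (h1 t ht).symm) measurableSet_Ioi, rfl⟩

/-- With x = r², r^s · r dr = x^(a-1) dx / 2 for a = s/2 + 1. The three hypotheses say Re a > -d, Re
a > -ν and Re a < 1/2: convergence of the t-integral, and of the Mellin integral of the scaled
Bessel function at 0 and at infinity. -/
theorem integral_cpow_mul_resolventPowKernel {ν : ℝ} (d : ℕ) {s : ℂ}
    (h1 : -2 - 2 * (d : ℝ) < s.re) (h2 : -2 - 2 * ν < s.re) (h3 : s.re < -1) :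
    IntegrableOn (fun r : ℝ => (r : ℂ) ^ s * (resolventPowKernel ν d r r : ℂ)) (Ioi 0) ∧
    ∫ r in Ioi (0 : ℝ), (r : ℂ) ^ s * (resolventPowKernel ν d r r : ℂ) =
      Complex.Gamma (d + 1 + s / 2) * Complex.Gamma (-1 / 2 - s / 2) *
          Complex.Gamma (ν + 1 + s / 2) /
        (4 * (Real.sqrt Real.pi : ℂ) * (d.factorial : ℂ) * Complex.Gamma (ν - s / 2)) := by
  set a : ℂ := (s + 2) / (2 : ℝ) with ha
  have ha' : a = s / 2 + 1 := by
    rw [ha, Complex.ofReal_ofNat]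
    ring
  have hare : a.re = s.re / 2 + 1 := by
    rw [ha', Complex.add_re, Complex.div_ofNat_re, Complex.one_re]
  have hm := hasMellin_scaledBesselI (ν := ν) (a := a) (by linarith) (by linarith)
  have hg := integral_gamma_weight (a := a) d (by
    rw [Complex.add_re, Complex.natCast_re]
    linarith)
  set Φ : ℝ → ℂ := fun x => ∫ t in Ioi (0 : ℝ),
    ((t ^ d * Real.exp (-t) * (2 * t)⁻¹ : ℝ) : ℂ) * (scaledBesselI ν ((2 * t)⁻¹ * x) : ℂ) with hΦ
  have hsup : HasMellin Φ a _ := hasMellin_superposition (κ := fun t : ℝ => (2 * t)⁻¹)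
    (g := fun t : ℝ => ((t ^ d * Real.exp (-t) * (2 * t)⁻¹ : ℝ) : ℂ))
    (f := fun x => (scaledBesselI ν x : ℂ)) measurableSet_Ioi (by fun_prop) (by fun_prop)
    (Complex.measurable_ofReal.comp (measurable_scaledBesselI ν))
    (fun t ht => by
      have := mem_Ioi.1 ht
      positivity) hm.1 hg.1
  have hsq : MellinConvergent (fun r => Φ (r ^ (2 : ℝ))) (s + 2) :=
    (MellinConvergent.comp_rpow two_ne_zero).2 hsup.1
  have hval := mellin_comp_rpow Φ (s + 2) 2
  rw [← ha, hsup.2, hg.2, hm.2] at hval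
  have hdiag : ∀ r ∈ Ioi (0 : ℝ), (r : ℂ) ^ s * (resolventPowKernel ν d r r : ℂ) =
      (d.factorial : ℂ)⁻¹ * ((r : ℂ) ^ (s + 2 - 1) • Φ (r ^ (2 : ℝ))) := by
    intro r hr
    have hr := mem_Ioi.1 hr
    rw [resolventPowKernel_diag ν d hr, show s + 2 - 1 = s + 1 by ring,
      Complex.cpow_add _ _ (Complex.ofReal_ne_zero.2 hr.ne'), Complex.cpow_one, smul_eq_mul]
    ring
  refine ⟨IntegrableOn.congr_fun (Integrable.const_mul hsq _) (fun r hr => (hdiag r hr).symm)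
    measurableSet_Ioi, ?_⟩
  rw [setIntegral_congr_fun measurableSet_Ioi hdiag, integral_const_mul]
  change (d.factorial : ℂ)⁻¹ * mellin (fun r => Φ (r ^ (2 : ℝ))) (s + 2) = _
  -- The 4 in the denominator is 2 from the substitution x = r² times 2 from 2^(a-1) / 2^a.
  rw [hval, ha', show (d : ℂ) + (s / 2 + 1) = d + 1 + s / 2 by ring,
    show 1 / 2 - (s / 2 + 1) = -1 / 2 - s / 2 by ring,
    show s / 2 + 1 + (ν : ℂ) = ν + 1 + s / 2 by ring,
    show 1 + (ν : ℂ) - (s / 2 + 1) = ν - s / 2 by ring, add_sub_cancel_right,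
    Complex.cpow_add _ _ two_ne_zero, Complex.cpow_one, abs_of_pos (two_pos : (0 : ℝ) < 2),
    Complex.real_smul]
  have e1 : (2 : ℂ) ^ (s / 2) ≠ 0 := by simp [Complex.cpow_eq_zero_iff]
  have e2 : (d.factorial : ℂ) ≠ 0 := Nat.cast_ne_zero.2 d.factorial_ne_zero
  have e3 : (√Real.pi : ℂ) ≠ 0 := Complex.ofReal_ne_zero.2 (Real.sqrt_pos.2 Real.pi_pos).ne'
  push_cast
  simp only [div_eq_mul_inv, mul_inv]
  field_simp
  ring

/-! ### Regularised integrals of integrable functions -/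

/-- The sign σ treats (0, 1] and (1, ∞) at once: where σ log r ≤ 0, the modulus of r^(z-c) is exp
(-σ (Re z - c) |log r|). Convergence at c thus passes to all z on the good side of c, with room to
absorb the logarithm from differentiation. -/
theorem integrableOn_and_differentiableAt_integral_cpow {S : Set ℝ} (hS : MeasurableSet S)
    {σ c : ℝ} (hσ : σ * σ = 1) (hSσ : ∀ r ∈ S, 0 < r ∧ σ * Real.log r ≤ 0) {g : ℝ → ℂ}
    (hg : IntegrableOn (fun r : ℝ => (r : ℂ) ^ (c : ℂ) * g r) S) {w : ℂ}
    (hw : 0 < σ * (w.re - c)) :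
    IntegrableOn (fun r : ℝ => (r : ℂ) ^ w * g r) S ∧
      DifferentiableAt ℂ (fun w : ℂ => ∫ r in S, (r : ℂ) ^ w * g r) w := by
  have hsplit : ∀ z : ℂ, ∀ r ∈ S, (r : ℂ) ^ z * g r =
      (r : ℂ) ^ (z - c) * ((r : ℂ) ^ (c : ℂ) * g r) := by
    intro z r hr
    rw [← mul_assoc, ← Complex.cpow_add _ _ (Complex.ofReal_ne_zero.2 (hSσ r hr).1.ne'),
      sub_add_cancel]
  have hnorm : ∀ {ε : ℝ} {z : ℂ}, ε ≤ σ * (z.re - c) → ∀ r ∈ S,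
      ‖(r : ℂ) ^ (z - c)‖ ≤ Real.exp (-(ε * |Real.log r|)) := by
    intro ε z hz r hr
    obtain ⟨h1, h2⟩ := hSσ r hr
    rw [Complex.norm_cpow_eq_rpow_re_of_pos h1, Complex.sub_re, Complex.ofReal_re,
      Real.rpow_def_of_pos h1, Real.exp_le_exp]
    have h3 : |Real.log r| = -(σ * Real.log r) := by
      have : |σ| = 1 := by
        rw [← sq_eq_sq₀ (abs_nonneg _) zero_le_one, sq_abs, pow_two, hσ, one_pow]
      rw [← abs_of_nonpos h2, abs_mul, this, one_mul]
    rw [h3]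
    have h4 : Real.log r * (z.re - c) = (σ * Real.log r) * (σ * (z.re - c)) := by
      linear_combination (-Real.log r * (z.re - c)) * hσ
    rw [h4]
    nlinarith
  have hmeas : ∀ z : ℂ, AEStronglyMeasurable
      (fun r : ℝ => (r : ℂ) ^ (z - c) * ((r : ℂ) ^ (c : ℂ) * g r)) (volume.restrict S) := fun z =>
    (Measurable.aestronglyMeasurable (by fun_prop)).mul hg.aestronglyMeasurable
  have hint : IntegrableOn (fun r : ℝ => (r : ℂ) ^ (w - c) * ((r : ℂ) ^ (c : ℂ) * g r)) S := by
    refine Integrable.mono hg (hmeas w) ?_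
    filter_upwards [ae_restrict_mem hS] with r hr
    rw [norm_mul]
    refine mul_le_of_le_one_left (norm_nonneg _) ?_
    have := hnorm hw.le r hr
    rwa [zero_mul, neg_zero, Real.exp_zero] at this
  refine ⟨hint.congr_fun (fun r hr => (hsplit w r hr).symm) hS, ?_⟩
  -- Half of the available margin, so that the bound is uniform near w; it gives |log r| exp (-ε
  -- |log r|) ≤ 1/ε.
  set ε : ℝ := σ * (w.re - c) / 2 with hε
  have hε0 : 0 < ε := by positivity
  have hfun : (fun w : ℂ => ∫ r in S, (r : ℂ) ^ w * g r) =
      fun w : ℂ => ∫ r in S, (r : ℂ) ^ (w - c) * ((r : ℂ) ^ (c : ℂ) * g r) := by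
    funext z
    exact setIntegral_congr_fun hS (hsplit z)
  rw [hfun]
  refine (hasDerivAt_integral_of_dominated_loc_of_deriv_le
    (F := fun (z : ℂ) (r : ℝ) => (r : ℂ) ^ (z - c) * ((r : ℂ) ^ (c : ℂ) * g r))
    (F' := fun (z : ℂ) (r : ℝ) => (r : ℂ) ^ (z - c) * Complex.log r * 1 * ((r : ℂ) ^ (c : ℂ) * g r))
    (bound := fun r : ℝ => ε⁻¹ * ‖(r : ℂ) ^ (c : ℂ) * g r‖)
    (s := {z : ℂ | ε < σ * (z.re - c)})
    ((isOpen_lt continuous_const (by fun_prop)).mem_nhds (by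
      change ε < σ * (w.re - c)
      linarith))
    (Eventually.of_forall hmeas) hint
    ((Measurable.aestronglyMeasurable (by fun_prop)).mul hg.aestronglyMeasurable) ?_
    (hg.norm.const_mul _) ?_).2.differentiableAt
  · filter_upwards [ae_restrict_mem hS] with r hr z hz
    rw [norm_mul, mul_one, norm_mul, ← Complex.ofReal_log (hSσ r hr).1.le, Complex.norm_real,
      Real.norm_eq_abs]
    refine mul_le_mul_of_nonneg_right ?_ (norm_nonneg _)
    have h1 := hnorm (le_of_lt hz) r hr
    have h2 := Real.add_one_le_exp (ε * |Real.log r|)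
    calc ‖(r : ℂ) ^ (z - c)‖ * |Real.log r| ≤
        Real.exp (-(ε * |Real.log r|)) * |Real.log r| := by gcongr
      _ ≤ ε⁻¹ := by
        rw [Real.exp_neg, inv_mul_le_iff₀ (Real.exp_pos _), mul_comm, ← div_eq_inv_mul,
          le_div_iff₀ hε0]
        linarith
  · filter_upwards [ae_restrict_mem hS] with r hr z _
    exact (((hasDerivAt_id z).sub_const (c : ℂ)).const_cpow
      (Or.inl (Complex.ofReal_ne_zero.2 (hSσ r hr).1.ne'))).mul_const _

/-- Convergence on a strip around 0 makes both truncated integrals holomorphic on half-planes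
containing 0. They are their own continuations, the polar part is the zero polynomial, and the
constant term is the value at w = 0. -/
theorem isRegularizedIntegral_of_integrableOn {g : ℝ → ℂ} {α β : ℝ} (hα : α < 0) (hβ : 0 < β)
    (h : ∀ x : ℝ, α < x → x < β →
      IntegrableOn (fun r : ℝ => (r : ℂ) ^ (x : ℂ) * g r) (Ioi 0)) :
    IsRegularizedIntegral g (∫ r in Ioi (0 : ℝ), g r) := by
  set δ : ℝ := min (-α) β / 2 with hδ
  have hδ0 : 0 < δ := by
    have : 0 < min (-α) β := lt_min (by linarith) hβ
    positivity
  have hδα : α < -δ := by linarith [min_le_left (-α) β]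
  have hδβ : δ < β := by linarith [min_le_right (-α) β]
  have hF := fun (w : ℂ) (hw : -δ < w.re) => integrableOn_and_differentiableAt_integral_cpow
    (S := Ioc 0 1) (σ := 1) (c := -δ) (g := g) (w := w) measurableSet_Ioc (one_mul 1)
    (fun r hr => ⟨hr.1, by rw [one_mul]; exact Real.log_nonpos hr.1.le hr.2⟩)
    ((h (-δ) hδα (by linarith)).mono_set Ioc_subset_Ioi_self) (by linarith)
  have hG := fun (w : ℂ) (hw : w.re < δ) => integrableOn_and_differentiableAt_integral_cpow
    (S := Ioi 1) (σ := -1) (c := δ) (g := g) (w := w) measurableSet_Ioi (by norm_num)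
    (fun r hr => ⟨zero_lt_one.trans (mem_Ioi.1 hr), by
      have := Real.log_nonneg (mem_Ioi.1 hr).le
      linarith⟩)
    ((h δ (by linarith) hδβ).mono_set (Ioi_subset_Ioi zero_le_one)) (by linarith)
  have hF0 := hF 0 (by simpa using hδ0)
  have hG0 := hG 0 (by simpa using hδ0)
  refine ⟨fun w => ∫ r in Ioc (0 : ℝ) 1, (r : ℂ) ^ w * g r,
    fun w => ∫ r in Ioi (1 : ℝ), (r : ℂ) ^ w * g r, δ, -δ, δ, hδ0, ?_, ?_,
    fun w hw => ⟨(hF w hw).1, rfl⟩, fun w hw => ⟨(hG w hw).1, rfl⟩, 0, by simp, ?_⟩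
  · exact (DifferentiableOn.analyticOnNhd
      (fun w hw => (hF w hw).2.differentiableWithinAt)
      (isOpen_lt continuous_const Complex.continuous_re)).meromorphicOn
  · exact (DifferentiableOn.analyticOnNhd
      (fun w hw => (hG w hw).2.differentiableWithinAt)
      (isOpen_lt Complex.continuous_re continuous_const)).meromorphicOn
  · have hsum : ∫ r in Ioi (0 : ℝ), g r = (∫ r in Ioc (0 : ℝ) 1, (r : ℂ) ^ (0 : ℂ) * g r) +
        ∫ r in Ioi (1 : ℝ), (r : ℂ) ^ (0 : ℂ) * g r := by
      rw [← setIntegral_union (Ioc_disjoint_Ioi le_rfl) measurableSet_Ioi hF0.1 hG0.1,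
        Ioc_union_Ioi_eq_Ioi zero_le_one]
      simp
    rw [hsum]
    simp only [Polynomial.eval_zero, sub_zero]
    exact ((hF0.2.add hG0.2).continuousAt.tendsto).mono_left nhdsWithin_le_nhds

end FriedrichsKernel

/-! ### The main theorem. -/

theorem proposition3p2 (ν : ℝ) (hν : 0 ≤ ν) (d : ℕ) (hd : 1 < d) :
    (∃! R : FriedrichsKernel.L2HalfLine →L[ℂ] FriedrichsKernel.L2HalfLine,
      FriedrichsKernel.IsResolvent (FriedrichsKernel.besselFriedrichs ν) 1 R) ∧
    ∀ R : FriedrichsKernel.L2HalfLine →L[ℂ] FriedrichsKernel.L2HalfLine,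
      FriedrichsKernel.IsResolvent (FriedrichsKernel.besselFriedrichs ν) 1 R →
      (∃ k : ℝ → ℝ → ℂ, FriedrichsKernel.IsContinuousKernel (R ^ (d + 1)) k) ∧
      ∀ k : ℝ → ℝ → ℂ, FriedrichsKernel.IsContinuousKernel (R ^ (d + 1)) k →
        ∀ s : ℂ, max (-2 - 2 * (d : ℝ)) (-2 - 2 * ν) < s.re → s.re < -1 →
          IntegrableOn (fun r : ℝ => (r : ℂ) ^ s * k r r) (Ioi 0) ∧
          ∫ r in Ioi (0 : ℝ), (r : ℂ) ^ s * k r r =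
            Complex.Gamma (d + 1 + s / 2) * Complex.Gamma (-1 / 2 - s / 2) *
                Complex.Gamma (ν + 1 + s / 2) /
              (4 * (Real.sqrt Real.pi : ℂ) * (d.factorial : ℂ) * Complex.Gamma (ν - s / 2)) ∧
          FriedrichsKernel.IsRegularizedIntegral (fun r : ℝ => (r : ℂ) ^ s * k r r)
            (Complex.Gamma (d + 1 + s / 2) * Complex.Gamma (-1 / 2 - s / 2) *
                Complex.Gamma (ν + 1 + s / 2) /
              (4 * (Real.sqrt Real.pi : ℂ) * (d.factorial : ℂ) * Complex.Gamma (ν - s / 2))) := by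
  refine ⟨FriedrichsKernel.existsUnique_isResolvent hν, fun R hR => ?_⟩
  have hker := FriedrichsKernel.isContinuousKernel_resolventPowKernel hν hR hd.le
  refine ⟨⟨_, hker⟩, fun k hk s hs1 hs2 => ?_⟩
  obtain ⟨hs3, hs4⟩ := max_lt_iff.1 hs1
  -- By uniqueness, an arbitrary continuous kernel has the diagonal of the explicit one.
  have hdiag : ∀ z : ℂ, ∀ r ∈ Ioi (0 : ℝ), (r : ℂ) ^ z * k r r =
      (r : ℂ) ^ z * (FriedrichsKernel.resolventPowKernel ν d r r : ℂ) := fun z r hr => by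
    rw [hk.eqOn hker (mem_Ioi.1 hr) (mem_Ioi.1 hr)]
  have hint : ∀ z : ℂ, -2 - 2 * (d : ℝ) < z.re → -2 - 2 * ν < z.re → z.re < -1 →
      IntegrableOn (fun r : ℝ => (r : ℂ) ^ z * k r r) (Ioi 0) := fun z h1 h2 h3 =>
    (FriedrichsKernel.integral_cpow_mul_resolventPowKernel d h1 h2 h3).1.congr_fun
      (fun r hr => (hdiag z r hr).symm) measurableSet_Ioi
  have hval := (setIntegral_congr_fun measurableSet_Ioi (hdiag s)).trans
    (FriedrichsKernel.integral_cpow_mul_resolventPowKernel d hs3 hs4 hs2).2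
  refine ⟨hint s hs3 hs4 hs2, hval, ?_⟩
  rw [← hval]
  -- Since r^x · r^s = r^(x+s), the admissible x form the original strip translated by -Re s, an
  -- open interval around 0.
  refine FriedrichsKernel.isRegularizedIntegral_of_integrableOn
    (α := max (-2 - 2 * (d : ℝ)) (-2 - 2 * ν) - s.re) (β := -1 - s.re) (by linarith) (by linarith)
    fun x hx1 hx2 => ?_
  have hx3 := (le_max_left _ _).trans_lt (sub_lt_iff_lt_add.1 hx1)
  have hx4 := (le_max_right _ _).trans_lt (sub_lt_iff_lt_add.1 hx1)
  refine (hint (x + s) ?_ ?_ ?_).congr_fun (fun r hr => ?_) measurableSet_Ioi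
  · simpa using hx3
  · simpa using hx4
  · simp only [Complex.add_re, Complex.ofReal_re]
    linarith
  · simp only
    rw [Complex.cpow_add _ _ (Complex.ofReal_ne_zero.2 (mem_Ioi.1 hr).ne'), mul_assoc]
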